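/- **Setting.** For $c\ge 0$ and $\kappa\in\mathbb R$ consider the travelling-wave equation $$icu'+u''+u(1-|u|^2)+\kappa u\,(1-|u|^2)''=0\qquad\text{on }\mathbb R,\tag{TW}$$ in the energy space $\mathcal X(\mathbb R)=\{v\in H^1_{\rm loc}(\mathbb R;\mathbb C):\ 1-|v|^2\in L^2(\mathbb R),\ v'\in L^2(\mathbb R)\}$, whose elements are identified with their continuous representatives. A solution is a function $u\in\mathcal X(\mathbb R)$ such that, with $\langle z,w\rangle=\operatorname{Re}z\operatorname{Re}w+\operatorname{Im}z\operatorname{Im}w$, $$\int_{\mathbb R}\langle icu'+u(1-|u|^2),\phi\rangle-\langle u',\phi'\rangle+2\kappa\langle u,u'\rangle\langle u,\phi\rangle'=0\qquad\text{for all }\phi\in C_0^\infty(\mathbb R;\mathbb C).$$ Write $\eta_u=1-|u|^2$ and $$\Gamma(u)=\{x:|u(x)|^2=\tfrac1{2\kappa}\},\quad \mathcal Z(u)=\{x\notin\Gamma(u):x\text{ is a local extremum of }\eta_u\},\quad \mathcal N(u)=\{x:u\text{ is not differentiable at }x\}.$$ Let $$\mathcal D_1=\{0\le c<\sqrt2,\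 0<\kappa<\tfrac12\},\quad \mathcal D_3=\{c>\sqrt2,\ \kappa>\tfrac12\},\quad \mathcal B_-=\{c=\sqrt2,\ 0<\kappa<\tfrac12\},\quad \mathcal B_+=\{c=\sqrt2,\ \kappa>\tfrac12\},$$ $\tilde{\mathcal D}=\mathcal D_1\cup\mathcal D_3\cup\mathcal B_-\cup\mathcal B_+$ and $\mathcal C=\{c\ge0,\ \kappa=\tfrac12\}$. **Proposition 1.8 (Composite waves).** For every $(c,\kappa)\in\tilde{\mathcal D}\cup\mathcal C$ there is a negative constant $A<1-\frac1{2\kappa}$ such that, for every $\eta_0\in(-\infty,A)$, there exists a solution $u\in\mathcal X(\mathbb R)$ of (TW), unique up to a phase shift $u\mapsto e^{i\varphi}u$ with $\varphi\in\mathbb R$, satisfying $$\mathcal Z(u)=\{0\}\quad\text{and}\quad \eta_u(0)=\eta_0.$$ Moreover $\inf_{\mathbb R}|u|>0$, $\eta_0$ is the global minimum of $\eta_u$, and $\mathcal N(u)$ has exactly two elements. In addition, if $(c,\kappa)\in\tilde{\mathcal D}$, then $\Gamma(u)=\mathcal N(u)$, whereas if $(c,\kappa)\in\mathcal C$, then $u$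 is a compacton, i.e. $\eta_u$ is compactly supported. -/

import Mathlib

open MeasureTheory
open scoped ContDiff

noncomputable section

namespace QuasilinearGP

/-- `0 ≤ c < √2` and `0 < κ < 1/2`. -/
def D₁ : Set (ℝ × ℝ) := {p | 0 ≤ p.1 ∧ p.1 < Real.sqrt 2 ∧ 0 < p.2 ∧ p.2 < 1 / 2}

/-- `c > √2` and `κ > 1/2`. -/
def D₃ : Set (ℝ × ℝ) := {p | Real.sqrt 2 < p.1 ∧ 1 / 2 < p.2}

/-- `c = √2` and `0 < κ < 1/2`. -/
def Bminus : Set (ℝ × ℝ) := {p | p.1 = Real.sqrt 2 ∧ 0 < p.2 ∧ p.2 < 1 / 2}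

/-- `c = √2` and `κ > 1/2`. -/
def Bplus : Set (ℝ × ℝ) := {p | p.1 = Real.sqrt 2 ∧ 1 / 2 < p.2}

/-- The parameter set `D̃ = D₁ ∪ D₃ ∪ B₋ ∪ B₊`. -/
def Dtilde : Set (ℝ × ℝ) := D₁ ∪ D₃ ∪ Bminus ∪ Bplus

/-- The critical set `C`: `c ≥ 0` and `κ = 1/2`. -/
def Ccrit : Set (ℝ × ℝ) := {p | 0 ≤ p.1 ∧ p.2 = 1 / 2}

/-- `g` is the weak (distributional) derivative of `v` on `ℝ`. -/
def HasWeakDeriv (v g : ℝ → ℂ) : Prop :=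
  LocallyIntegrable v volume ∧ LocallyIntegrable g volume ∧
    ∀ φ : ℝ → ℝ, ContDiff ℝ ∞ φ → HasCompactSupport φ →
      ∫ x, deriv φ x • v x = -∫ x, φ x • g x

/-- `v ∈ L²_loc(ℝ)`. -/
def LocL2 (v : ℝ → ℂ) : Prop :=
  ∀ K : Set ℝ, IsCompact K → MemLp v 2 (volume.restrict K)

/-- `v ∈ H¹_loc(ℝ)`. -/
def InH1loc (v : ℝ → ℂ) : Prop :=
  LocL2 v ∧ ∃ g : ℝ → ℂ, HasWeakDeriv v g ∧ LocL2 g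

/-- The intensity profile `η = 1 - |u|²`. -/
def eta (u : ℝ → ℂ) (x : ℝ) : ℝ := 1 - ‖u x‖ ^ 2

/-- The energy space `X(ℝ)`: functions in `H¹_loc(ℝ)` with `1 - |v|² ∈ L²(ℝ)` and
`v' ∈ L²(ℝ)`. Each class of `H¹_loc(ℝ)` contains exactly one continuous function, and an element
of `X(ℝ)` is identified with it; this is what gives a meaning to pointwise values. -/
def InX (v : ℝ → ℂ) : Prop :=
  Continuous v ∧ InH1loc v ∧ MemLp (eta v) 2 volume ∧
    ∃ g : ℝ → ℂ, HasWeakDeriv v g ∧ MemLp g 2 volume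

/-- The nonvanishing energy space `NX(ℝ)`. -/
def InNX (v : ℝ → ℂ) : Prop :=
  InX v ∧ 0 < ⨅ x : ℝ, ‖v x‖

/-- Weak solutions of `i c u' + u'' + u (1 - |u|²) + κ u (1 - |u|²)'' = 0`: with `g = u'`,
`∫ ⟨i c u' + u (1 - |u|²), φ⟩ - ⟨u', φ'⟩ + 2 κ ⟨u, u'⟩ ⟨u, φ⟩' = 0` for all
`φ ∈ C₀^∞(ℝ; ℂ)`, where `⟨z, w⟩ = Re z Re w + Im z Im w` is the real inner product of `ℂ` and
`⟨u, φ⟩' = ⟨u', φ⟩ + ⟨u, φ'⟩`. -/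
def IsWeakSolution (c κ : ℝ) (u : ℝ → ℂ) : Prop :=
  ∃ g : ℝ → ℂ, HasWeakDeriv u g ∧
    ∀ φ : ℝ → ℂ, ContDiff ℝ ∞ φ → HasCompactSupport φ →
      ∫ x, (inner ℝ (Complex.I * (c : ℂ) * g x + u x * ((eta u x : ℝ) : ℂ)) (φ x)
        - inner ℝ (g x) (deriv φ x)
        + 2 * κ * inner ℝ (u x) (g x)
            * (inner ℝ (g x) (φ x) + inner ℝ (u x) (deriv φ x))) = 0

/-- The singular set `Γ(u) = {x : |u(x)|² = 1/(2κ)}`. -/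
def singularSet (κ : ℝ) (u : ℝ → ℂ) : Set ℝ := {x | ‖u x‖ ^ 2 = 1 / (2 * κ)}

/-- `𝒵(u)`: the points outside `Γ(u)` that are local extrema of `1 - |u|²`. -/
def regularExtrema (κ : ℝ) (u : ℝ → ℂ) : Set ℝ :=
  {x | x ∉ singularSet κ u ∧ IsLocalExtr (eta u) x}

/-- `𝒩(u)`: the points where `u` is not differentiable in the classical sense. -/
def nondiffSet (u : ℝ → ℂ) : Set ℝ := {x | ¬ DifferentiableAt ℝ u x}

/-- `u ∈ X(ℝ)` is a solution with `𝒵(u) = {0}` and `η(0) = η₀`. -/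
structure IsCompositeWave (c κ η₀ : ℝ) (u : ℝ → ℂ) : Prop where
  inX : InX u
  sol : IsWeakSolution c κ u
  extrema : regularExtrema κ u = {0}
  value : eta u 0 = η₀

end QuasilinearGP

end

/-! Write `u = √(1-η) e^{iθ}`. The component of the equation along `iu` integrates to the momentum
law `⟨iu,u'⟩ = cη/2`, finite energy killing the constant, so `θ' = cη/(2(1-η))` is determined by
`η`. The component along `u` is a scalar equation for `η`, whose leading coefficient `D = 1-2κ(1-η)
= 2κ(η-η*)` degenerates at `η* = 1-1/(2κ)`. Where `D ≠ 0` and `η < 1`, the quantity `E = (Dη'² -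
η²(2-c²-2η))/(1-η)` is locally constant. The weak equation keeps the flux `q = Dη'` continuous
through `η = η*`, but allows `E` to jump there.

A composite wave exploits this jump. The inner arc starts at `η₀` with `q = 0` and a nonzero `E`,
and rises to `η*`, where its slope blows up like `(η*-η)^(-1/2)`: still square integrable, but not
differentiable. On the outer arcs finite energy forces `E = 0`, that is `Dη'² = η²(2-c²-2η)`; the
conditions on `(c,κ)` give both factors `D` and `2-c²-2η` the same sign between `η*` and `0`. For `κ
= 1/2` one has `η* = 0` and the outer arcs are `η = 0`, whence the compacton.

Existence: the profile is explicit in a parameter `p` (`profEta`, `profRate`, `profFlux`), with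
`dx/dp` continuous and vanishing only at the two crossings, so `x ↦ p` is obtained by inverting a
strictly increasing function (`exists_inverse_clock`). `ScalarProfile` then turns profile, slope and
flux into a weak solution through the momentum law.

Uniqueness: `exists_realWave` and `RealWave.scalarWave` recover the momentum law and the scalar
system from the weak equation. The first integral and the absence of other regular extrema force the
inner arc up to `η*` (`eq_profile_inner`). Beyond it `|η-η*|` cannot decrease, plateaus at `η*` are
excluded algebraically when `κ ≠ 1/2`, and square integrability drives `η` along the outer arc
(`eq_profile_outer`). Two waves then have the same logarithmic derivative off two points, so their
quotient is a constant of modulus one. -/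

namespace QuasilinearGP

open Set Filter Topology

/-! ### Absolutely continuous functions and weak derivatives -/

/-- `f` is locally absolutely continuous with almost everywhere derivative `f'`. -/
def HasAEDeriv (f f' : ℝ → ℝ) : Prop :=
  (∀ a b : ℝ, AbsolutelyContinuousOnInterval f a b) ∧ ∀ᵐ x, HasDerivAt f (f' x) x

theorem HasAEDeriv.mul {f f' g g' : ℝ → ℝ} (hf : HasAEDeriv f f') (hg : HasAEDeriv g g') :
    HasAEDeriv (fun x => f x * g x) (fun x => f' x * g x + f x * g' x) := by
  refine ⟨fun a b => (hf.1 a b).mul (hg.1 a b), ?_⟩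
  filter_upwards [hf.2, hg.2] with x h1 h2 using h1.mul h2

theorem HasAEDeriv.add {f f' g g' : ℝ → ℝ} (hf : HasAEDeriv f f') (hg : HasAEDeriv g g') :
    HasAEDeriv (fun x => f x + g x) (fun x => f' x + g' x) := by
  refine ⟨fun a b => (hf.1 a b).add (hg.1 a b), ?_⟩
  filter_upwards [hf.2, hg.2] with x h1 h2 using h1.add h2

theorem HasAEDeriv.sub {f f' g g' : ℝ → ℝ} (hf : HasAEDeriv f f') (hg : HasAEDeriv g g') :
    HasAEDeriv (fun x => f x - g x) (fun x => f' x - g' x) := by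
  refine ⟨fun a b => (hf.1 a b).sub (hg.1 a b), ?_⟩
  filter_upwards [hf.2, hg.2] with x h1 h2 using h1.sub h2

theorem HasAEDeriv.const_mul {f f' : ℝ → ℝ} (r : ℝ) (hf : HasAEDeriv f f') :
    HasAEDeriv (fun x => r * f x) (fun x => r * f' x) := by
  refine ⟨fun a b => (hf.1 a b).const_mul r, ?_⟩
  filter_upwards [hf.2] with x h1 using h1.const_mul r

theorem hasAEDeriv_const (r : ℝ) : HasAEDeriv (fun _ => r) (fun _ => 0) := by
  refine ⟨fun a b => ?_, Eventually.of_forall fun x => hasDerivAt_const x r⟩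
  exact contDiffOn_const.absolutelyContinuousOnInterval

theorem HasAEDeriv.continuous {f f' : ℝ → ℝ} (hf : HasAEDeriv f f') : Continuous f := by
  rw [continuous_iff_continuousAt]
  intro x
  have h := (hf.1 (x - 1) (x + 1)).continuousOn
  rw [uIcc_of_le (by linarith)] at h
  exact h.continuousAt (Icc_mem_nhds (by linarith) (by linarith))

theorem HasAEDeriv.eq_of_ae_zero {f f' : ℝ → ℝ} (hf : HasAEDeriv f f') (h : ∀ᵐ x, f' x = 0)
    (x y : ℝ) : f x = f y := by
  obtain ⟨C, hC⟩ := (hf.1 x y).const_of_ae_hasDerivAt_zero (by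
    filter_upwards [hf.2, h] with z h1 h2 _
    rwa [h2] at h1)
  rw [hC x left_mem_uIcc, hC y right_mem_uIcc]

/-- Absolute continuity recovers `f` by integrating its derivative, and the integral only sees the
continuous representative `g`. This is how classical regularity is regained off the singular set. -/
theorem HasAEDeriv.hasDerivAt_of_ae_eq {f f' g : ℝ → ℝ} {U : Set ℝ} (hf : HasAEDeriv f f')
    (hU : IsOpen U) (hg : ContinuousOn g U) (h : ∀ᵐ x, x ∈ U → f' x = g x) {x : ℝ} (hx : x ∈ U) :
    HasDerivAt f (g x) x := by
  obtain ⟨ε, hε, hb⟩ := Metric.isOpen_iff.1 hU x hx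
  have hd : ∀ᵐ y, y ∈ U → deriv f y = g y := by
    filter_upwards [hf.2, h] with y h1 h2 hy
    rw [h1.deriv, h2 hy]
  have hball : ∀ y ∈ Metric.ball x ε, uIcc x y ⊆ U := fun y hy =>
    ((convex_ball x ε).ordConnected.uIcc_subset (Metric.mem_ball_self hε) hy).trans hb
  have key : ∀ y ∈ Metric.ball x ε, f y = f x + ∫ t in x..y, g t := by
    intro y hy
    have h1 := (hf.1 x y).integral_deriv_eq_sub
    have h2 : ∫ t in x..y, deriv f t = ∫ t in x..y, g t := by
      apply intervalIntegral.integral_congr_ae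
      filter_upwards [hd] with t ht hty
      exact ht (hball y hy (uIoc_subset_uIcc hty))
    linarith
  have hgx : ContinuousAt g x := hg.continuousAt (hU.mem_nhds hx)
  have hint : HasDerivAt (fun y => ∫ t in x..y, g t) (g x) x := by
    refine intervalIntegral.integral_hasDerivAt_right (by simp) ?_ hgx
    exact hg.stronglyMeasurableAtFilter hU x hx
  refine (hint.const_add (f x)).congr_of_eventuallyEq ?_
  filter_upwards [Metric.ball_mem_nhds x hε] with y hy using key y hy

theorem hasAEDeriv_integral {F : ℝ → ℝ} (hF : LocallyIntegrable F volume) :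
    HasAEDeriv (fun x => ∫ t in (0 : ℝ)..x, F t) F := by
  have hi : ∀ a b, IntervalIntegrable F volume a b := fun a b => intervalIntegrable_iff.mpr <|
      (hF.integrableOn_isCompact isCompact_uIcc).mono_set uIoc_subset_uIcc
  constructor
  · intro a b
    have h := (hi (min (min a b) 0) (max (max a b) 0)).absolutelyContinuousOnInterval_intervalIntegral
      (c := 0) (by rw [uIcc_of_le (by simp)]; simp)
    refine h.mono ?_
    rw [uIcc_of_le (by simp : min (min a b) 0 ≤ max (max a b) 0), uIcc]
    exact Icc_subset_Icc (min_le_left _ _) (le_max_left _ _)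
  · filter_upwards [_root_.LocallyIntegrable.ae_hasDerivAt_integral hF] with x hx using hx 0

/-- The integral of the derivative of a compactly supported function vanishes. -/
theorem integral_deriv_eq_zero_off_countable {E : Type*} [NormedAddCommGroup E] [NormedSpace ℝ E]
    [CompleteSpace E] {f f' : ℝ → E} {s : Set ℝ} (hs : s.Countable) (hf : Continuous f)
    (hc : HasCompactSupport f) (hd : ∀ x, x ∉ s → HasDerivAt f (f' x) x) (hi : Integrable f') :
    ∫ x, f' x = 0 := by
  obtain ⟨L, hL⟩ := hc.isBounded.subset_ball (0 : ℝ)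
  have hz : ∀ x, L ≤ |x| → f x = 0 := fun x hx => by
    by_contra h
    have := hL (subset_tsupport f h)
    simp at this; linarith
  have h1 := intervalIntegral_tendsto_integral hi tendsto_neg_atTop_atBot tendsto_id
  refine tendsto_nhds_unique h1 (tendsto_const_nhds.congr' ?_)
  filter_upwards [eventually_ge_atTop (max L 0)] with x hx
  have hx1 : L ≤ x := (le_max_left _ _).trans hx
  have hx0 : 0 ≤ x := (le_max_right _ _).trans hx
  have := integral_eq_of_hasDerivAt_off_countable f f' (a := -x) (b := x) hs hf.continuousOn
    (fun y hy => hd y hy.2) hi.intervalIntegrable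
  simp only [id]
  rw [this, hz x (by rwa [abs_of_nonneg hx0]), hz (-x) (by rwa [abs_neg, abs_of_nonneg hx0])]
  simp

theorem eq_of_hasDerivAt_zero_off_countable {E : Type*} [NormedAddCommGroup E] [NormedSpace ℝ E]
    [CompleteSpace E] {f : ℝ → E} {s : Set ℝ} (hs : s.Countable) (hf : Continuous f)
    (hd : ∀ x, x ∉ s → HasDerivAt f 0 x) (x y : ℝ) : f x = f y := by
  have := integral_eq_of_hasDerivAt_off_countable f (fun _ => 0) (a := y) (b := x) hs
    hf.continuousOn (fun z hz => hd z hz.2) (by simp)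
  simp only [intervalIntegral.integral_zero] at this
  exact (sub_eq_zero.1 this.symm)

/-- The primitive started to the left of the support is constant to its right, and that constant is
the integral of `ψ`; mean zero is what makes the support compact. -/
theorem exists_contDiff_primitive {ψ : ℝ → ℝ} (hψ : ContDiff ℝ ∞ ψ) (hc : HasCompactSupport ψ)
    (h0 : ∫ x, ψ x = 0) :
    ∃ φ : ℝ → ℝ, ContDiff ℝ ∞ φ ∧ HasCompactSupport φ ∧ deriv φ = ψ := by
  obtain ⟨L, hL⟩ := hc.isBounded.subset_ball (0 : ℝ)
  have hz : ∀ x, L ≤ |x| → ψ x = 0 := fun x hx => by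
    by_contra h
    have := hL (subset_tsupport ψ h)
    simp at this; linarith
  have hi : Integrable ψ := hψ.continuous.integrable_of_hasCompactSupport hc
  let φ : ℝ → ℝ := fun x => ∫ t in (-|L|)..x, ψ t
  have hd : ∀ x, HasDerivAt φ (ψ x) x := fun x =>
    intervalIntegral.integral_hasDerivAt_right hi.intervalIntegrable
      hψ.continuous.stronglyMeasurable.stronglyMeasurableAtFilter hψ.continuous.continuousAt
  have hder : deriv φ = ψ := funext fun x => (hd x).deriv
  refine ⟨φ, ?_, ?_, hder⟩
  · rw [contDiff_infty_iff_deriv]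
    exact ⟨fun x => (hd x).differentiableAt, hder ▸ hψ⟩
  · refine HasCompactSupport.intro (K := Icc (-|L|) |L|) isCompact_Icc fun x hx => ?_
    have hx' : x < -|L| ∨ |L| < x := by
      by_contra h
      push Not at h
      exact hx h
    rcases hx' with hx' | hx'
    · refine intervalIntegral.integral_zero_ae (Eventually.of_forall fun t ht => hz t ?_)
      rw [uIoc_of_ge hx'.le] at ht
      have : |L| ≤ |t| := by have := neg_le_abs t; linarith [ht.2]
      linarith [le_abs_self L]
    · have h1 : φ x = ∫ t, ψ t := by
        refine intervalIntegral.integral_eq_integral_of_support_subset fun t ht => ?_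
        have h2 : |t| < L := by
          by_contra h
          exact ht (hz t (not_lt.1 h))
        have h3 := abs_lt.1 h2
        have h4 := le_abs_self L
        exact ⟨by linarith, by linarith⟩
      rw [h1, h0]

/-- A locally integrable function with zero weak derivative is constant. -/
theorem ae_eq_const_of_weakDeriv_zero {w : ℝ → ℝ} (hw : LocallyIntegrable w volume)
    (h : ∀ φ : ℝ → ℝ, ContDiff ℝ ∞ φ → HasCompactSupport φ → ∫ x, deriv φ x * w x = 0) :
    ∃ C : ℝ, ∀ᵐ x, w x = C := by
  let b : ContDiffBump (0 : ℝ) := default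
  let ψ₀ : ℝ → ℝ := b.normed volume
  have hψ₀ : ContDiff ℝ ∞ ψ₀ := b.contDiff_normed
  have hψ₀c : HasCompactSupport ψ₀ := b.hasCompactSupport_normed
  have hψ₀i : ∫ x, ψ₀ x = 1 := b.integral_normed
  have hint : ∀ {g : ℝ → ℝ}, ContDiff ℝ ∞ g → HasCompactSupport g →
      Integrable (fun x => g x * w x) := fun hg hc =>
    hw.integrable_smul_left_of_hasCompactSupport hg.continuous hc
  refine ⟨∫ x, ψ₀ x * w x, ?_⟩
  refine ae_eq_of_integral_contDiff_smul_eq hw (continuous_const.locallyIntegrable) fun g hg hc => ?_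
  have hgi : Integrable g := hg.continuous.integrable_of_hasCompactSupport hc
  have hψi : Integrable ψ₀ := hψ₀.continuous.integrable_of_hasCompactSupport hψ₀c
  -- Subtracting a multiple of the unit-mass bump makes any test function the derivative of a test
  -- function.
  obtain ⟨φ, hφ, hφc, hφd⟩ := exists_contDiff_primitive (ψ := fun x => g x - (∫ y, g y) * ψ₀ x)
    (hg.sub (contDiff_const.mul hψ₀)) (hc.sub (hψ₀c.mul_left)) (by
      rw [integral_sub hgi (hψi.const_mul _), integral_const_mul, hψ₀i]; ring)
  have h1 := h φ hφ hφc
  rw [hφd] at h1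
  have h2 : ∫ x, (g x - (∫ y, g y) * ψ₀ x) * w x
      = (∫ x, g x * w x) - (∫ y, g y) * ∫ x, ψ₀ x * w x := by
    rw [← integral_const_mul, ← integral_sub (hint hg hc) ((hint hψ₀ hψ₀c).const_mul _)]
    congr 1; ext x; ring
  simp only [smul_eq_mul]
  rw [integral_mul_const]
  linarith

/-- The lemma of du Bois-Reymond: a function with a weak derivative has a locally absolutely
continuous representative. -/
theorem exists_hasAEDeriv_of_weakDeriv {w F : ℝ → ℝ} (hw : LocallyIntegrable w volume)
    (hF : LocallyIntegrable F volume)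
    (h : ∀ φ : ℝ → ℝ, ContDiff ℝ ∞ φ → HasCompactSupport φ →
      ∫ x, deriv φ x * w x = -∫ x, φ x * F x) :
    ∃ P : ℝ → ℝ, HasAEDeriv P F ∧ ∀ᵐ x, w x = P x := by
  let Q : ℝ → ℝ := fun x => ∫ t in (0 : ℝ)..x, F t
  have hQ : HasAEDeriv Q F := hasAEDeriv_integral hF
  have hQl : LocallyIntegrable Q volume := hQ.continuous.locallyIntegrable
  obtain ⟨C, hC⟩ := ae_eq_const_of_weakDeriv_zero (hw.sub hQl) fun φ hφ hφc => by
    have hφ' : Continuous (deriv φ) := hφ.continuous_deriv (by simp)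
    have hi1 : Integrable (fun x => deriv φ x * w x) :=
      hw.integrable_smul_left_of_hasCompactSupport hφ' hφc.deriv
    have hi2 : Integrable (fun x => deriv φ x * Q x) :=
      hQl.integrable_smul_left_of_hasCompactSupport hφ' hφc.deriv
    have hi3 : Integrable (fun x => φ x * F x) :=
      hF.integrable_smul_left_of_hasCompactSupport hφ.continuous hφc
    have hφa : HasAEDeriv φ (deriv φ) := by
      refine ⟨fun a b => ContDiffOn.absolutelyContinuousOnInterval
        (hφ.of_le (by simp)).contDiffOn, Eventually.of_forall fun x => ?_⟩
      exact (hφ.differentiable (by simp) x).hasDerivAt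
    have hpr := hφa.mul hQ
    obtain ⟨L, hL⟩ := hφc.isBounded.subset_ball (0 : ℝ)
    have hz : ∀ x, L ≤ |x| → φ x = 0 := fun x hx => by
      by_contra h
      have := hL (subset_tsupport φ h)
      simp at this; linarith
    have h0 : ∫ x, (deriv φ x * Q x + φ x * F x) = 0 := by
      have h1 := intervalIntegral_tendsto_integral (hi2.add hi3) tendsto_neg_atTop_atBot tendsto_id
      refine tendsto_nhds_unique h1 (tendsto_const_nhds.congr' ?_)
      filter_upwards [eventually_ge_atTop (max L 0)] with x hx
      have hx1 : L ≤ x := (le_max_left _ _).trans hx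
      have hx0 : 0 ≤ x := (le_max_right _ _).trans hx
      have h2 := (hpr.1 (-x) x).integral_deriv_eq_sub
      rw [hz x (by rwa [abs_of_nonneg hx0]), hz (-x) (by rwa [abs_neg, abs_of_nonneg hx0])] at h2
      simp only [zero_mul, sub_zero] at h2
      rw [← h2]
      apply intervalIntegral.integral_congr_ae
      filter_upwards [hpr.2] with t ht _ using ht.deriv
    rw [integral_add hi2 hi3] at h0
    have h1 := h φ hφ hφc
    have h2 : ∫ x, deriv φ x * (w - Q) x = (∫ x, deriv φ x * w x) - ∫ x, deriv φ x * Q x := by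
      rw [← integral_sub hi1 hi2]
      congr 1; ext x; simp only [Pi.sub_apply]; ring
    rw [h2]; linarith
  refine ⟨fun x => C + Q x, ?_, ?_⟩
  · simpa using (hasAEDeriv_const C).add hQ
  · filter_upwards [hC] with x hx
    simp only [Pi.sub_apply] at hx
    linarith

/-- A constant dominated by an integrable function wherever the square integrable function `f` is
at most one in absolute value is not positive. -/
theorem nonpos_of_le_integrable {f G : ℝ → ℝ} {a k : ℝ} (hf : Integrable (fun x => f x ^ 2))
    (hG : Integrable G) (h : ∀ᵐ x, a < x → |f x| ≤ 1 → k ≤ G x) : k ≤ 0 := by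
  by_contra hk
  push Not at hk
  -- Where `|f| > 1` the term `k f²` takes over the domination, so a positive `k` would be
  -- integrable on a half-line.
  have hi : Integrable (fun x => |G x| + k * f x ^ 2) := hG.abs.add (hf.const_mul k)
  have h1 : IntegrableOn (fun _ : ℝ => k) (Ioi a) := by
    refine (hi.integrableOn (s := Ioi a)).mono' (by fun_prop) ?_
    rw [ae_restrict_iff' measurableSet_Ioi]
    filter_upwards [h] with x hx hxa
    rw [Real.norm_of_nonneg hk.le]
    by_cases h1 : |f x| ≤ 1
    · have := hx hxa h1
      have := le_abs_self (G x)
      nlinarith [sq_nonneg (f x), mul_nonneg hk.le (sq_nonneg (f x))]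
    · have h2 : 1 ≤ f x ^ 2 := by
        rw [← sq_abs]; nlinarith [abs_nonneg (f x)]
      have := abs_nonneg (G x)
      nlinarith
  rw [integrableOn_const_iff] at h1
  simp [hk.ne'] at h1

/-! ### Inverting a degenerate time change -/

/-- The primitive of `Ψ` vanishing at the origin. -/
noncomputable def clock (Ψ : ℝ → ℝ) (p : ℝ) : ℝ := ∫ t in (0 : ℝ)..p, Ψ t

theorem hasDerivAt_clock {Ψ : ℝ → ℝ} (hc : Continuous Ψ) (p : ℝ) :
    HasDerivAt (clock Ψ) (Ψ p) p :=
  intervalIntegral.integral_hasDerivAt_right (hc.intervalIntegrable _ _)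
    hc.stronglyMeasurable.stronglyMeasurableAtFilter hc.continuousAt

theorem clock_zero (Ψ : ℝ → ℝ) : clock Ψ 0 = 0 := by simp [clock]

theorem clock_neg {Ψ : ℝ → ℝ} (he : ∀ p, Ψ (-p) = Ψ p) (p : ℝ) : clock Ψ (-p) = -clock Ψ p := by
  have h := intervalIntegral.integral_comp_neg (a := 0) (b := p) Ψ
  simp only [he, neg_zero] at h
  rw [clock, clock, h, intervalIntegral.integral_symm]

theorem strictMono_clock {Ψ : ℝ → ℝ} {T : ℝ} (hc : Continuous Ψ) (h0 : ∀ p, 0 ≤ Ψ p)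
    (hz : ∀ p, Ψ p = 0 → |p| = T) : StrictMono (clock Ψ) := by
  intro a b hab
  have h1 : clock Ψ b - clock Ψ a = ∫ t in a..b, Ψ t :=
    intervalIntegral.integral_interval_sub_left (hc.intervalIntegrable _ _)
      (hc.intervalIntegrable _ _)
  have h2 : 0 < ∫ t in a..b, Ψ t := by
    refine intervalIntegral.integral_pos hab hc.continuousOn (fun x _ => h0 x) ?_
    obtain ⟨x, hx, hx'⟩ := ((Ioo_infinite hab).sdiff (toFinite {T, -T})).nonempty
    refine ⟨x, Ioo_subset_Icc_self hx, lt_of_le_of_ne (h0 x) fun h => hx' ?_⟩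
    have h3 := hz x h.symm
    have hT : 0 ≤ T := h3 ▸ abs_nonneg x
    exact (abs_eq hT).1 h3
  linarith

/-- The time change: the primitive of a nonnegative even function with at most two zeros which is
bounded away from zero at infinity has a continuous odd inverse. -/
theorem exists_inverse_clock {Ψ : ℝ → ℝ} {T δ M : ℝ} (hc : Continuous Ψ) (he : ∀ p, Ψ (-p) = Ψ p)
    (h0 : ∀ p, 0 ≤ Ψ p) (hz : ∀ p, Ψ p = 0 → |p| = T) (hδ : 0 < δ) (hM : ∀ p, M ≤ p → δ ≤ Ψ p) :
    ∃ P : ℝ → ℝ, Continuous P ∧ StrictMono P ∧ (∀ x, clock Ψ (P x) = x) ∧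
      (∀ p, P (clock Ψ p) = p) ∧ (∀ x, P (-x) = -P x) ∧
      ∀ x, Ψ (P x) ≠ 0 → HasDerivAt P (Ψ (P x))⁻¹ x := by
  have hmono := strictMono_clock hc h0 hz
  have hcont : Continuous (clock Ψ) :=
    continuous_iff_continuousAt.2 fun p => (hasDerivAt_clock hc p).continuousAt
  have htop : Tendsto (clock Ψ) atTop atTop := by
    have h1 : Tendsto (fun p : ℝ => clock Ψ (max M 0) + δ * (p - max M 0)) atTop atTop :=
      tendsto_atTop_add_const_left _ _ ((tendsto_atTop_add_const_right _ _ tendsto_id).const_mul_atTop hδ)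
    refine tendsto_atTop_mono' _ ?_ h1
    filter_upwards [eventually_ge_atTop (max M 0)] with p hp
    have h2 : clock Ψ p - clock Ψ (max M 0) = ∫ t in (max M 0)..p, Ψ t :=
      intervalIntegral.integral_interval_sub_left (hc.intervalIntegrable _ _)
        (hc.intervalIntegrable _ _)
    have h3 : ∫ t in (max M 0)..p, δ ≤ ∫ t in (max M 0)..p, Ψ t :=
      intervalIntegral.integral_mono_on hp (by simp) (hc.intervalIntegrable _ _)
        fun t ht => hM t ((le_max_left _ _).trans ht.1)
    simp only [intervalIntegral.integral_const, smul_eq_mul] at h3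
    linarith
  have hbot : Tendsto (clock Ψ) atBot atBot := by
    have h1 : clock Ψ = fun p => -clock Ψ (-p) := funext fun p => by rw [clock_neg he]; ring
    rw [h1]
    exact tendsto_neg_atTop_atBot.comp (htop.comp tendsto_neg_atBot_atTop)
  let e := hmono.orderIsoOfSurjective _ (hcont.surjective htop hbot)
  have h1 : ∀ x, clock Ψ (e.symm x) = x := fun x => e.apply_symm_apply x
  have h2 : ∀ p, e.symm (clock Ψ p) = p := fun p => e.symm_apply_apply p
  refine ⟨e.symm, e.symm.continuous, e.symm.strictMono, h1, h2, fun x => ?_, fun x hx => ?_⟩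
  · rw [← h2 (-e.symm x), clock_neg he, h1]
  · exact HasDerivAt.of_local_left_inverse e.symm.continuous.continuousAt
      (hasDerivAt_clock hc _) hx (Eventually.of_forall h1)

/-! ### The explicit profile in the desingularized parameter -/

/-- The value of `η` on the singular set. -/
noncomputable def etaStar (κ : ℝ) : ℝ := 1 - 1 / (2 * κ)

/-- The coefficient `1 - 2κ(1 - η)` of the second derivative. -/
def diffusion (κ η : ℝ) : ℝ := 1 - 2 * κ + 2 * κ * η

/-- The derivative of `η' (1 - 2κ(1 - η))` along solutions, in terms of `η` and `d = η'`. -/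
noncomputable def fluxDeriv (c κ η d : ℝ) : ℝ :=
  -(d ^ 2 + c ^ 2 * η ^ 2) / (2 * (1 - η)) + 2 * κ * d ^ 2 - c ^ 2 * η + 2 * (1 - η) * η

/-- The admissible parameters, with a depth `η₀` below the threshold. -/
structure Admissible (c κ η₀ : ℝ) : Prop where
  pos : 0 < κ
  sub : κ < 1 / 2 → c ^ 2 ≤ 2
  super : 1 / 2 < κ → 2 ≤ c ^ 2
  depth : η₀ < min (etaStar κ) 0 - c ^ 2 - 2

/-- The factor of the first integral on the inner region. -/
noncomputable def innerFactor (c η₀ h : ℝ) : ℝ :=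
  (-2 * (η₀ + h) - c ^ 2) * (1 - h) + c ^ 2 / (1 - η₀)

/-- The factor of the first integral on the outer region. -/
def outerFactor (c h : ℝ) : ℝ := 2 - c ^ 2 - 2 * h

/-- The parameter at which the profile reaches the singular value. -/
noncomputable def crossing (κ η₀ : ℝ) : ℝ := √(etaStar κ - η₀)

/-- The profile `η` in the desingularized parameter. -/
noncomputable def profEta (κ η₀ p : ℝ) : ℝ :=
  if |p| ≤ crossing κ η₀ then η₀ + p ^ 2 else etaStar κ * Real.exp (crossing κ η₀ - |p|)

/-- The rate `dx/dp` of the desingularized parameter. -/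
noncomputable def profRate (c κ η₀ p : ℝ) : ℝ :=
  if |p| ≤ crossing κ η₀ then
    2 * √(-diffusion κ (η₀ + p ^ 2) / innerFactor c η₀ (η₀ + p ^ 2))
  -- The profile is identically zero here, so the rate is a free choice: it vanishes at the crossing
  -- for continuity and grows at infinity so that all positions are reached.
  else if κ = 1 / 2 then |p| - crossing κ η₀
  else √(diffusion κ (profEta κ η₀ p) / outerFactor c (profEta κ η₀ p))

/-- The flux `η' (1 - 2κ(1 - η))` in the desingularized parameter. -/
noncomputable def profFlux (c κ η₀ p : ℝ) : ℝ :=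
  if |p| ≤ crossing κ η₀ then
    -p * √(-diffusion κ (η₀ + p ^ 2) * innerFactor c η₀ (η₀ + p ^ 2))
  else p / |p| * (if κ < 1 / 2 then -1 else 1) * profEta κ η₀ p *
    √(diffusion κ (profEta κ η₀ p) * outerFactor c (profEta κ η₀ p))

section

variable {c κ η₀ : ℝ}

theorem diffusion_eq (hκ : 0 < κ) (h : ℝ) : diffusion κ h = 2 * κ * (h - etaStar κ) := by
  unfold diffusion etaStar; field_simp; ring

theorem etaStar_lt_one (hκ : 0 < κ) : etaStar κ < 1 := by
  unfold etaStar; have : 0 < 1 / (2 * κ) := by positivity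
  linarith

theorem etaStar_eq (hκ : 0 < κ) : 2 * κ * etaStar κ = 2 * κ - 1 := by
  unfold etaStar; field_simp

theorem profEta_neg (p : ℝ) : profEta κ η₀ (-p) = profEta κ η₀ p := by
  simp [profEta]

theorem profRate_neg (p : ℝ) :
    profRate c κ η₀ (-p) = profRate c κ η₀ p := by
  simp [profRate, profEta_neg]

theorem profFlux_neg (p : ℝ) :
    profFlux c κ η₀ (-p) = -profFlux c κ η₀ p := by
  simp only [profFlux, profEta_neg, abs_neg, neg_sq]
  split_ifs
  all_goals ring

namespace Admissible

theorem lt_etaStar (ha : Admissible c κ η₀) : η₀ < etaStar κ := by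
  have := ha.depth; have := min_le_left (etaStar κ) 0; nlinarith [sq_nonneg c]

theorem lt_zero (ha : Admissible c κ η₀) : η₀ < -2 - c ^ 2 := by
  have := ha.depth; have := min_le_right (etaStar κ) 0; nlinarith [sq_nonneg c]

theorem crossing_pos (ha : Admissible c κ η₀) : 0 < crossing κ η₀ := Real.sqrt_pos.2 (by linarith [ha.lt_etaStar])

theorem crossing_sq (ha : Admissible c κ η₀) : crossing κ η₀ ^ 2 = etaStar κ - η₀ :=
  Real.sq_sqrt (by linarith [ha.lt_etaStar])

theorem innerFactor_pos (ha : Admissible c κ η₀) {h : ℝ} (hh : h < 1) : 0 < innerFactor c η₀ h := by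
  have h1 := ha.lt_zero
  -- The depth condition is tuned to this: `η₀ < -2 - c²` and `h < 1` leave a margin of at least `2
  -- + c²`.
  have h2 : 0 < -2 * (η₀ + h) - c ^ 2 := by nlinarith [sq_nonneg c]
  have h3 : 0 ≤ c ^ 2 / (1 - η₀) := div_nonneg (sq_nonneg c) (by nlinarith [sq_nonneg c])
  unfold innerFactor
  have := mul_pos h2 (sub_pos.2 hh)
  linarith

theorem inner_le (ha : Admissible c κ η₀) {p : ℝ} (hp : |p| ≤ crossing κ η₀) : η₀ + p ^ 2 ≤ etaStar κ := by
  have h1 := ha.crossing_sq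
  have h2 := sq_le_sq' (by linarith [(abs_le.1 hp).1]) (abs_le.1 hp).2
  linarith

theorem inner_lt (ha : Admissible c κ η₀) {p : ℝ} (hp : |p| < crossing κ η₀) : η₀ + p ^ 2 < etaStar κ := by
  have h1 := ha.crossing_sq
  have h2 := sq_lt_sq' (by linarith [(abs_lt.1 hp).1]) (abs_lt.1 hp).2
  linarith

theorem profEta_continuous (ha : Admissible c κ η₀) : Continuous (profEta κ η₀) := by
  unfold profEta
  refine Continuous.if_le (by fun_prop) (by fun_prop) continuous_abs continuous_const fun p hp => ?_
  rw [hp, sub_self, Real.exp_zero, mul_one, ← sq_abs, hp, ha.crossing_sq]; ring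

theorem outer_exists (ha : Admissible c κ η₀) {p : ℝ} (hp : crossing κ η₀ < |p|) :
    ∃ r, 0 < r ∧ r < 1 ∧ profEta κ η₀ p = etaStar κ * r ∧
      diffusion κ (etaStar κ * r) = (1 - 2 * κ) * (1 - r) := by
  refine ⟨Real.exp (crossing κ η₀ - |p|), Real.exp_pos _, ?_, ?_, ?_⟩
  · rw [Real.exp_lt_one_iff]; linarith
  · rw [profEta, if_neg (not_le.2 hp)]
  · unfold diffusion; linear_combination Real.exp (crossing κ η₀ - |p|) * etaStar_eq ha.pos

/-- On the outer region the signs of `η`, of the diffusion and of the outer factor are locked. -/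
theorem outer_sign (ha : Admissible c κ η₀) {r : ℝ} (hr : 0 < r) (hr1 : r < 1) (hκ : κ ≠ 1 / 2) :
    0 < diffusion κ (etaStar κ * r) * outerFactor c (etaStar κ * r) ∧
      etaStar κ * r * diffusion κ (etaStar κ * r) < 0 ∧ 2 * |etaStar κ * r| ≤ |outerFactor c (etaStar κ * r)| := by
  have h1 : diffusion κ (etaStar κ * r) = (1 - 2 * κ) * (1 - r) := by
    unfold diffusion; linear_combination r * etaStar_eq ha.pos
  have h2 := etaStar_eq ha.pos
  have h3 := ha.pos
  have hr2 : 0 < 1 - r := by linarith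
  rw [h1]
  unfold outerFactor
  rcases lt_or_gt_of_ne hκ with h | h
  · have hc := ha.sub h
    have h4 : etaStar κ < 0 := by
      by_contra h5; push Not at h5; nlinarith [mul_nonneg h3.le h5]
    have h5 : etaStar κ * r < 0 := mul_neg_of_neg_of_pos h4 hr
    have h6 : 0 < (1 - 2 * κ) * (1 - r) := mul_pos (by linarith) hr2
    refine ⟨mul_pos h6 (by linarith), mul_neg_of_neg_of_pos h5 h6, ?_⟩
    rw [abs_of_neg h5, abs_of_pos (by linarith)]; linarith
  · have hc := ha.super h
    have h4 : 0 < etaStar κ := by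
      by_contra h5; push Not at h5; nlinarith [mul_nonneg h3.le (neg_nonneg.2 h5)]
    have h5 : 0 < etaStar κ * r := mul_pos h4 hr
    have h6 : (1 - 2 * κ) * (1 - r) < 0 := mul_neg_of_neg_of_pos (by linarith) hr2
    refine ⟨mul_pos_of_neg_of_neg h6 (by linarith), mul_neg_of_pos_of_neg h5 h6, ?_⟩
    rw [abs_of_pos h5, abs_of_neg (by linarith)]; linarith

theorem profRate_inner_pos (ha : Admissible c κ η₀) {p : ℝ} (hp : |p| < crossing κ η₀) : 0 < profRate c κ η₀ p := by
  rw [profRate, if_pos hp.le]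
  have h1 := ha.inner_lt hp
  have h2 : diffusion κ (η₀ + p ^ 2) < 0 := by
    rw [diffusion_eq ha.pos]; exact mul_neg_of_pos_of_neg (by linarith [ha.pos]) (by linarith)
  have h3 := ha.innerFactor_pos (h1.trans (etaStar_lt_one ha.pos))
  have : 0 < -diffusion κ (η₀ + p ^ 2) / innerFactor c η₀ (η₀ + p ^ 2) := div_pos (by linarith) h3
  positivity

theorem profRate_outer_pos (ha : Admissible c κ η₀) {p : ℝ} (hp : crossing κ η₀ < |p|) : 0 < profRate c κ η₀ p := by
  rw [profRate, if_neg (not_le.2 hp)]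
  split_ifs with hκ
  · linarith
  · obtain ⟨r, h1, h2, h3, h4⟩ := ha.outer_exists hp
    rw [h3]
    have h5 := (ha.outer_sign h1 h2 hκ).1
    exact Real.sqrt_pos.2 (div_pos_iff.2 (mul_pos_iff.1 h5))

theorem _root_.QuasilinearGP.profRate_nonneg (p : ℝ) : 0 ≤ profRate c κ η₀ p := by
  unfold profRate; split_ifs with h1 <;> first | positivity | linarith

theorem profRate_eq_zero (ha : Admissible c κ η₀) {p : ℝ} (h : profRate c κ η₀ p = 0) : |p| = crossing κ η₀ := by
  rcases lt_trichotomy (|p|) (crossing κ η₀) with h1 | h1 | h1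
  · exact absurd h (ha.profRate_inner_pos h1).ne'
  · exact h1
  · exact absurd h (ha.profRate_outer_pos h1).ne'

end Admissible

end

namespace Admissible

variable {c κ η₀ : ℝ}

theorem etaStar_ne_zero (ha : Admissible c κ η₀) (hκ : κ ≠ 1 / 2) : etaStar κ ≠ 0 := by
  intro h
  have := etaStar_eq ha.pos
  rw [h] at this
  exact hκ (by linarith)

theorem profEta_crossing (ha : Admissible c κ η₀) {p : ℝ} (hp : |p| = crossing κ η₀) :
    profEta κ η₀ p = etaStar κ := by
  rw [profEta, if_pos hp.le, ← sq_abs, hp, ha.crossing_sq]; ring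

theorem outer_exists' (ha : Admissible c κ η₀) {p : ℝ} (hp : crossing κ η₀ ≤ |p|) :
    ∃ r, 0 < r ∧ r ≤ 1 ∧ profEta κ η₀ p = etaStar κ * r := by
  rcases hp.eq_or_lt with h | h
  · exact ⟨1, one_pos, le_rfl, by rw [ha.profEta_crossing h.symm, mul_one]⟩
  · obtain ⟨r, h1, h2, h3, -⟩ := ha.outer_exists h
    exact ⟨r, h1, h2.le, h3⟩

/-- Unlike `outer_sign` this includes `r = 1`, the crossing itself, where the rate must still be
continuous. -/
theorem outerFactor_ne_zero (ha : Admissible c κ η₀) (hκ : κ ≠ 1 / 2) {r : ℝ} (hr : 0 < r) :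
    outerFactor c (etaStar κ * r) ≠ 0 := by
  have h2 := etaStar_eq ha.pos
  have h3 := ha.pos
  unfold outerFactor
  rcases lt_or_gt_of_ne hκ with h | h
  · have hc := ha.sub h
    have h4 : etaStar κ < 0 := by
      by_contra h5; push Not at h5; nlinarith [mul_nonneg h3.le h5]
    have h5 : etaStar κ * r < 0 := mul_neg_of_neg_of_pos h4 hr
    linarith
  · have hc := ha.super h
    have h4 : 0 < etaStar κ := by
      by_contra h5; push Not at h5; nlinarith [mul_nonneg h3.le (neg_nonneg.2 h5)]
    have h5 : 0 < etaStar κ * r := mul_pos h4 hr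
    linarith

theorem profEta_half (ha : Admissible c (1 / 2) η₀) {p : ℝ} (hp : crossing (1 / 2) η₀ ≤ |p|) :
    profEta (1 / 2) η₀ p = 0 := by
  obtain ⟨r, -, -, h⟩ := ha.outer_exists' hp
  rw [h]; norm_num [etaStar]

theorem continuous_diffusion : Continuous (diffusion κ) := by unfold diffusion; fun_prop

theorem continuous_outerFactor : Continuous (outerFactor c) := by unfold outerFactor; fun_prop

theorem continuous_innerFactor : Continuous (innerFactor c η₀) := by unfold innerFactor; fun_prop

theorem diffusion_etaStar (ha : Admissible c κ η₀) : diffusion κ (etaStar κ) = 0 := by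
  rw [diffusion_eq ha.pos]; ring

/-- The two formulas agree at the crossing because the diffusion vanishes at `etaStar κ`, which
makes both of them zero. -/
theorem profRate_continuous (ha : Admissible c κ η₀) : Continuous (profRate c κ η₀) := by
  unfold profRate
  refine continuous_if_le continuous_abs continuous_const ?_ ?_ ?_
  · refine ContinuousOn.mul continuousOn_const (ContinuousOn.sqrt (ContinuousOn.div ?_ ?_ ?_))
    · exact (continuous_diffusion.comp (by fun_prop)).neg.continuousOn
    · exact (continuous_innerFactor.comp (by fun_prop)).continuousOn
    · intro p hp
      exact (ha.innerFactor_pos ((ha.inner_le hp).trans_lt (etaStar_lt_one ha.pos))).ne'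
  · split_ifs with hκ
    · fun_prop
    · refine ContinuousOn.sqrt (ContinuousOn.div ?_ ?_ ?_)
      · exact (continuous_diffusion.comp ha.profEta_continuous).continuousOn
      · exact (continuous_outerFactor.comp ha.profEta_continuous).continuousOn
      · intro p hp
        obtain ⟨r, h1, -, h3⟩ := ha.outer_exists' hp
        rw [h3]
        exact ha.outerFactor_ne_zero hκ h1
  · intro p hp
    have h1 : η₀ + p ^ 2 = etaStar κ := by
      rw [← ha.profEta_crossing hp, profEta, if_pos hp.le]
    rw [h1, ha.profEta_crossing hp, ha.diffusion_etaStar, hp]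
    simp

/-- Both formulas carry the square root of a multiple of the diffusion, hence vanish at the
crossing. This continuity is what makes the glued profile a weak solution although its first
integral jumps. -/
theorem profFlux_continuous (ha : Admissible c κ η₀) : Continuous (profFlux c κ η₀) := by
  unfold profFlux
  have h := ha.profEta_continuous
  have h0 := ha.crossing_pos
  refine continuous_if_le continuous_abs continuous_const ?_ ?_ ?_
  · refine (continuous_neg.mul (Real.continuous_sqrt.comp ?_)).continuousOn
    exact (continuous_diffusion.comp (by fun_prop)).neg.mul (continuous_innerFactor.comp (by fun_prop))
  · refine ContinuousOn.mul (ContinuousOn.mul (ContinuousOn.mul ?_ continuousOn_const) h.continuousOn) ?_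
    · refine ContinuousOn.div continuousOn_id continuous_abs.continuousOn fun p hp => ?_
      exact (h0.trans_le hp).ne'
    · exact (Real.continuous_sqrt.comp ((continuous_diffusion.comp h).mul
        (continuous_outerFactor.comp h))).continuousOn
  · intro p hp
    have h1 : η₀ + p ^ 2 = etaStar κ := by
      rw [← ha.profEta_crossing hp, profEta, if_pos hp.le]
    rw [h1, ha.profEta_crossing hp, ha.diffusion_etaStar]
    simp

/-- One unit past the crossing the ratio `r = η/η*` is at most `e⁻¹`, so `|D| = |1-2κ|(1-r)` is
bounded below while the outer factor is bounded above. Consequently the profile occupies the whole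
line. -/
theorem profRate_lower_bound (ha : Admissible c κ η₀) :
    ∃ δ > 0, ∀ p, crossing κ η₀ + 1 ≤ p → δ ≤ profRate c κ η₀ p := by
  have h0 := ha.crossing_pos
  by_cases hκ : κ = 1 / 2
  · refine ⟨1, one_pos, fun p hp => ?_⟩
    have hp' : |p| = p := abs_of_pos (by linarith)
    rw [profRate, if_neg (by rw [hp']; linarith), if_pos hκ, hp']; linarith
  · have h1 : 0 < |1 - 2 * κ| := abs_pos.2 (fun h => hκ (by linarith))
    have h2 : 0 < 1 - Real.exp (-1) := by
      have : Real.exp (-1) < 1 := by rw [Real.exp_lt_one_iff]; norm_num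
      linarith
    have h3 : 0 < |2 - c ^ 2| + 2 * |etaStar κ| := by
      have := abs_pos.2 (ha.etaStar_ne_zero hκ)
      positivity
    refine ⟨√(|1 - 2 * κ| * (1 - Real.exp (-1)) / (|2 - c ^ 2| + 2 * |etaStar κ|)),
      Real.sqrt_pos.2 (by positivity), fun p hp => ?_⟩
    have hp' : |p| = p := abs_of_pos (by linarith)
    rw [profRate, if_neg (by rw [hp']; linarith), if_neg hκ]
    apply Real.sqrt_le_sqrt
    have h4 : profEta κ η₀ p = etaStar κ * Real.exp (crossing κ η₀ - |p|) := by
      rw [profEta, if_neg (by rw [hp']; linarith)]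
    have h5 : Real.exp (crossing κ η₀ - |p|) ≤ Real.exp (-1) := by
      rw [Real.exp_le_exp, hp']; linarith
    set r := Real.exp (crossing κ η₀ - |p|)
    have hr : 0 < r := Real.exp_pos _
    have h6 := (ha.outer_sign hr (by linarith) hκ).1
    have h7 : diffusion κ (etaStar κ * r) = (1 - 2 * κ) * (1 - r) := by
      unfold diffusion; linear_combination r * etaStar_eq ha.pos
    rw [h4]
    have h8 : diffusion κ (etaStar κ * r) / outerFactor c (etaStar κ * r)
        = |diffusion κ (etaStar κ * r)| / |outerFactor c (etaStar κ * r)| := by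
      rw [← abs_div, abs_of_pos (div_pos_iff.2 (mul_pos_iff.1 h6))]
    have h9 : outerFactor c (etaStar κ * r) ≠ 0 := right_ne_zero_of_mul h6.ne'
    rw [h8]
    have h10 : |diffusion κ (etaStar κ * r)| = |1 - 2 * κ| * (1 - r) := by
      rw [h7, abs_mul, abs_of_pos (by linarith : 0 < 1 - r)]
    rw [h10]
    have h11 : |outerFactor c (etaStar κ * r)| ≤ |2 - c ^ 2| + 2 * |etaStar κ| := by
      unfold outerFactor
      refine (abs_sub _ _).trans ?_
      rw [abs_mul, abs_mul, abs_of_pos hr, abs_two]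
      have : |etaStar κ| * r ≤ |etaStar κ| := mul_le_of_le_one_right (abs_nonneg _) (by linarith)
      linarith
    exact div_le_div₀ (mul_nonneg h1.le (by linarith))
      (mul_le_mul_of_nonneg_left (by linarith) h1.le) (abs_pos.2 h9) h11

/-- Multiplying by the inverse rate converts `d/dp` into `d/dx`, so these are the scalar equations
in position form. They hold because rate and flux were read off the first integral. -/
theorem inner_ode (ha : Admissible c κ η₀) {p : ℝ} (hp : |p| < crossing κ η₀) :
    ∃ h' q', HasDerivAt (profEta κ η₀) h' p ∧ HasDerivAt (profFlux c κ η₀) q' p ∧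
      h' * (profRate c κ η₀ p)⁻¹ = profFlux c κ η₀ p / diffusion κ (profEta κ η₀ p) ∧
      q' * (profRate c κ η₀ p)⁻¹ = fluxDeriv c κ (profEta κ η₀ p)
        (profFlux c κ η₀ p / diffusion κ (profEta κ η₀ p)) := by
  have hev : ∀ᶠ t in 𝓝 p, |t| < crossing κ η₀ := continuous_abs.continuousAt.eventually_lt_const hp
  have h1 := ha.inner_lt hp
  have hlt := h1.trans (etaStar_lt_one ha.pos)
  have h2 : diffusion κ (η₀ + p ^ 2) < 0 := by
    rw [diffusion_eq ha.pos]; exact mul_neg_of_pos_of_neg (by linarith [ha.pos]) (by linarith)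
  have h3 := ha.innerFactor_pos hlt
  have h0 := ha.lt_zero
  have hη0 : 1 - η₀ ≠ 0 := by nlinarith [sq_nonneg c]
  have hS : 0 < -diffusion κ (η₀ + p ^ 2) * innerFactor c η₀ (η₀ + p ^ 2) := mul_pos (by linarith) h3
  have hH : HasDerivAt (fun t : ℝ => η₀ + t ^ 2) (2 * p) p := by
    simpa using (hasDerivAt_pow 2 p).const_add η₀
  have hD : HasDerivAt (fun t : ℝ => -diffusion κ (η₀ + t ^ 2)) (-(2 * κ * (2 * p))) p := by
    unfold diffusion; exact ((hH.const_mul _).const_add _).neg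
  have hG : HasDerivAt (fun t : ℝ => innerFactor c η₀ (η₀ + t ^ 2))
      ((-2 * (2 * p)) * (1 - (η₀ + p ^ 2)) + (-2 * (η₀ + (η₀ + p ^ 2)) - c ^ 2) * (-(2 * p))) p := by
    unfold innerFactor
    exact ((((hH.const_add η₀).const_mul (-2)).sub_const _).mul (hH.const_sub 1)).add_const _
  have hq := (hasDerivAt_neg p).mul ((hD.mul hG).sqrt hS.ne')
  have e1 : profEta κ η₀ p = η₀ + p ^ 2 := by rw [profEta, if_pos hp.le]
  have e2 : profFlux c κ η₀ p
      = -p * √(-diffusion κ (η₀ + p ^ 2) * innerFactor c η₀ (η₀ + p ^ 2)) := by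
    rw [profFlux, if_pos hp.le]
  -- The rate is rewritten over the square root occurring in the flux, so that a single radical
  -- remains.
  have e3 : profRate c κ η₀ p = 2 * (-diffusion κ (η₀ + p ^ 2)) /
      √(-diffusion κ (η₀ + p ^ 2) * innerFactor c η₀ (η₀ + p ^ 2)) := by
    rw [profRate, if_pos hp.le, mul_div_assoc]
    congr 1
    rw [eq_div_iff (Real.sqrt_pos.2 hS).ne', ← Real.sqrt_mul (div_pos (by linarith) h3).le]
    rw [Real.sqrt_eq_iff_mul_self_eq_of_pos (by linarith)]
    field_simp
  refine ⟨_, _, hH.congr_of_eventuallyEq ?_, hq.congr_of_eventuallyEq ?_, ?_, ?_⟩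
  · filter_upwards [hev] with t ht
    rw [profEta, if_pos ht.le]
  · filter_upwards [hev] with t ht
    rw [profFlux, if_pos ht.le]; rfl
  · rw [e1, e2, e3]
    have := (Real.sqrt_pos.2 hS).ne'
    have := h2.ne
    field_simp
  · rw [e1, e2, e3]
    have hr := Real.sq_sqrt hS.le
    have hr0 := (Real.sqrt_pos.2 hS).ne'
    simp only [Pi.mul_apply]
    set r := √(-diffusion κ (η₀ + p ^ 2) * innerFactor c η₀ (η₀ + p ^ 2))
    have hd := h2.ne
    have hm : 1 - (η₀ + p ^ 2) ≠ 0 := by linarith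
    unfold fluxDeriv
    rw [div_pow, mul_pow, hr]
    have hr' : r⁻¹ * r = 1 := inv_mul_cancel₀ hr0
    generalize hDD : diffusion κ (η₀ + p ^ 2) = D at *
    -- The radical enters only through its square; what remains is a rational identity.
    have hL : ∀ X : ℝ, (-1 * r + -p * (X / (2 * r))) * (2 * -D / r)⁻¹ = (r ^ 2 + p * X / 2) / (2 * D) := by
      intro X; field_simp; ring
    rw [hL, hr]
    subst hDD
    have hd' : 1 - 2 * κ + 2 * κ * (η₀ + p ^ 2) ≠ 0 := hd
    unfold diffusion innerFactor
    field_simp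
    ring

theorem outer_ode_of_pos (ha : Admissible c κ η₀) {p : ℝ} (hp : crossing κ η₀ < p) :
    ∃ h' q', HasDerivAt (profEta κ η₀) h' p ∧ HasDerivAt (profFlux c κ η₀) q' p ∧
      h' * (profRate c κ η₀ p)⁻¹ = profFlux c κ η₀ p / diffusion κ (profEta κ η₀ p) ∧
      q' * (profRate c κ η₀ p)⁻¹ = fluxDeriv c κ (profEta κ η₀ p)
        (profFlux c κ η₀ p / diffusion κ (profEta κ η₀ p)) := by
  have h0 := ha.crossing_pos
  have hp0 : |p| = p := abs_of_pos (by linarith)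
  have hev : ∀ᶠ t in 𝓝 p, crossing κ η₀ < t := continuousAt_id.eventually_const_lt hp
  obtain ⟨r, hr, hr1, e1, hDr⟩ := ha.outer_exists (hp0.symm ▸ hp)
  have hH : HasDerivAt (profEta κ η₀) (-profEta κ η₀ p) p := by
    have h1 : HasDerivAt (fun t => etaStar κ * Real.exp (crossing κ η₀ - t))
        (etaStar κ * (Real.exp (crossing κ η₀ - p) * (-1))) p :=
      ((hasDerivAt_id p).const_sub _).exp.const_mul _
    refine (h1.congr_of_eventuallyEq ?_).congr_deriv ?_
    · filter_upwards [hev] with t ht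
      rw [profEta, abs_of_pos (by linarith), if_neg (not_le.2 ht)]
    · rw [profEta, hp0, if_neg (not_le.2 hp)]; ring
  have hqe : ∀ t, crossing κ η₀ < t → profFlux c κ η₀ t = (if κ < 1 / 2 then -1 else 1) *
      profEta κ η₀ t * √(diffusion κ (profEta κ η₀ t) * outerFactor c (profEta κ η₀ t)) := by
    intro t ht
    have : 0 < t := by linarith
    rw [profFlux, abs_of_pos this, if_neg (not_le.2 ht), div_self this.ne', one_mul]
  by_cases hκ : κ = 1 / 2
  -- For `κ = 1/2` both profile and diffusion vanish outside, so the slope is `0 / 0`, which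
  -- evaluates to the correct value `0`.
  · subst hκ
    have hz : ∀ t, crossing (1 / 2) η₀ < t → profEta (1 / 2) η₀ t = 0 := fun t ht =>
      ha.profEta_half (by rw [abs_of_pos (by linarith)]; exact ht.le)
    refine ⟨_, 0, hH, (hasDerivAt_const p (0 : ℝ)).congr_of_eventuallyEq ?_, ?_, ?_⟩
    · filter_upwards [hev] with t ht
      rw [hqe t ht, hz t ht]; simp
    · rw [hqe p hp, hz p hp]; simp
    · rw [hqe p hp, hz p hp]; simp [fluxDeriv]
  · obtain ⟨hS, hsg, -⟩ := ha.outer_sign hr hr1 hκ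
    rw [← e1] at hS hsg
    have hD : HasDerivAt (fun t : ℝ => diffusion κ (profEta κ η₀ t)) (2 * κ * -profEta κ η₀ p) p := by
      unfold diffusion; exact (hH.const_mul _).const_add _
    have hG : HasDerivAt (fun t : ℝ => outerFactor c (profEta κ η₀ t)) (-(2 * -profEta κ η₀ p)) p := by
      unfold outerFactor; exact (hH.const_mul 2).const_sub _
    have hq := (hH.const_mul (if κ < 1 / 2 then (-1 : ℝ) else 1)).mul ((hD.mul hG).sqrt hS.ne')
    have hm : 1 - profEta κ η₀ p ≠ 0 := by
      have h1 := etaStar_lt_one ha.pos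
      rw [e1]
      rcases le_total (etaStar κ) 0 with h | h <;> nlinarith
    have hσ : (if κ < 1 / 2 then (-1 : ℝ) else 1) ^ 2 = 1 := by split_ifs <;> norm_num
    -- The sign factor makes this representation of the rate positive: the outer diffusion is
    -- positive exactly when `κ < 1/2`.
    have e3 : profRate c κ η₀ p = -(if κ < 1 / 2 then (-1 : ℝ) else 1) * diffusion κ (profEta κ η₀ p) /
        √(diffusion κ (profEta κ η₀ p) * outerFactor c (profEta κ η₀ p)) := by
      have hσD : 0 < -(if κ < 1 / 2 then (-1 : ℝ) else 1) * diffusion κ (profEta κ η₀ p) := by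
        rw [e1, hDr]
        split_ifs with h
        · have := mul_pos (by linarith : 0 < 1 - 2 * κ) (sub_pos.2 hr1); linarith
        · have h' : 1 / 2 < κ := lt_of_le_of_ne (not_lt.1 h) (Ne.symm hκ)
          have := mul_pos (by linarith : 0 < 2 * κ - 1) (sub_pos.2 hr1); linarith
      have h4 : 0 < diffusion κ (profEta κ η₀ p) / outerFactor c (profEta κ η₀ p) :=
        div_pos_iff.2 (mul_pos_iff.1 hS)
      have h5 : outerFactor c (profEta κ η₀ p) ≠ 0 := right_ne_zero_of_mul hS.ne'
      rw [profRate, hp0, if_neg (not_le.2 hp), if_neg hκ, eq_div_iff (Real.sqrt_pos.2 hS).ne',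
        ← Real.sqrt_mul h4.le, Real.sqrt_eq_iff_mul_self_eq_of_pos hσD]
      have : -(if κ < 1 / 2 then (-1 : ℝ) else 1) * diffusion κ (profEta κ η₀ p) *
        (-(if κ < 1 / 2 then (-1 : ℝ) else 1) * diffusion κ (profEta κ η₀ p)) =
        diffusion κ (profEta κ η₀ p) ^ 2 := by
        linear_combination (diffusion κ (profEta κ η₀ p)) ^ 2 * hσ
      rw [this]; field_simp
    refine ⟨_, _, hH, hq.congr_of_eventuallyEq ?_, ?_, ?_⟩
    · filter_upwards [hev] with t ht
      rw [hqe t ht]; rfl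
    · rw [e3, hqe p hp]
      have h6 := (Real.sqrt_pos.2 hS).ne'
      have h7 := left_ne_zero_of_mul hS.ne'
      split_ifs <;> field_simp
    · rw [e3, hqe p hp]
      have hr2 := Real.sq_sqrt hS.le
      have hr0 := (Real.sqrt_pos.2 hS).ne'
      have hd := left_ne_zero_of_mul hS.ne'
      simp only [Pi.mul_apply]
      set ρ := √(diffusion κ (profEta κ η₀ p) * outerFactor c (profEta κ η₀ p))
      generalize profEta κ η₀ p = h at *
      generalize (if κ < 1 / 2 then (-1 : ℝ) else 1) = σ at *
      have hσ0 : σ ≠ 0 := fun h => by rw [h] at hσ; norm_num at hσ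
      unfold fluxDeriv
      rw [div_pow, mul_pow, mul_pow, hr2, hσ]
      generalize hDD : diffusion κ h = D at *
      have hL : ∀ X : ℝ, (σ * -h * ρ + σ * h * (X / (2 * ρ))) * (-σ * D / ρ)⁻¹
          = (h * ρ ^ 2 - h * X / 2) / D := by
        intro X; field_simp; ring
      rw [hL, hr2]
      unfold outerFactor
      field_simp
      rw [← hDD, diffusion]
      ring

theorem param_ode (ha : Admissible c κ η₀) {p : ℝ} (hp : |p| ≠ crossing κ η₀) :
    ∃ h' q', HasDerivAt (profEta κ η₀) h' p ∧ HasDerivAt (profFlux c κ η₀) q' p ∧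
      h' * (profRate c κ η₀ p)⁻¹ = profFlux c κ η₀ p / diffusion κ (profEta κ η₀ p) ∧
      q' * (profRate c κ η₀ p)⁻¹ = fluxDeriv c κ (profEta κ η₀ p)
        (profFlux c κ η₀ p / diffusion κ (profEta κ η₀ p)) := by
  rcases lt_or_gt_of_ne hp with h | h
  · exact ha.inner_ode h
  rcases lt_abs.1 h with h1 | h1
  · exact ha.outer_ode_of_pos h1
  · obtain ⟨h', q', d1, d2, d3, d4⟩ := ha.outer_ode_of_pos h1
    refine ⟨-h', q', ?_, ?_, ?_, ?_⟩
    · have := d1.comp p (hasDerivAt_neg p)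
      refine (this.congr_of_eventuallyEq (Eventually.of_forall fun t => ?_)).congr_deriv (by ring)
      simp [profEta_neg]
    · have := (d2.comp p (hasDerivAt_neg p)).neg
      refine (this.congr_of_eventuallyEq (Eventually.of_forall fun t => ?_)).congr_deriv (by ring)
      simp [profFlux_neg]
    · simp only [profRate_neg, profFlux_neg, profEta_neg] at d3
      rw [neg_mul, d3]; ring
    · simp only [profRate_neg, profFlux_neg, profEta_neg] at d4
      rw [d4]; simp [fluxDeriv, neg_div]

end Admissible

/-! ### The profile as a function of position: slope, integrability, singular points -/

theorem integrable_of_even_of_integrableOn_Ioi {f : ℝ → ℝ} (he : ∀ x, f (-x) = f x)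
    (h : IntegrableOn f (Ioi 0)) : Integrable f := by
  have h1 : IntegrableOn f (Iio 0) := by
    rw [← (Measure.measurePreserving_neg (volume : Measure ℝ)).integrableOn_comp_preimage
      (Homeomorph.neg ℝ).measurableEmbedding]
    have : f ∘ Neg.neg = f := funext he
    rw [this]
    simpa using h
  have h2 : IntegrableOn f (Iic 0) := by
    rwa [integrableOn_Iic_iff_integrableOn_Iio]
  rw [← integrableOn_univ, ← Iic_union_Ioi (a := (0 : ℝ))]
  exact h2.union h

/-- `P` is the inverse of the clock of the profile, that is, the desingularized parameter as a
function of position. -/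
structure ProfileClock (c κ η₀ : ℝ) (P : ℝ → ℝ) : Prop where
  cont : Continuous P
  mono : StrictMono P
  clock_apply : ∀ x, clock (profRate c κ η₀) (P x) = x
  apply_clock : ∀ p, P (clock (profRate c κ η₀) p) = p
  odd : ∀ x, P (-x) = -P x
  deriv : ∀ x, profRate c κ η₀ (P x) ≠ 0 → HasDerivAt P (profRate c κ η₀ (P x))⁻¹ x

/-- The position at which the profile crosses the singular value. -/
noncomputable def crossingPoint (c κ η₀ : ℝ) : ℝ := clock (profRate c κ η₀) (crossing κ η₀)

theorem Admissible.exists_profileClock {c κ η₀ : ℝ} (ha : Admissible c κ η₀) :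
    ∃ P, ProfileClock c κ η₀ P := by
  obtain ⟨δ, hδ, hb⟩ := ha.profRate_lower_bound
  obtain ⟨P, h1, h2, h3, h4, h5, h6⟩ := exists_inverse_clock ha.profRate_continuous profRate_neg
    profRate_nonneg (fun p => ha.profRate_eq_zero) hδ hb
  exact ⟨P, h1, h2, h3, h4, h5, h6⟩

namespace Admissible

variable {c κ η₀ : ℝ}

theorem profEta_inner {p : ℝ} (hp : |p| ≤ crossing κ η₀) : profEta κ η₀ p = η₀ + p ^ 2 := by
  rw [profEta, if_pos hp]

theorem le_profEta (ha : Admissible c κ η₀) (p : ℝ) : η₀ ≤ profEta κ η₀ p := by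
  rcases le_total (|p|) (crossing κ η₀) with h | h
  · rw [profEta_inner h]; nlinarith [sq_nonneg p]
  · obtain ⟨r, h1, h2, h3⟩ := ha.outer_exists' h
    have := ha.lt_etaStar
    have := ha.lt_zero
    rw [h3]
    nlinarith [sq_nonneg c]

theorem profEta_le (ha : Admissible c κ η₀) (p : ℝ) : profEta κ η₀ p ≤ max (etaStar κ) 0 := by
  rcases le_total (|p|) (crossing κ η₀) with h | h
  · rw [profEta_inner h]; exact (ha.inner_le h).trans (le_max_left _ _)
  · obtain ⟨r, h1, h2, h3⟩ := ha.outer_exists' h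
    rw [h3]
    rcases le_total (etaStar κ) 0 with h4 | h4
    · exact (mul_nonpos_of_nonpos_of_nonneg h4 h1.le).trans (le_max_right _ _)
    · exact (mul_le_of_le_one_right h4 h2).trans (le_max_left _ _)

theorem profEta_lt_one (ha : Admissible c κ η₀) (p : ℝ) : profEta κ η₀ p < 1 :=
  (ha.profEta_le p).trans_lt (max_lt (etaStar_lt_one ha.pos) one_pos)

theorem diffusion_inner_neg (ha : Admissible c κ η₀) {p : ℝ} (hp : |p| < crossing κ η₀) :
    diffusion κ (profEta κ η₀ p) < 0 := by
  rw [profEta_inner hp.le, diffusion_eq ha.pos]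
  exact mul_neg_of_pos_of_neg (by linarith [ha.pos]) (by linarith [ha.inner_lt hp])

theorem profFlux_sq_inner (ha : Admissible c κ η₀) {p : ℝ} (hp : |p| < crossing κ η₀) :
    profFlux c κ η₀ p ^ 2 =
      p ^ 2 * (-diffusion κ (profEta κ η₀ p) * innerFactor c η₀ (profEta κ η₀ p)) := by
  have h1 := ha.diffusion_inner_neg hp
  have h2 := ha.innerFactor_pos (ha.profEta_lt_one p)
  rw [profFlux, if_pos hp.le, mul_pow, ← profEta_inner hp.le,
    Real.sq_sqrt (mul_nonneg (by linarith) h2.le)]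
  ring

theorem slope_inner_pos (ha : Admissible c κ η₀) {p : ℝ} (h0 : 0 < p) (hp : p < crossing κ η₀) :
    0 < profFlux c κ η₀ p / diffusion κ (profEta κ η₀ p) := by
  have hp' : |p| < crossing κ η₀ := by rwa [abs_of_pos h0]
  have h1 := ha.diffusion_inner_neg hp'
  have h2 := ha.innerFactor_pos (ha.profEta_lt_one p)
  refine div_pos_of_neg_of_neg ?_ h1
  rw [profFlux, if_pos hp'.le, ← profEta_inner hp'.le]
  exact mul_neg_of_neg_of_pos (by linarith) (Real.sqrt_pos.2 (mul_pos (by linarith) h2))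

theorem profFlux_half (ha : Admissible c (1 / 2) η₀) {p : ℝ} (hp : crossing (1 / 2) η₀ < |p|) :
    profFlux c (1 / 2) η₀ p = 0 := by
  rw [profFlux, if_neg (not_le.2 hp), ha.profEta_half hp.le]; simp

theorem outer_sign_prof (ha : Admissible c κ η₀) (hκ : κ ≠ 1 / 2) {p : ℝ}
    (hp : crossing κ η₀ < |p|) :
    0 < diffusion κ (profEta κ η₀ p) * outerFactor c (profEta κ η₀ p) ∧
      profEta κ η₀ p * diffusion κ (profEta κ η₀ p) < 0 ∧
      2 * |profEta κ η₀ p| ≤ |outerFactor c (profEta κ η₀ p)| := by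
  obtain ⟨r, h1, h2, h3, -⟩ := ha.outer_exists hp
  rw [h3]
  exact ha.outer_sign h1 h2 hκ

theorem profFlux_sq_outer (ha : Admissible c κ η₀) (hκ : κ ≠ 1 / 2) {p : ℝ}
    (hp : crossing κ η₀ < |p|) : profFlux c κ η₀ p ^ 2 = profEta κ η₀ p ^ 2 *
      (diffusion κ (profEta κ η₀ p) * outerFactor c (profEta κ η₀ p)) := by
  have h1 := (ha.outer_sign_prof hκ hp).1
  have h2 : |p| ≠ 0 := (ha.crossing_pos.trans hp).ne'
  rw [profFlux, if_neg (not_le.2 hp), mul_pow, Real.sq_sqrt h1.le]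
  congr 1
  rw [mul_pow, mul_pow, div_pow, sq_abs, div_self (by simpa using h2)]
  split_ifs <;> ring

/-- The slope has the sign of `-η D` times the sign of `κ < 1/2`, and `η D < 0` on the outer region:
the profile moves from `η*` towards `0`. -/
theorem slope_outer_sign (ha : Admissible c κ η₀) (hκ : κ ≠ 1 / 2) {p : ℝ}
    (hp : crossing κ η₀ < p) :
    0 < (if κ < 1 / 2 then 1 else -1) * (profFlux c κ η₀ p / diffusion κ (profEta κ η₀ p)) := by
  have h0 := ha.crossing_pos.trans hp
  have hp' : crossing κ η₀ < |p| := by rwa [abs_of_pos h0]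
  obtain ⟨h1, h2, -⟩ := ha.outer_sign_prof hκ hp'
  have h3 : diffusion κ (profEta κ η₀ p) ≠ 0 := left_ne_zero_of_mul h1.ne'
  have h4 : (if κ < 1 / 2 then (1 : ℝ) else -1) * (profFlux c κ η₀ p / diffusion κ (profEta κ η₀ p))
      = -(profEta κ η₀ p * diffusion κ (profEta κ η₀ p)) *
        √(diffusion κ (profEta κ η₀ p) * outerFactor c (profEta κ η₀ p)) /
          diffusion κ (profEta κ η₀ p) ^ 2 := by
    rw [profFlux, abs_of_pos h0, if_neg (not_le.2 hp), div_self h0.ne']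
    split_ifs <;> field_simp
  rw [h4]
  exact div_pos (mul_pos (by linarith) (Real.sqrt_pos.2 h1)) (by positivity)

/-- The squared flux is a product in which, apart from the diffusion, the only vanishing factor is
`p²`. Hence the origin is the only critical point off the singular set. -/
theorem slope_ne_zero (ha : Admissible c κ η₀) {p : ℝ} (h0 : p ≠ 0)
    (hD : diffusion κ (profEta κ η₀ p) ≠ 0) :
    profFlux c κ η₀ p / diffusion κ (profEta κ η₀ p) ≠ 0 := by
  rw [ne_eq, div_eq_zero_iff, not_or]
  refine ⟨fun h => ?_, hD⟩
  have hsq : profFlux c κ η₀ p ^ 2 = 0 := by rw [h]; ring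
  rcases lt_trichotomy (|p|) (crossing κ η₀) with h1 | h1 | h1
  · rw [ha.profFlux_sq_inner h1] at hsq
    have h2 := ha.innerFactor_pos (ha.profEta_lt_one p)
    simp [h0, hD, h2.ne'] at hsq
  · rw [ha.profEta_crossing h1, ha.diffusion_etaStar] at hD
    exact hD rfl
  · by_cases hκ : κ = 1 / 2
    · subst hκ
      rw [ha.profEta_half h1.le, diffusion] at hD
      norm_num at hD
    · rw [ha.profFlux_sq_outer hκ h1] at hsq
      obtain ⟨h2, h3, -⟩ := ha.outer_sign_prof hκ h1
      have h4 : profEta κ η₀ p ≠ 0 := left_ne_zero_of_mul h3.ne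
      simp [h4, hD, right_ne_zero_of_mul h2.ne'] at hsq

theorem diffusion_eq_zero_iff (ha : Admissible c κ η₀) (hκ : κ ≠ 1 / 2) (p : ℝ) :
    diffusion κ (profEta κ η₀ p) = 0 ↔ |p| = crossing κ η₀ := by
  constructor
  · intro h
    rcases lt_trichotomy (|p|) (crossing κ η₀) with h1 | h1 | h1
    · exact absurd h (ha.diffusion_inner_neg h1).ne
    · exact h1
    · exact absurd h (left_ne_zero_of_mul (ha.outer_sign_prof hκ h1).1.ne')
  · intro h
    rw [ha.profEta_crossing h, ha.diffusion_etaStar]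

end Admissible

namespace ProfileClock

variable {c κ η₀ : ℝ} {P : ℝ → ℝ}

theorem zero (hP : ProfileClock c κ η₀ P) : P 0 = 0 := by
  have := hP.apply_clock 0
  rwa [clock_zero] at this

theorem apply_crossingPoint (hP : ProfileClock c κ η₀ P) :
    P (crossingPoint c κ η₀) = crossing κ η₀ := hP.apply_clock _

theorem crossingPoint_pos (ha : Admissible c κ η₀) (hP : ProfileClock c κ η₀ P) :
    0 < crossingPoint c κ η₀ := by
  rw [← hP.mono.lt_iff_lt, hP.zero, hP.apply_crossingPoint]
  exact ha.crossing_pos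

theorem abs_apply (hP : ProfileClock c κ η₀ P) (x : ℝ) : |P x| = P |x| := by
  rcases le_total 0 x with h | h
  · have := hP.mono.monotone h
    rw [hP.zero] at this
    rw [abs_of_nonneg h, abs_of_nonneg this]
  · have := hP.mono.monotone h
    rw [hP.zero] at this
    rw [abs_of_nonpos h, abs_of_nonpos this, hP.odd]

theorem abs_lt_iff (hP : ProfileClock c κ η₀ P) (x : ℝ) :
    |P x| < crossing κ η₀ ↔ |x| < crossingPoint c κ η₀ := by
  rw [hP.abs_apply, ← hP.apply_crossingPoint, hP.mono.lt_iff_lt]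

theorem lt_abs_iff (hP : ProfileClock c κ η₀ P) (x : ℝ) :
    crossing κ η₀ < |P x| ↔ crossingPoint c κ η₀ < |x| := by
  rw [hP.abs_apply, ← hP.apply_crossingPoint, hP.mono.lt_iff_lt]

theorem abs_eq_iff (hP : ProfileClock c κ η₀ P) (x : ℝ) :
    |P x| = crossing κ η₀ ↔ |x| = crossingPoint c κ η₀ := by
  rw [hP.abs_apply, ← hP.apply_crossingPoint, hP.mono.injective.eq_iff]

theorem ode (ha : Admissible c κ η₀) (hP : ProfileClock c κ η₀ P) {x : ℝ}
    (hx : |x| ≠ crossingPoint c κ η₀) :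
    HasDerivAt (fun y => profEta κ η₀ (P y))
      (profFlux c κ η₀ (P x) / diffusion κ (profEta κ η₀ (P x))) x ∧
    HasDerivAt (fun y => profFlux c κ η₀ (P y)) (fluxDeriv c κ (profEta κ η₀ (P x))
      (profFlux c κ η₀ (P x) / diffusion κ (profEta κ η₀ (P x)))) x := by
  have h1 : |P x| ≠ crossing κ η₀ := fun h => hx ((hP.abs_eq_iff x).1 h)
  obtain ⟨h', q', d1, d2, d3, d4⟩ := ha.param_ode (c := c) h1
  have hd := hP.deriv x fun h => h1 (ha.profRate_eq_zero h)
  rw [← d3] at d4 ⊢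
  rw [← d4]
  exact ⟨d1.comp x hd, d2.comp x hd⟩

theorem continuous_eta (ha : Admissible c κ η₀) (hP : ProfileClock c κ η₀ P) :
    Continuous (fun y => profEta κ η₀ (P y)) := ha.profEta_continuous.comp hP.cont

theorem continuous_flux (ha : Admissible c κ η₀) (hP : ProfileClock c κ η₀ P) :
    Continuous (fun y => profFlux c κ η₀ (P y)) := ha.profFlux_continuous.comp hP.cont

theorem measurable_slope (ha : Admissible c κ η₀) (hP : ProfileClock c κ η₀ P) :
    Measurable (fun y => profFlux c κ η₀ (P y) / diffusion κ (profEta κ η₀ (P y))) :=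
  (hP.continuous_flux ha).measurable.div
    (Admissible.continuous_diffusion.comp (hP.continuous_eta ha)).measurable

theorem eta_even (hP : ProfileClock c κ η₀ P) (x : ℝ) :
    profEta κ η₀ (P (-x)) = profEta κ η₀ (P x) := by rw [hP.odd, profEta_neg]

theorem flux_odd (hP : ProfileClock c κ η₀ P) (x : ℝ) :
    profFlux c κ η₀ (P (-x)) = -profFlux c κ η₀ (P x) := by rw [hP.odd, profFlux_neg]

theorem tendsto_atTop (hP : ProfileClock c κ η₀ P) : Tendsto P atTop atTop := by
  refine Filter.tendsto_atTop.2 fun b => ?_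
  filter_upwards [eventually_ge_atTop (clock (profRate c κ η₀) b)] with x hx
  rw [← hP.apply_clock b]
  exact hP.mono.monotone hx

theorem tendsto_eta (ha : Admissible c κ η₀) (hP : ProfileClock c κ η₀ P) :
    Tendsto (fun y => profEta κ η₀ (P y)) atTop (𝓝 0) := by
  have h1 : Tendsto (profEta κ η₀) atTop (𝓝 0) := by
    have h2 : Tendsto (fun p => etaStar κ * Real.exp (crossing κ η₀ - p)) atTop (𝓝 (etaStar κ * 0)) :=
      (Real.tendsto_exp_atBot.comp (tendsto_atBot_add_const_left _ _ tendsto_neg_atTop_atBot)).const_mul _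
    rw [mul_zero] at h2
    refine h2.congr' ?_
    filter_upwards [eventually_gt_atTop (crossing κ η₀)] with p hp
    have h3 : |p| = p := abs_of_pos (ha.crossing_pos.trans hp)
    rw [profEta, h3, if_neg (not_le.2 hp)]
  exact h1.comp hP.tendsto_atTop

/-- Near the crossing the slope is of order `1/s` with `s = √(η* - η)`, so its square is controlled
by `d/s = -2 s'`. That function is nonnegative with a continuous primitive, hence integrable. -/
theorem integrableOn_slope_inner (ha : Admissible c κ η₀) (hP : ProfileClock c κ η₀ P) :
    IntegrableOn (fun y => (profFlux c κ η₀ (P y) / diffusion κ (profEta κ η₀ (P y))) ^ 2)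
      (Ioc 0 (crossingPoint c κ η₀)) := by
  set R := crossingPoint c κ η₀
  set d := fun y => profFlux c κ η₀ (P y) / diffusion κ (profEta κ η₀ (P y))
  have hR : ∀ x ∈ Ioo 0 R, 0 < P x ∧ P x < crossing κ η₀ := fun x hx =>
    ⟨by rw [← hP.zero]; exact hP.mono hx.1, by rw [← hP.apply_crossingPoint]; exact hP.mono hx.2⟩
  have hlt : ∀ x ∈ Ioo 0 R, 0 < etaStar κ - profEta κ η₀ (P x) := fun x hx => by
    have h1 : |P x| < crossing κ η₀ := by rw [abs_of_pos (hR x hx).1]; exact (hR x hx).2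
    rw [Admissible.profEta_inner h1.le]
    linarith [ha.inner_lt h1]
  have hI : IntegrableOn (fun y => d y / (2 * √(etaStar κ - profEta κ η₀ (P y)))) (Ioc 0 R) := by
    refine intervalIntegral.integrableOn_deriv_of_nonneg
      (g := fun y => -√(etaStar κ - profEta κ η₀ (P y))) ?_ (fun x hx => ?_) (fun x hx => ?_)
    · exact (Real.continuous_sqrt.comp (continuous_const.sub (hP.continuous_eta ha))).neg.continuousOn
    · have h1 := (hP.ode ha (x := x) (by rw [abs_of_pos hx.1]; exact hx.2.ne)).1
      refine ((h1.const_sub (etaStar κ)).sqrt (hlt x hx).ne').neg.congr_deriv ?_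
      simp only [d]; ring
    · exact div_nonneg (ha.slope_inner_pos (hR x hx).1 (hR x hx).2).le (by positivity)
  obtain ⟨M, hM⟩ := (isCompact_Icc (a := -crossing κ η₀) (b := crossing κ η₀)).exists_bound_of_continuousOn
    (f := fun p => p ^ 2 * innerFactor c η₀ (profEta κ η₀ p) / (2 * κ))
    (((continuous_pow 2).mul (Admissible.continuous_innerFactor.comp ha.profEta_continuous)).div_const _).continuousOn
  rw [integrableOn_Ioc_iff_integrableOn_Ioo] at hI ⊢
  refine (hI.const_mul (2 * (M + 1))).mono' ((hP.measurable_slope ha).pow_const 2).aestronglyMeasurable ?_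
  rw [ae_restrict_iff' measurableSet_Ioo]
  refine Eventually.of_forall fun x hx => ?_
  rw [Real.norm_of_nonneg (sq_nonneg _)]
  have hd : 0 < d x := ha.slope_inner_pos (hR x hx).1 (hR x hx).2
  have hp : |P x| < crossing κ η₀ := by rw [abs_of_pos (hR x hx).1]; exact (hR x hx).2
  have hs := Real.sqrt_pos.2 (hlt x hx)
  have h2 := Real.sq_sqrt (hlt x hx).le
  set s := √(etaStar κ - profEta κ η₀ (P x))
  have h3 : (d x * s) ^ 2 ≤ M := by
    have h4 := hM (P x) (abs_le.1 hp.le)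
    have hD := ha.diffusion_inner_neg hp
    have h5 : (d x * s) ^ 2 = P x ^ 2 * innerFactor c η₀ (profEta κ η₀ (P x)) / (2 * κ) := by
      have h6 : etaStar κ - profEta κ η₀ (P x) = -diffusion κ (profEta κ η₀ (P x)) / (2 * κ) := by
        rw [diffusion_eq ha.pos]; have := ha.pos; field_simp; ring
      simp only [d]
      rw [mul_pow, h2, div_pow, ha.profFlux_sq_inner hp, h6]
      have := hD.ne
      have := ha.pos
      field_simp
    rw [h5]
    exact (le_abs_self _).trans h4
  -- From `2t ≤ t² + 1`; the bound `M + 1` avoids a square root of `M`.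
  have h6 : d x * s ≤ M + 1 := by nlinarith [sq_nonneg (d x * s - 1)]
  change d x ^ 2 ≤ 2 * (M + 1) * (d x / (2 * s))
  have h7 : 2 * (M + 1) * (d x / (2 * s)) = (M + 1) * d x / s := by field_simp
  rw [h7, le_div_iff₀ hs]
  nlinarith

/-- The slope is treated as on the inner side, with a primitive `√(σ(η - η*))` having a limit at
infinity. For `η²` the bound is `η² ≤ C|η'|`, whose right side is integrable because `η` is monotone
with limit `0`. No exponential decay is used, so `c = √2` is covered. -/
theorem integrableOn_slope_outer (ha : Admissible c κ η₀) (hP : ProfileClock c κ η₀ P) :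
    IntegrableOn (fun y => (profFlux c κ η₀ (P y) / diffusion κ (profEta κ η₀ (P y))) ^ 2)
      (Ioi (crossingPoint c κ η₀)) ∧
    IntegrableOn (fun y => profEta κ η₀ (P y) ^ 2) (Ioi (crossingPoint c κ η₀)) := by
  have hR0 := hP.crossingPoint_pos ha
  set R := crossingPoint c κ η₀
  have hR : ∀ x ∈ Ioi R, crossing κ η₀ < P x := fun x hx => by
    rw [← hP.apply_crossingPoint]; exact hP.mono hx
  have hR' : ∀ x ∈ Ioi R, crossing κ η₀ < |P x| := fun x hx => (hR x hx).trans_le (le_abs_self _)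
  by_cases hκ : κ = 1 / 2
  · subst hκ
    constructor
    · refine IntegrableOn.congr_fun integrableOn_zero (fun x hx => ?_) measurableSet_Ioi
      rw [ha.profFlux_half (hR' x hx)]; simp
    · refine IntegrableOn.congr_fun integrableOn_zero (fun x hx => ?_) measurableSet_Ioi
      rw [ha.profEta_half (hR' x hx).le]; simp
  -- With this sign both `σ d` and `σ(η - η*)` are positive on the outer region.
  set σ : ℝ := if κ < 1 / 2 then 1 else -1 with hσdef
  have hσ : σ ^ 2 = 1 := by simp only [hσdef]; split_ifs <;> norm_num
  set d := fun y => profFlux c κ η₀ (P y) / diffusion κ (profEta κ η₀ (P y))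
  have hd : ∀ x ∈ Ioi R, 0 < σ * d x := fun x hx => ha.slope_outer_sign hκ (hR x hx)
  have hdη : ∀ x ∈ Ioi R, HasDerivAt (fun y => profEta κ η₀ (P y)) (d x) x := fun x hx =>
    (hP.ode ha (by rw [abs_of_pos (hR0.trans hx)]; exact (ne_of_gt hx))).1
  have hη := hP.continuous_eta ha
  have hσD : ∀ x ∈ Ioi R, 0 < σ * (profEta κ η₀ (P x) - etaStar κ) := fun x hx => by
    obtain ⟨r, h1, h2, h3, h4⟩ := ha.outer_exists (hR' x hx)
    have h5 := diffusion_eq ha.pos (etaStar κ * r)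
    rw [h4] at h5
    rw [h3]
    have h6 : 0 < 2 * κ * (σ * (etaStar κ * r - etaStar κ)) := by
      have : 2 * κ * (σ * (etaStar κ * r - etaStar κ)) = σ * (1 - 2 * κ) * (1 - r) := by
        linear_combination -σ * h5
      rw [this]
      refine mul_pos ?_ (by linarith)
      simp only [hσdef]
      split_ifs with h
      · linarith
      · have := lt_of_le_of_ne (not_lt.1 h) (Ne.symm hκ); linarith
    have := ha.pos
    exact pos_of_mul_pos_right h6 (by linarith)
  have hfirst : ∀ x ∈ Ioi R, d x ^ 2 * diffusion κ (profEta κ η₀ (P x)) =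
      profEta κ η₀ (P x) ^ 2 * outerFactor c (profEta κ η₀ (P x)) := fun x hx => by
    have h1 := left_ne_zero_of_mul (ha.outer_sign_prof hκ (hR' x hx)).1.ne'
    simp only [d]
    rw [div_pow, ha.profFlux_sq_outer hκ (hR' x hx)]
    field_simp
  have hbH : ∀ x ∈ Ioi R, |profEta κ η₀ (P x)| ≤ |etaStar κ| := fun x hx => by
    obtain ⟨r, h1, h2, h3⟩ := ha.outer_exists' (hR' x hx).le
    rw [h3, abs_mul, abs_of_pos h1]
    exact mul_le_of_le_one_right (abs_nonneg _) h2
  have hbD : ∀ x ∈ Ioi R, |diffusion κ (profEta κ η₀ (P x))| ≤ |1 - 2 * κ| := fun x hx => by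
    obtain ⟨r, h1, h2, h3, h4⟩ := ha.outer_exists (hR' x hx)
    rw [h3, h4, abs_mul, abs_of_pos (by linarith : 0 < 1 - r)]
    exact mul_le_of_le_one_right (abs_nonneg _) (by linarith)
  have hbB : ∀ x ∈ Ioi R, |outerFactor c (profEta κ η₀ (P x))| ≤ |2 - c ^ 2| + 2 * |etaStar κ| :=
    fun x hx => by
      unfold outerFactor
      refine (abs_sub _ _).trans ?_
      rw [abs_mul, abs_two]
      linarith [hbH x hx]
  constructor
  · have hI : IntegrableOn (fun y => σ * d y / (2 * √(σ * (profEta κ η₀ (P y) - etaStar κ)))) (Ioi R) := by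
      refine integrableOn_Ioi_deriv_of_nonneg
        (g := fun y => √(σ * (profEta κ η₀ (P y) - etaStar κ))) ?_ (fun x hx => ?_) (fun x hx => ?_)
        (l := √(σ * (0 - etaStar κ))) ?_
      · exact (Real.continuous_sqrt.comp
          (continuous_const.mul (hη.sub continuous_const))).continuousWithinAt
      · exact (((hdη x hx).sub_const _).const_mul σ).sqrt (hσD x hx).ne'
      · exact div_nonneg (hd x hx).le (by positivity)
      · exact (((hP.tendsto_eta ha).sub_const _).const_mul σ).sqrt
    set M := |etaStar κ| ^ 2 * (|2 - c ^ 2| + 2 * |etaStar κ|) / (2 * κ)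
    refine (hI.const_mul (2 * (M + 1))).mono' ((hP.measurable_slope ha).pow_const 2).aestronglyMeasurable ?_
    rw [ae_restrict_iff' measurableSet_Ioi]
    refine Eventually.of_forall fun x hx => ?_
    rw [Real.norm_of_nonneg (sq_nonneg _)]
    have hs := Real.sqrt_pos.2 (hσD x hx)
    have h2 := Real.sq_sqrt (hσD x hx).le
    change d x ^ 2 ≤ 2 * (M + 1) * (σ * d x / (2 * √(σ * (profEta κ η₀ (P x) - etaStar κ))))
    set s := √(σ * (profEta κ η₀ (P x) - etaStar κ))
    have h3 : (σ * d x * s) ^ 2 ≤ M := by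
      have h4 : (σ * d x * s) ^ 2 = σ * (profEta κ η₀ (P x) ^ 2 * outerFactor c (profEta κ η₀ (P x))) / (2 * κ) := by
        rw [← hfirst x hx, mul_pow, mul_pow, h2, hσ, diffusion_eq ha.pos]
        have := ha.pos
        field_simp
      rw [h4]
      have h5 := hbH x hx
      have h6 := hbB x hx
      have := ha.pos
      refine div_le_div_of_nonneg_right ?_ (by linarith)
      refine (le_abs_self _).trans ?_
      have h7 : |σ| = 1 := by simp only [hσdef]; split_ifs <;> norm_num
      rw [abs_mul, h7, one_mul, abs_mul, abs_pow]
      gcongr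
    have h6 : σ * d x * s ≤ M + 1 := by nlinarith [sq_nonneg (σ * d x * s - 1)]
    have h7 : 2 * (M + 1) * (σ * d x / (2 * s)) = (M + 1) * (σ * d x) / s := by field_simp
    rw [h7, le_div_iff₀ hs]
    have h8 := hd x hx
    have h9 : d x ^ 2 * s = (σ * d x * s) * (σ * d x) := by linear_combination -(d x ^ 2 * s) * hσ
    rw [h9]
    exact mul_le_mul_of_nonneg_right h6 h8.le
  · have hI : IntegrableOn (fun y => σ * d y) (Ioi R) := by
      refine integrableOn_Ioi_deriv_of_nonneg
        (g := fun y => σ * profEta κ η₀ (P y)) ?_ (fun x hx => ?_) (fun x hx => (hd x hx).le)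
        (l := σ * 0) ?_
      · exact (continuous_const.mul hη).continuousWithinAt
      · exact (hdη x hx).const_mul σ
      · exact (hP.tendsto_eta ha).const_mul σ
    set C := 1 + |etaStar κ| * |1 - 2 * κ| with hC
    refine (hI.const_mul C).mono' (hη.pow 2).measurable.aestronglyMeasurable ?_
    rw [ae_restrict_iff' measurableSet_Ioi]
    refine Eventually.of_forall fun x hx => ?_
    rw [Real.norm_of_nonneg (sq_nonneg _)]
    obtain ⟨g1, g2, g3⟩ := ha.outer_sign_prof hκ (hR' x hx)
    have h1 := hfirst x hx
    have h2 := hbH x hx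
    have h3 := hbD x hx
    have hd0 := hd x hx
    set h := profEta κ η₀ (P x)
    set D := diffusion κ h
    set B := outerFactor c h
    have hD0 : 0 < |D| := abs_pos.2 (left_ne_zero_of_mul g1.ne')
    have h4 : d x ^ 2 * |D| = h ^ 2 * |B| := by
      have := congrArg abs h1
      rwa [abs_mul, abs_mul, abs_of_nonneg (sq_nonneg (d x)), abs_of_nonneg (sq_nonneg h)] at this
    have hC1 : 1 ≤ C := by rw [hC]; have := mul_nonneg (abs_nonneg (etaStar κ)) (abs_nonneg (1 - 2 * κ)); linarith
    have h5 : |h| * |D| ≤ C ^ 2 * 2 := by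
      have : |h| * |D| ≤ |etaStar κ| * |1 - 2 * κ| := by gcongr
      nlinarith
    -- After multiplication by `|D|`, the first integral `d²|D| = h²|B|` and the bound `2|h| ≤ |B|`
    -- give it. The latter is an equality when `c = √2`.
    have h6 : (h ^ 2) ^ 2 ≤ (C * (σ * d x)) ^ 2 := by
      have h7 : (C * (σ * d x)) ^ 2 = C ^ 2 * d x ^ 2 := by
        linear_combination C ^ 2 * d x ^ 2 * hσ
      rw [h7]
      refine le_of_mul_le_mul_right ?_ hD0
      have h8 : (h ^ 2) ^ 2 * |D| = h ^ 2 * (|h| * (|h| * |D|)) := by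
        rw [← sq_abs h]; ring
      rw [h8, mul_assoc, h4]
      have h9 : |h| * (|h| * |D|) ≤ C ^ 2 * |B| := by
        calc |h| * (|h| * |D|) ≤ |h| * (C ^ 2 * 2) := by gcongr
          _ = C ^ 2 * (2 * |h|) := by ring
          _ ≤ C ^ 2 * |B| := by gcongr
      nlinarith [sq_nonneg h]
    exact (abs_le_of_sq_le_sq' h6 (by positivity)).2

theorem integrable_slope_sq (ha : Admissible c κ η₀) (hP : ProfileClock c κ η₀ P) :
    Integrable (fun y => (profFlux c κ η₀ (P y) / diffusion κ (profEta κ η₀ (P y))) ^ 2) := by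
  refine integrable_of_even_of_integrableOn_Ioi (fun x => ?_) ?_
  · rw [hP.flux_odd, hP.eta_even, neg_div, neg_sq]
  · rw [← Ioc_union_Ioi_eq_Ioi (hP.crossingPoint_pos ha).le]
    exact (hP.integrableOn_slope_inner ha).union (hP.integrableOn_slope_outer ha).1

theorem integrable_eta_sq (ha : Admissible c κ η₀) (hP : ProfileClock c κ η₀ P) :
    Integrable (fun y => profEta κ η₀ (P y) ^ 2) := by
  refine integrable_of_even_of_integrableOn_Ioi (fun x => by rw [hP.eta_even]) ?_
  rw [← Ioc_union_Ioi_eq_Ioi (hP.crossingPoint_pos ha).le]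
  refine IntegrableOn.union ?_ (hP.integrableOn_slope_outer ha).2
  exact ((hP.continuous_eta ha).pow 2).integrableOn_Ioc

/-- On the inner side the slope is `2p` divided by the rate; at the crossing `p` stays positive and
the rate tends to `0` from above, so the left derivative is infinite. Evenness transfers this to the
other point. -/
theorem not_differentiableAt_eta (ha : Admissible c κ η₀) (hP : ProfileClock c κ η₀ P) {x : ℝ}
    (hx : |x| = crossingPoint c κ η₀) :
    ¬ DifferentiableAt ℝ (fun y => profEta κ η₀ (P y)) x := by
  have hR0 := hP.crossingPoint_pos ha
  have key : ¬ DifferentiableAt ℝ (fun y => profEta κ η₀ (P y)) (crossingPoint c κ η₀) := by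
    intro h
    refine not_differentiableWithinAt_of_deriv_tendsto_atTop_Iio _ ?_ h.differentiableWithinAt
    have h1 : Tendsto (fun y => profRate c κ η₀ (P y)) (𝓝[<] (crossingPoint c κ η₀)) (𝓝[>] 0) := by
      refine tendsto_nhdsWithin_iff.2 ⟨?_, ?_⟩
      · have := (ha.profRate_continuous.comp hP.cont).tendsto (crossingPoint c κ η₀)
        have h0 : profRate c κ η₀ (P (crossingPoint c κ η₀)) = 0 := by
          rw [hP.apply_crossingPoint, profRate, abs_of_pos ha.crossing_pos, if_pos le_rfl,
            ha.crossing_sq, add_sub_cancel, ha.diffusion_etaStar]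
          simp
        simp only [Function.comp_def, h0] at this
        exact this.mono_left nhdsWithin_le_nhds
      · filter_upwards [Ioo_mem_nhdsLT hR0] with y hy
        exact ha.profRate_inner_pos ((hP.abs_lt_iff y).2 (by rw [abs_of_pos hy.1]; exact hy.2))
    have h2 : Tendsto (fun y => 2 * P y * (profRate c κ η₀ (P y))⁻¹) (𝓝[<] (crossingPoint c κ η₀)) atTop := by
      refine Tendsto.pos_mul_atTop (C := 2 * crossing κ η₀) (by linarith [ha.crossing_pos]) ?_
        h1.inv_tendsto_nhdsGT_zero
      rw [← hP.apply_crossingPoint]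
      exact ((hP.cont.tendsto _).const_mul 2).mono_left nhdsWithin_le_nhds
    refine h2.congr' ?_
    filter_upwards [Ioo_mem_nhdsLT hR0] with y hy
    have hp := (hP.abs_lt_iff y).2 (by rw [abs_of_pos hy.1]; exact hy.2)
    have hd := hP.deriv y (ha.profRate_inner_pos hp).ne'
    have hH : HasDerivAt (profEta κ η₀) (2 * P y) (P y) := by
      have : HasDerivAt (fun t : ℝ => η₀ + t ^ 2) (2 * P y) (P y) := by
        simpa using (hasDerivAt_pow 2 (P y)).const_add η₀
      refine this.congr_of_eventuallyEq ?_
      filter_upwards [continuous_abs.continuousAt.eventually_lt_const hp] with t ht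
      exact Admissible.profEta_inner ht.le
    exact (hH.comp y hd).deriv.symm
  rcases (abs_eq hR0.le).1 hx with h | h
  · rwa [h]
  · intro hd
    apply key
    have h1 : (fun y => profEta κ η₀ (P y)) = (fun y => profEta κ η₀ (P y)) ∘ Neg.neg :=
      funext fun y => (hP.eta_even y).symm
    rw [h1]
    rw [h] at hd
    exact hd.comp _ differentiable_neg.differentiableAt

end ProfileClock

/-! ### From a scalar profile to a weak solution -/

theorem locL2_of_continuous {v : ℝ → ℂ} (hv : Continuous v) : LocL2 v := by
  intro K hK
  rw [memLp_two_iff_integrable_sq_norm hv.aestronglyMeasurable]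
  exact (hv.norm.pow 2).continuousOn.integrableOn_compact hK

/-- The weak form is at most quadratic in the gradient, and a compactly supported multiple of `1 +
|u'|²` dominates it. -/
theorem integrable_of_le_compactSupport {b e F : ℝ → ℝ} (hb : Continuous b)
    (hbc : HasCompactSupport b) (he : Integrable e) (he0 : ∀ x, 0 ≤ e x)
    (hF : AEStronglyMeasurable F) (h : ∀ x, |F x| ≤ b x * (1 + e x)) : Integrable F := by
  obtain ⟨B, hB⟩ := hb.bounded_above_of_compact_support hbc
  refine ((hb.integrable_of_hasCompactSupport hbc).add (he.const_mul B)).mono' hF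
    (Eventually.of_forall fun x => (h x).trans ?_)
  have h1 : b x ≤ B := (le_abs_self _).trans (hB x)
  simp only [Pi.add_apply]
  nlinarith [mul_le_mul_of_nonneg_right h1 (he0 x)]

/-- The hypotheses on a scalar profile `η` with slope `d` and flux `q` that make it the intensity
profile of a travelling wave; the equations may fail on the countable set `s`. -/
structure ScalarProfile (c κ δ : ℝ) (s : Set ℝ) (η d q : ℝ → ℝ) : Prop where
  countable : s.Countable
  pos : 0 < δ
  cont : Continuous η
  cont_flux : Continuous q
  gap : ∀ x, δ ≤ 1 - η x
  hasDerivAt : ∀ x, x ∉ s → HasDerivAt η (d x) x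
  hasDerivAt_flux : ∀ x, x ∉ s → HasDerivAt q (fluxDeriv c κ (η x) (d x)) x
  flux : ∀ x, x ∉ s → q x = diffusion κ (η x) * d x
  measurable_slope : Measurable d
  sq_slope : Integrable (fun x => d x ^ 2)
  sq : Integrable (fun x => η x ^ 2)

/-- The wave with intensity profile `η` and momentum `c η / 2`. -/
noncomputable def waveOf (c : ℝ) (η : ℝ → ℝ) (x : ℝ) : ℂ :=
  (√(1 - η x) : ℝ) * Complex.exp (Complex.I * (∫ t in (0 : ℝ)..x, c * η t / (2 * (1 - η t)) : ℝ))

/-- The logarithmic derivative of the wave with intensity `η` of slope `d`. -/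
noncomputable def logSlope (c η d : ℝ) : ℂ := (-d + Complex.I * c * η) / (2 * (1 - η))

namespace ScalarProfile

variable {c κ δ : ℝ} {s : Set ℝ} {η d q : ℝ → ℝ}

theorem gap_pos (h : ScalarProfile c κ δ s η d q) (x : ℝ) : 0 < 1 - η x := h.pos.trans_le (h.gap x)

theorem norm_sq_wave (h : ScalarProfile c κ δ s η d q) (x : ℝ) : ‖waveOf c η x‖ ^ 2 = 1 - η x := by
  rw [waveOf, norm_mul, mul_comm Complex.I, Complex.norm_exp_ofReal_mul_I, mul_one,
    Complex.norm_real, Real.norm_of_nonneg (Real.sqrt_nonneg _), Real.sq_sqrt (h.gap_pos x).le]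

theorem eta_wave (h : ScalarProfile c κ δ s η d q) (x : ℝ) : eta (waveOf c η) x = η x := by
  rw [eta, h.norm_sq_wave]; ring

theorem continuous_phase (h : ScalarProfile c κ δ s η d q) :
    Continuous (fun t => c * η t / (2 * (1 - η t))) :=
  (continuous_const.mul h.cont).div (continuous_const.mul (continuous_const.sub h.cont))
    fun x => by have := h.gap_pos x; positivity

theorem continuous_wave (h : ScalarProfile c κ δ s η d q) : Continuous (waveOf c η) := by
  unfold waveOf
  have h1 : Continuous (fun x => ∫ t in (0 : ℝ)..x, c * η t / (2 * (1 - η t))) :=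
    intervalIntegral.continuous_primitive (fun a b => h.continuous_phase.intervalIntegrable a b) 0
  have h2 := h.cont
  fun_prop

theorem hasDerivAt_wave (h : ScalarProfile c κ δ s η d q) {x : ℝ} (hx : x ∉ s) :
    HasDerivAt (waveOf c η) (waveOf c η x * logSlope c (η x) (d x)) x := by
  have hm := h.gap_pos x
  have h1 : HasDerivAt (fun y => ∫ t in (0 : ℝ)..y, c * η t / (2 * (1 - η t)))
      (c * η x / (2 * (1 - η x))) x :=
    intervalIntegral.integral_hasDerivAt_right (h.continuous_phase.intervalIntegrable _ _)
      h.continuous_phase.stronglyMeasurable.stronglyMeasurableAtFilter h.continuous_phase.continuousAt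
  have h2 := ((h.hasDerivAt x hx).const_sub 1).sqrt hm.ne'
  have h3 := h2.ofReal_comp.mul (h1.ofReal_comp.const_mul Complex.I).cexp
  refine h3.congr_deriv ?_
  have hs : (√(1 - η x) : ℂ) ≠ 0 := by exact_mod_cast (Real.sqrt_pos.2 hm).ne'
  have hs2 : ((√(1 - η x) : ℝ) : ℂ) ^ 2 = 1 - η x := by
    rw [← Complex.ofReal_pow, Real.sq_sqrt hm.le]; push_cast; ring
  have hm' : (1 - η x : ℂ) ≠ 0 := by exact_mod_cast hm.ne'
  unfold waveOf logSlope
  push_cast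
  field_simp
  rw [hs2]
  ring

theorem norm_sq_slope (h : ScalarProfile c κ δ s η d q) (x : ℝ) :
    ‖waveOf c η x * logSlope c (η x) (d x)‖ ^ 2 = (d x ^ 2 + c ^ 2 * η x ^ 2) / (4 * (1 - η x)) := by
  have hm := h.gap_pos x
  have h1 : logSlope c (η x) (d x) = ((-d x / (2 * (1 - η x)) : ℝ) : ℂ)
      + ((c * η x / (2 * (1 - η x)) : ℝ) : ℂ) * Complex.I := by
    unfold logSlope; push_cast; ring
  rw [norm_mul, mul_pow, h.norm_sq_wave, h1, ← Complex.normSq_eq_norm_sq, Complex.normSq_add_mul_I]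
  field_simp
  ring

theorem measurable_gradient (h : ScalarProfile c κ δ s η d q) :
    Measurable (fun x => waveOf c η x * logSlope c (η x) (d x)) := by
  refine h.continuous_wave.measurable.mul ?_
  unfold logSlope
  have h1 := h.measurable_slope
  have h2 := h.cont.measurable
  fun_prop

theorem integrable_gradient_sq (h : ScalarProfile c κ δ s η d q) :
    Integrable (fun x => ‖waveOf c η x * logSlope c (η x) (d x)‖ ^ 2) := by
  refine ((h.sq_slope.add (h.sq.const_mul (c ^ 2))).const_mul (1 / (4 * δ))).mono'
    (h.measurable_gradient.norm.pow_const 2).aestronglyMeasurable (Eventually.of_forall fun x => ?_)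
  have hm := h.gap_pos x
  have hδ := h.pos
  rw [Real.norm_of_nonneg (sq_nonneg _), h.norm_sq_slope, div_eq_mul_one_div, mul_comm]
  refine mul_le_mul_of_nonneg_right ?_ (by positivity)
  exact one_div_le_one_div_of_le (by positivity) (by linarith [h.gap x])

theorem memLp_gradient (h : ScalarProfile c κ δ s η d q) :
    MemLp (fun x => waveOf c η x * logSlope c (η x) (d x)) 2 volume := by
  rw [memLp_two_iff_integrable_sq_norm h.measurable_gradient.aestronglyMeasurable]
  exact h.integrable_gradient_sq

theorem hasWeakDeriv_wave (h : ScalarProfile c κ δ s η d q) :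
    HasWeakDeriv (waveOf c η) (fun x => waveOf c η x * logSlope c (η x) (d x)) := by
  have hg : LocallyIntegrable (fun x => waveOf c η x * logSlope c (η x) (d x)) volume :=
    h.memLp_gradient.locallyIntegrable (by norm_num)
  have hu := h.continuous_wave.locallyIntegrable (μ := volume)
  refine ⟨hu, hg, fun φ hφ hc => ?_⟩
  have hi1 : Integrable (fun x => deriv φ x • waveOf c η x) :=
    hu.integrable_smul_left_of_hasCompactSupport (hφ.continuous_deriv (by simp)) hc.deriv
  have hi2 : Integrable (fun x => φ x • (waveOf c η x * logSlope c (η x) (d x))) :=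
    hg.integrable_smul_left_of_hasCompactSupport hφ.continuous hc
  have h0 := integral_deriv_eq_zero_off_countable (f := fun x => φ x • waveOf c η x) h.countable
    (hφ.continuous.smul h.continuous_wave) (hc.smul_right) (fun x hx =>
      ((hφ.differentiable (by simp) x).hasDerivAt).smul (h.hasDerivAt_wave hx)) (hi2.add hi1)
  have h1 := integral_add hi2 hi1
  have h2 : (∫ x, φ x • (waveOf c η x * logSlope c (η x) (d x))) + ∫ x, deriv φ x • waveOf c η x = 0 := by
    rw [← h1]; exact h0
  rw [eq_neg_iff_add_eq_zero, add_comm]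
  exact h2

theorem inX_wave (h : ScalarProfile c κ δ s η d q) : InX (waveOf c η) := by
  have hL := h.memLp_gradient
  refine ⟨h.continuous_wave, ⟨locL2_of_continuous h.continuous_wave, _, h.hasWeakDeriv_wave,
    fun K _ => hL.mono_measure Measure.restrict_le_self⟩, ?_, _, h.hasWeakDeriv_wave, hL⟩
  have h1 : eta (waveOf c η) = η := funext h.eta_wave
  rw [h1, memLp_two_iff_integrable_sq_norm h.cont.aestronglyMeasurable]
  simpa using h.sq

theorem inNX_wave (h : ScalarProfile c κ δ s η d q) : InNX (waveOf c η) := by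
  refine ⟨h.inX_wave, (Real.sqrt_pos.2 h.pos).trans_le (le_ciInf fun x => ?_)⟩
  rw [Real.sqrt_le_left (norm_nonneg _), h.norm_sq_wave]
  exact h.gap x

theorem inner_wave (h : ScalarProfile c κ δ s η d q) (x : ℝ) :
    inner ℝ (waveOf c η x) (waveOf c η x * logSlope c (η x) (d x)) = -d x / 2 := by
  have hm := h.gap_pos x
  have h1 : logSlope c (η x) (d x) = ((-d x / (2 * (1 - η x)) : ℝ) : ℂ)
      + ((c * η x / (2 * (1 - η x)) : ℝ) : ℂ) * Complex.I := by
    unfold logSlope; push_cast; ring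
  have h2 := h.norm_sq_wave x
  rw [← Complex.normSq_eq_norm_sq, Complex.normSq_apply] at h2
  rw [Complex.inner, h1]
  generalize waveOf c η x = z at *
  simp only [Complex.mul_re, Complex.mul_im, Complex.conj_re, Complex.conj_im, Complex.add_re,
    Complex.add_im, Complex.ofReal_re, Complex.ofReal_im, Complex.I_re, Complex.I_im]
  field_simp
  linear_combination (-d x) * h2

/-- Replacing the slope `d` by the flux `q` in the logarithmic derivative gives the vector `u' -
2κ⟨u,u'⟩u`, since `⟨u,u'⟩ = -d/2`. Written with `q` it is continuous across the singular points, and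
its derivative is the travelling wave equation in divergence form. -/
theorem hasDerivAt_fluxVector (h : ScalarProfile c κ δ s η d q) {x : ℝ} (hx : x ∉ s) :
    HasDerivAt (fun y => waveOf c η y * logSlope c (η y) (q y))
      (-(Complex.I * (c : ℂ) * (waveOf c η x * logSlope c (η x) (d x)) + waveOf c η x * (η x : ℂ)
        - (κ * d x : ℝ) * (waveOf c η x * logSlope c (η x) (d x)))) x := by
  have hm := h.gap_pos x
  have h1 := (h.hasDerivAt x hx).ofReal_comp
  have h2 := (h.hasDerivAt_flux x hx).ofReal_comp
  have hm' : (1 - η x : ℂ) ≠ 0 := by exact_mod_cast hm.ne'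
  have h3 := (h2.neg.add (h1.const_mul (Complex.I * c))).div ((h1.const_sub 1).const_mul 2)
    (mul_ne_zero two_ne_zero hm')
  refine ((h.hasDerivAt_wave hx).mul h3).congr_deriv ?_
  have h4 : (q x : ℂ) = (1 - 2 * κ + 2 * κ * η x) * d x := by
    rw [h.flux x hx, diffusion]; push_cast; ring
  simp only [Pi.add_apply, Pi.neg_apply, Pi.div_apply, logSlope, fluxDeriv]
  push_cast
  rw [h4]
  linear_combination (norm := skip) waveOf c η x *
    ((c : ℂ) ^ 2 * η x ^ 2 / (4 * (1 - η x) ^ 2) + (c : ℂ) ^ 2 * η x / (2 * (1 - η x))) * Complex.I_sq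
  field_simp
  ring

theorem fluxVector_eq (h : ScalarProfile c κ δ s η d q) {x : ℝ} (hx : x ∉ s) :
    waveOf c η x * logSlope c (η x) (q x) =
      waveOf c η x * logSlope c (η x) (d x) + (κ * d x) • waveOf c η x := by
  have hm := h.gap_pos x
  have hm' : (1 - η x : ℂ) ≠ 0 := by exact_mod_cast hm.ne'
  have h4 : (q x : ℂ) = (1 - 2 * κ + 2 * κ * η x) * d x := by
    rw [h.flux x hx, diffusion]; push_cast; ring
  rw [Complex.real_smul]
  unfold logSlope
  push_cast
  rw [h4]
  field_simp
  ring

/-- Off the exceptional set the integrand is the derivative of `-⟨W, φ⟩`, where `W` is the flux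
vector. As `W` is continuous, the countable set contributes no jump and the integral vanishes. -/
theorem isWeakSolution_wave (h : ScalarProfile c κ δ s η d q) : IsWeakSolution c κ (waveOf c η) := by
  refine ⟨_, h.hasWeakDeriv_wave, fun φ hφ hc => ?_⟩
  set u := waveOf c η with hu
  set g := fun x => u x * logSlope c (η x) (d x) with hg
  have hφ' : Continuous (deriv φ) := hφ.continuous_deriv (by simp)
  have hgm : Measurable g := h.measurable_gradient
  have hη : Continuous η := h.cont
  have huc : Continuous u := h.continuous_wave
  have hint : Integrable (fun x => inner ℝ (Complex.I * (c : ℂ) * g x + u x * ((eta u x : ℝ) : ℂ)) (φ x)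
        - inner ℝ (g x) (deriv φ x)
        + 2 * κ * inner ℝ (u x) (g x) * (inner ℝ (g x) (φ x) + inner ℝ (u x) (deriv φ x))) := by
    have heu : eta u = η := funext h.eta_wave
    simp only [heu]
    refine integrable_of_le_compactSupport
      (b := fun x => (|c| + 1 + 2 * |κ| * ‖u x‖ + ‖u x‖ * |η x| + 2 * |κ| * ‖u x‖ ^ 2) *
        (‖φ x‖ + ‖deriv φ x‖)) (e := fun x => ‖g x‖ ^ 2) ?_ ?_ h.integrable_gradient_sq
      (fun x => sq_nonneg _) ?_ fun x => ?_
    · have := hφ.continuous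
      fun_prop
    · exact (hc.norm.add hc.deriv.norm).mul_left
    · have h1 := hφ.continuous.measurable
      have h2 := hφ'.measurable
      have h3 := huc.measurable
      have h4 := hη.measurable
      refine Measurable.aestronglyMeasurable ?_
      have h5 : Measurable (fun x => Complex.I * (c : ℂ) * g x + u x * ((η x : ℝ) : ℂ)) := by fun_prop
      exact ((h5.inner h1).sub (hgm.inner h2)).add
        (((h3.inner hgm).const_mul _).mul ((hgm.inner h1).add (h3.inner h2)))
    · have i1 := abs_real_inner_le_norm (Complex.I * (c : ℂ) * g x + u x * ((η x : ℝ) : ℂ)) (φ x)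
      have i2 := abs_real_inner_le_norm (g x) (deriv φ x)
      have i3 := abs_real_inner_le_norm (u x) (g x)
      have i4 := abs_real_inner_le_norm (g x) (φ x)
      have i5 := abs_real_inner_le_norm (u x) (deriv φ x)
      have i6 : ‖Complex.I * (c : ℂ) * g x + u x * ((η x : ℝ) : ℂ)‖ ≤ |c| * ‖g x‖ + ‖u x‖ * |η x| := by
        refine (norm_add_le _ _).trans_eq ?_
        simp
      have e1 : |(2 : ℝ) * κ| = 2 * |κ| := by rw [abs_mul, abs_two]
      refine (abs_add_le _ _).trans ?_
      refine (add_le_add (abs_sub _ _) le_rfl).trans ?_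
      rw [abs_mul, abs_mul, e1]
      have j1 : |inner ℝ (g x) (φ x) + inner ℝ (u x) (deriv φ x)| ≤ ‖g x‖ * ‖φ x‖ + ‖u x‖ * ‖deriv φ x‖ :=
        (abs_add_le _ _).trans (add_le_add i4 i5)
      have j2 : 2 * |κ| * |inner ℝ (u x) (g x)| * |inner ℝ (g x) (φ x) + inner ℝ (u x) (deriv φ x)|
          ≤ 2 * |κ| * (‖u x‖ * ‖g x‖) * (‖g x‖ * ‖φ x‖ + ‖u x‖ * ‖deriv φ x‖) := by gcongr
      have j3 : |inner ℝ (Complex.I * (c : ℂ) * g x + u x * ((η x : ℝ) : ℂ)) (φ x)|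
          ≤ (|c| * ‖g x‖ + ‖u x‖ * |η x|) * ‖φ x‖ := i1.trans (by gcongr)
      refine (add_le_add (add_le_add j3 i2) j2).trans ?_
      have k1 : ‖g x‖ ≤ 1 + ‖g x‖ ^ 2 := by nlinarith [sq_nonneg (‖g x‖ - 1), sq_nonneg (‖g x‖)]
      have k2 : (1 : ℝ) ≤ 1 + ‖g x‖ ^ 2 := by nlinarith [sq_nonneg (‖g x‖)]
      have k3 : ‖g x‖ ^ 2 ≤ 1 + ‖g x‖ ^ 2 := by linarith
      set G := 1 + ‖g x‖ ^ 2
      have n1 := norm_nonneg (u x)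
      have n2 := norm_nonneg (φ x)
      have n3 := norm_nonneg (deriv φ x)
      have n4 := abs_nonneg κ
      have n5 := abs_nonneg c
      have n6 := abs_nonneg (η x)
      have n7 := norm_nonneg (g x)
      have m1 : |c| * ‖φ x‖ * ‖g x‖ ≤ |c| * ‖φ x‖ * G := by gcongr
      have m2 : ‖u x‖ * |η x| * ‖φ x‖ * 1 ≤ ‖u x‖ * |η x| * ‖φ x‖ * G := by gcongr
      have m3 : ‖deriv φ x‖ * ‖g x‖ ≤ ‖deriv φ x‖ * G := by gcongr
      have m4 : 2 * |κ| * ‖u x‖ * ‖φ x‖ * ‖g x‖ ^ 2 ≤ 2 * |κ| * ‖u x‖ * ‖φ x‖ * G := by gcongr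
      have m5 : 2 * |κ| * ‖u x‖ ^ 2 * ‖deriv φ x‖ * ‖g x‖ ≤ 2 * |κ| * ‖u x‖ ^ 2 * ‖deriv φ x‖ * G := by
        gcongr
      have hG : 0 ≤ G := by linarith
      have p1 : 0 ≤ |c| * ‖deriv φ x‖ * G := by positivity
      have p2 : 0 ≤ ‖φ x‖ * G := by positivity
      have p3 : 0 ≤ 2 * |κ| * ‖u x‖ * ‖deriv φ x‖ * G := by positivity
      have p4 : 0 ≤ ‖u x‖ * |η x| * ‖deriv φ x‖ * G := by positivity
      have p5 : 0 ≤ 2 * |κ| * ‖u x‖ ^ 2 * ‖φ x‖ * G := by positivity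
      linarith
  have hW : Continuous (fun y => u y * logSlope c (η y) (q y)) := by
    refine huc.mul ?_
    unfold logSlope
    have := h.cont_flux
    refine Continuous.div (by fun_prop) (by fun_prop) fun x => ?_
    have hm := h.gap_pos x
    exact mul_ne_zero two_ne_zero (by exact_mod_cast hm.ne')
  have h0 := integral_deriv_eq_zero_off_countable
    (f := fun y => -inner ℝ (u y * logSlope c (η y) (q y)) (φ y)) h.countable
    (hW.inner hφ.continuous).neg ?_ (f' := _) (fun x hx => ?_) hint
  · exact h0
  · refine hc.mono fun x hx => ?_
    contrapose! hx
    simp only [Function.mem_support, not_not] at hx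
    simp [hx]
  · have h1 := ((h.hasDerivAt_fluxVector hx).inner ℝ
      ((hφ.differentiable (by simp) x).hasDerivAt)).neg
    refine h1.congr_deriv ?_
    have h2 := h.inner_wave x
    have h3 := h.fluxVector_eq hx
    rw [← hu] at h2 h3
    change inner ℝ (u x) (g x) = -d x / 2 at h2
    rw [← hu, h3, h.eta_wave, h2]
    have h4 : -(Complex.I * (c : ℂ) * (u x * logSlope c (η x) (d x)) + u x * (η x : ℂ)
        - (κ * d x : ℝ) * (u x * logSlope c (η x) (d x))) =
        (κ * d x) • g x - (Complex.I * (c : ℂ) * g x + u x * (η x : ℂ)) := by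
      rw [Complex.real_smul]; simp only [hg]; ring
    rw [h4]
    change -(inner ℝ (g x + (κ * d x) • u x) (deriv φ x) + _) = _
    simp only [inner_add_left, inner_sub_left, real_inner_smul_left]
    ring

end ScalarProfile

/-! ### Existence: extrema, singular set and nondifferentiability of the profile wave -/

namespace ProfileClock

variable {c κ η₀ : ℝ} {P : ℝ → ℝ}

theorem mem_pair_iff (ha : Admissible c κ η₀) (hP : ProfileClock c κ η₀ P) {x : ℝ} :
    x ∈ ({crossingPoint c κ η₀, -crossingPoint c κ η₀} : Set ℝ) ↔ |x| = crossingPoint c κ η₀ :=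
  (abs_eq (hP.crossingPoint_pos ha).le).symm

theorem scalarProfile (ha : Admissible c κ η₀) (hP : ProfileClock c κ η₀ P) :
    ScalarProfile c κ (1 - max (etaStar κ) 0) {crossingPoint c κ η₀, -crossingPoint c κ η₀}
      (fun y => profEta κ η₀ (P y))
      (fun y => profFlux c κ η₀ (P y) / diffusion κ (profEta κ η₀ (P y)))
      (fun y => profFlux c κ η₀ (P y)) where
  countable := (toFinite _).countable
  pos := sub_pos.2 (max_lt (etaStar_lt_one ha.pos) one_pos)
  cont := hP.continuous_eta ha
  cont_flux := hP.continuous_flux ha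
  gap x := by linarith [ha.profEta_le (P x)]
  hasDerivAt x hx := (hP.ode ha fun h => hx ((hP.mem_pair_iff ha).2 h)).1
  hasDerivAt_flux x hx := (hP.ode ha fun h => hx ((hP.mem_pair_iff ha).2 h)).2
  -- The slope is a quotient by the diffusion, so only its zeros need an argument. Off the two
  -- crossings these occur only outside for `κ = 1/2`, where the flux is zero too.
  flux x hx := by
    have h1 : |P x| ≠ crossing κ η₀ := fun h =>
      hx ((hP.mem_pair_iff ha).2 ((hP.abs_eq_iff x).1 h))
    by_cases hD : diffusion κ (profEta κ η₀ (P x)) = 0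
    · by_cases hκ : κ = 1 / 2
      · subst hκ
        rcases lt_or_gt_of_ne h1 with h2 | h2
        · exact absurd hD (ha.diffusion_inner_neg h2).ne
        · rw [ha.profFlux_half h2]; simp
      · exact absurd ((ha.diffusion_eq_zero_iff hκ _).1 hD) h1
    · field_simp
  measurable_slope := hP.measurable_slope ha
  sq_slope := hP.integrable_slope_sq ha
  sq := hP.integrable_eta_sq ha

/-- The wave associated with the profile. -/
noncomputable def _root_.QuasilinearGP.profileWave (c κ η₀ : ℝ) (P : ℝ → ℝ) : ℝ → ℂ :=
  waveOf c (fun y => profEta κ η₀ (P y))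

theorem eta_profileWave (ha : Admissible c κ η₀) (hP : ProfileClock c κ η₀ P) (x : ℝ) :
    eta (profileWave c κ η₀ P) x = profEta κ η₀ (P x) := (hP.scalarProfile ha).eta_wave x

theorem mem_singularSet_iff (ha : Admissible c κ η₀) (u : ℝ → ℂ) (x : ℝ) :
    x ∈ singularSet κ u ↔ diffusion κ (eta u x) = 0 := by
  have := ha.pos
  simp only [singularSet, mem_ofPred_eq, eta, diffusion]
  rw [eq_div_iff (by positivity)]
  constructor <;> intro h <;> linarith

theorem regularExtrema_profileWave (ha : Admissible c κ η₀) (hP : ProfileClock c κ η₀ P) :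
    regularExtrema κ (profileWave c κ η₀ P) = {0} := by
  have he : eta (profileWave c κ η₀ P) = fun y => profEta κ η₀ (P y) :=
    funext (hP.eta_profileWave ha)
  ext x
  simp only [regularExtrema, mem_ofPred_eq, mem_singleton_iff, mem_singularSet_iff ha, he]
  constructor
  · rintro ⟨h1, h2⟩
    by_contra hx
    have h3 : |x| ≠ crossingPoint c κ η₀ := fun h => by
      rw [ha.profEta_crossing ((hP.abs_eq_iff x).2 h), ha.diffusion_etaStar] at h1
      exact h1 rfl
    have h4 := h2.hasDerivAt_eq_zero (hP.ode ha h3).1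
    refine ha.slope_ne_zero (fun h => hx ?_) h1 h4
    exact hP.mono.injective (by rw [h, hP.zero])
  · rintro rfl
    have h0 : |(0 : ℝ)| < crossing κ η₀ := by rw [abs_zero]; exact ha.crossing_pos
    rw [hP.zero]
    refine ⟨(ha.diffusion_inner_neg h0).ne, Or.inl (Eventually.of_forall fun y => ?_)⟩
    simp only [hP.zero]
    rw [Admissible.profEta_inner h0.le]
    simpa using ha.le_profEta (P y)

theorem isCompositeWave (ha : Admissible c κ η₀) (hP : ProfileClock c κ η₀ P) :
    IsCompositeWave c κ η₀ (profileWave c κ η₀ P) where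
  inX := (hP.scalarProfile ha).inX_wave
  sol := (hP.scalarProfile ha).isWeakSolution_wave
  extrema := hP.regularExtrema_profileWave ha
  value := by
    rw [hP.eta_profileWave ha, hP.zero, Admissible.profEta_inner (by simpa using ha.crossing_pos.le)]
    simp

theorem nondiffSet_profileWave (ha : Admissible c κ η₀) (hP : ProfileClock c κ η₀ P) :
    nondiffSet (profileWave c κ η₀ P) = {crossingPoint c κ η₀, -crossingPoint c κ η₀} := by
  ext x
  constructor
  · intro hx
    by_contra h
    exact hx ((hP.scalarProfile ha).hasDerivAt_wave h).differentiableAt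
  -- Differentiability of the wave would pass to its squared modulus, hence to `η`.
  · intro hx hd
    refine hP.not_differentiableAt_eta ha ((hP.mem_pair_iff ha).1 hx) ?_
    have he : (fun y => profEta κ η₀ (P y)) = fun y => 1 - ‖profileWave c κ η₀ P y‖ ^ 2 :=
      funext fun y => (hP.eta_profileWave ha y).symm
    rw [he]
    exact (hd.norm_sq ℝ).const_sub 1

theorem ncard_nondiffSet_profileWave (ha : Admissible c κ η₀) (hP : ProfileClock c κ η₀ P) :
    (nondiffSet (profileWave c κ η₀ P)).ncard = 2 := by
  rw [hP.nondiffSet_profileWave ha]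
  exact ncard_pair (by linarith [hP.crossingPoint_pos ha])

theorem singularSet_profileWave (ha : Admissible c κ η₀) (hP : ProfileClock c κ η₀ P)
    (hκ : κ ≠ 1 / 2) :
    singularSet κ (profileWave c κ η₀ P) = nondiffSet (profileWave c κ η₀ P) := by
  ext x
  rw [hP.nondiffSet_profileWave ha, mem_singularSet_iff ha, hP.eta_profileWave ha,
    ha.diffusion_eq_zero_iff hκ, hP.abs_eq_iff, hP.mem_pair_iff ha]

theorem hasCompactSupport_eta (ha : Admissible c κ η₀) (hP : ProfileClock c κ η₀ P)
    (hκ : κ = 1 / 2) : HasCompactSupport (eta (profileWave c κ η₀ P)) := by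
  subst hκ
  refine HasCompactSupport.intro (isCompact_Icc (a := -crossingPoint c (1 / 2) η₀)
    (b := crossingPoint c (1 / 2) η₀)) fun x hx => ?_
  rw [hP.eta_profileWave ha]
  refine ha.profEta_half ((hP.lt_abs_iff x).2 ?_).le
  by_contra h
  exact hx (abs_le.1 (not_lt.1 h))

end ProfileClock

/-! ### Parameter ranges and one-variable tools for uniqueness -/

theorem half_of_mem_Ccrit {c κ : ℝ} (h : (c, κ) ∈ Ccrit) : κ = 1 / 2 := h.2

theorem ne_half_of_mem_Dtilde {c κ : ℝ} (h : (c, κ) ∈ Dtilde) : κ ≠ 1 / 2 := by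
  rcases h with ((h | h) | h) | h
  · exact h.2.2.2.ne
  · exact h.2.ne'
  · exact h.2.2.ne
  · exact h.2.ne'

theorem admissible_of_mem {c κ η₀ : ℝ} (h : (c, κ) ∈ Dtilde ∪ Ccrit)
    (hη : η₀ < min (etaStar κ) 0 - c ^ 2 - 2) : Admissible c κ η₀ := by
  have h2 : √2 ^ 2 = (2 : ℝ) := Real.sq_sqrt (by norm_num)
  have h2' : 0 ≤ √(2 : ℝ) := Real.sqrt_nonneg 2
  rcases h with (((h | h) | h) | h) | h
  · obtain ⟨a, b, d, e⟩ := h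
    simp only at a b d e
    exact ⟨d, fun _ => by nlinarith, fun h => by linarith, hη⟩
  · obtain ⟨a, b⟩ := h
    simp only at a b
    exact ⟨by linarith, fun h => by linarith, fun _ => by nlinarith, hη⟩
  · obtain ⟨a, b, d⟩ := h
    simp only at a b d
    exact ⟨b, fun _ => by rw [a, h2], fun h => by linarith, hη⟩
  · obtain ⟨a, b⟩ := h
    simp only at a b
    exact ⟨by linarith, fun h => by linarith, fun _ => by rw [a, h2], hη⟩
  · obtain ⟨a, b⟩ := h
    simp only at a b
    exact ⟨by linarith, fun h => by linarith, fun h => by linarith, hη⟩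

theorem nonneg_of_hasDerivAt_of_monotoneOn {f : ℝ → ℝ} {d a b x : ℝ} (hd : HasDerivAt f d x)
    (hx : x ∈ Ioo a b) (hf : MonotoneOn f (Ioo a b)) : 0 ≤ d := by
  have h1 := hf.derivWithin_nonneg (x := x)
  rwa [hd.hasDerivWithinAt.derivWithin (isOpen_Ioo.uniqueDiffWithinAt hx)] at h1

theorem eq_on_Icc_of_hasDerivAt_zero {f : ℝ → ℝ} {a b : ℝ} (hab : a ≤ b)
    (hf : ContinuousOn f (Icc a b)) (hd : ∀ x ∈ Ioo a b, HasDerivAt f 0 x) : f b = f a := by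
  have := integral_eq_of_hasDerivAt_off_countable_of_le f (fun _ => 0) hab countable_empty hf
    (fun x hx => hd x hx.1) (by simp)
  simp only [intervalIntegral.integral_zero] at this
  exact (sub_eq_zero.1 this.symm)

/-- If `f a = v` and `f` has no local extremum with value different from `v` inside `(a, b)`, then
the distance to `v` is maximal at `b`. -/
theorem abs_sub_le_of_no_extr {f : ℝ → ℝ} {a b v : ℝ} (hf : Continuous f) (ha : f a = v)
    (hn : ∀ z ∈ Ioo a b, f z ≠ v → ¬ IsLocalExtr f z) {x : ℝ} (hx : x ∈ Icc a b) :
    |f x - v| ≤ |f b - v| := by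
  -- An interior maximum of `|f - v|` with `f ≠ v` is a local extremum of `f`, which is excluded.
  obtain ⟨z, hz, hmax⟩ := isCompact_Icc.exists_isMaxOn ⟨x, hx⟩
    (f := fun y => |f y - v|) (by fun_prop)
  have hmx : |f x - v| ≤ |f z - v| := hmax hx
  by_cases hzv : f z = v
  · rw [hzv, sub_self, abs_zero] at hmx
    exact hmx.trans (abs_nonneg _)
  rcases hz.2.eq_or_lt with h | h
  · rwa [h] at hmx
  have hza : a < z := lt_of_le_of_ne hz.1 fun h' => hzv (h' ▸ ha)
  exfalso
  refine hn z ⟨hza, h⟩ hzv ?_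
  have hev : ∀ᶠ y in 𝓝 z, |f y - v| ≤ |f z - v| := hmax.isLocalMax (Icc_mem_nhds hza h)
  rcases lt_or_gt_of_ne hzv with h1 | h1
  · left
    filter_upwards [hev] with y hy
    rw [abs_of_neg (by linarith : f z - v < 0)] at hy
    linarith [neg_abs_le (f y - v)]
  · right
    filter_upwards [hev] with y hy
    rw [abs_of_pos (by linarith : 0 < f z - v)] at hy
    linarith [le_abs_self (f y - v)]

/-- A square integrable function is not bounded away from zero on a half-line. -/
theorem not_sq_ge_on_Ioi {f : ℝ → ℝ} {a k : ℝ} (hf : Integrable (fun x => f x ^ 2)) (hk : 0 < k)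
    (h : ∀ x, a < x → k ≤ f x ^ 2) : False :=
  absurd (nonpos_of_le_integrable (a := a) hf hf (Eventually.of_forall fun x hx _ => h x hx))
    (not_le.2 hk)

/-! ### Uniqueness of the intensity profile -/

/-- The scalar system satisfied by the intensity profile of any solution. -/
structure ScalarWave (c κ : ℝ) (η q G : ℝ → ℝ) : Prop where
  cont : Continuous η
  cont_flux : Continuous q
  ode : ∀ x, diffusion κ (η x) ≠ 0 → HasDerivAt η (q x / diffusion κ (η x)) x
  ode_flux : ∀ x, diffusion κ (η x) ≠ 0 → η x < 1 →
    HasDerivAt q (fluxDeriv c κ (η x) (q x / diffusion κ (η x))) x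
  sq : Integrable (fun x => η x ^ 2)
  int : Integrable G
  bound : ∀ᵐ x, diffusion κ (η x) ≠ 0 → (q x / diffusion κ (η x)) ^ 2 ≤ 4 * (1 - η x) * G x
  plateau : ∀ a b : ℝ, a < b → (∀ x ∈ Ioo a b, diffusion κ (η x) = 0) → ∀ x ∈ Ioo a b,
    c ^ 2 * η x ^ 2 + 2 * c ^ 2 * η x * (1 - η x) - 4 * (1 - η x) ^ 2 * η x = 0

namespace ScalarWave

variable {c κ η₀ : ℝ} {η q G : ℝ → ℝ} {P : ℝ → ℝ}

/-- The scalar system is reversible, with odd flux; this reduces uniqueness to the right half-line.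
-/
theorem reflect (h : ScalarWave c κ η q G) :
    ScalarWave c κ (fun x => η (-x)) (fun x => -q (-x)) (fun x => G (-x)) where
  cont := h.cont.comp continuous_neg
  cont_flux := (h.cont_flux.comp continuous_neg).neg
  ode x hx := by
    have := (h.ode (-x) hx).comp x (hasDerivAt_neg x)
    exact this.congr_deriv (by ring)
  ode_flux x hx h1 := by
    have := ((h.ode_flux (-x) hx h1).comp x (hasDerivAt_neg x)).neg
    refine this.congr_deriv ?_
    simp [fluxDeriv, neg_div]
  sq := h.sq.comp_neg
  int := h.int.comp_neg
  bound := by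
    have := (Measure.measurePreserving_neg (volume : Measure ℝ)).quasiMeasurePreserving.ae h.bound
    filter_upwards [this] with x hx hD
    rw [neg_div, neg_sq]
    exact hx hD
  plateau a b hab hz x hx := by
    refine h.plateau (-b) (-a) (by linarith) (fun y hy => ?_) (-x) ⟨by linarith [hx.2], by linarith [hx.1]⟩
    have := hz (-y) ⟨by linarith [hy.2], by linarith [hy.1]⟩
    simpa using this

/-- The first integral of the scalar system. -/
noncomputable def energy (c κ η q : ℝ) : ℝ :=
  (q ^ 2 / diffusion κ η - η ^ 2 * outerFactor c η) / (1 - η)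

theorem hasDerivAt_energy (h : ScalarWave c κ η q G) {x : ℝ} (hD : diffusion κ (η x) ≠ 0)
    (h1 : η x < 1) : HasDerivAt (fun y => energy c κ (η y) (q y)) 0 x := by
  have d1 := h.ode x hD
  have d2 := h.ode_flux x hD h1
  have hm : 1 - η x ≠ 0 := by linarith
  have dD : HasDerivAt (fun y => diffusion κ (η y)) (2 * κ * (q x / diffusion κ (η x))) x := by
    unfold diffusion at d1 ⊢; exact (d1.const_mul _).const_add _
  have dB : HasDerivAt (fun y => outerFactor c (η y)) (-(2 * (q x / diffusion κ (η x)))) x := by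
    unfold outerFactor; exact (d1.const_mul 2).const_sub _
  have := (((d2.fun_pow 2).fun_div dD hD).fun_sub ((d1.fun_pow 2).fun_mul dB)).fun_div (d1.const_sub 1) hm
  refine this.congr_deriv ?_
  unfold fluxDeriv outerFactor
  generalize hDD : diffusion κ (η x) = D at *
  field_simp
  rw [← hDD, diffusion]
  ring

theorem energy_const (h : ScalarWave c κ η q G) {s : Set ℝ} (hs : IsOpen s) (hc : IsPreconnected s)
    (hD : ∀ x ∈ s, diffusion κ (η x) ≠ 0) (h1 : ∀ x ∈ s, η x < 1) {x y : ℝ} (hx : x ∈ s)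
    (hy : y ∈ s) : energy c κ (η x) (q x) = energy c κ (η y) (q y) :=
  hs.is_const_of_deriv_eq_zero (f := fun y => energy c κ (η y) (q y)) hc
    (fun z hz => (h.hasDerivAt_energy (hD z hz) (h1 z hz)).differentiableAt.differentiableWithinAt)
    (fun z hz => (h.hasDerivAt_energy (hD z hz) (h1 z hz)).deriv) hx hy

/-- The first integral vanishes on unbounded intervals. -/
theorem energy_eq_zero (h : ScalarWave c κ η q G) {a : ℝ}
    (hD : ∀ x ∈ Ioi a, diffusion κ (η x) ≠ 0) (h1 : ∀ x ∈ Ioi a, η x < 1) {x : ℝ} (hx : x ∈ Ioi a) :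
    energy c κ (η x) (q x) = 0 := by
  set K := energy c κ (η x) (q x) with hK
  set B := 1 + 4 * |κ| with hB
  have hi : Integrable (fun y => 2 * (6 * B * |G y| + (3 + c ^ 2) * η y ^ 2)) :=
    ((h.int.abs.const_mul (6 * B)).add (h.sq.const_mul (3 + c ^ 2))).const_mul 2
  -- Using `2η` makes the smallness condition read `|η| ≤ 1/2`, which bounds the diffusion and keeps
  -- `1 - η ≥ 1/2`.
  have hs : Integrable (fun y => (2 * η y) ^ 2) := by
    have : (fun y => (2 * η y) ^ 2) = fun y => 4 * η y ^ 2 := by ext; ring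
    rw [this]; exact h.sq.const_mul 4
  have := nonpos_of_le_integrable (a := a) (k := |K|) hs hi ?_
  · exact abs_eq_zero.1 (le_antisymm this (abs_nonneg _))
  filter_upwards [h.bound] with y hy hya hy1
  have hyD := hD y hya
  have hb := hy hyD
  have hKy : energy c κ (η y) (q y) = K := h.energy_const isOpen_Ioi isPreconnected_Ioi hD h1 hya hx
  have hm : 0 < 1 - η y := by linarith [h1 y hya]
  have hη : |η y| ≤ 1 / 2 := by rw [abs_mul, abs_two] at hy1; linarith
  have hη' := abs_le.1 hη
  have e1 : K * (1 - η y) = (q y / diffusion κ (η y)) ^ 2 * diffusion κ (η y)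
      - η y ^ 2 * outerFactor c (η y) := by
    rw [← hKy, energy]; field_simp
  have hDb : |diffusion κ (η y)| ≤ B := by
    have : diffusion κ (η y) = 1 - 2 * κ * (1 - η y) := by unfold diffusion; ring
    rw [this]
    refine (abs_sub _ _).trans ?_
    rw [abs_one, abs_mul, abs_mul, abs_two, abs_of_pos hm]
    have := abs_nonneg κ
    nlinarith
  have hOb : |outerFactor c (η y)| ≤ 3 + c ^ 2 := by
    unfold outerFactor
    rw [abs_le]
    constructor <;> nlinarith [sq_nonneg c]
  have hd : (q y / diffusion κ (η y)) ^ 2 ≤ 6 * |G y| := by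
    have := le_abs_self (G y)
    have := abs_nonneg (G y)
    nlinarith
  have e2 : |K| * (1 - η y) ≤ 6 * B * |G y| + (3 + c ^ 2) * η y ^ 2 := by
    rw [← abs_of_pos hm, ← abs_mul, e1]
    refine (abs_sub _ _).trans ?_
    rw [abs_mul, abs_mul, abs_of_nonneg (sq_nonneg (q y / diffusion κ (η y))),
      abs_of_nonneg (sq_nonneg (η y))]
    have t1 : (q y / diffusion κ (η y)) ^ 2 * |diffusion κ (η y)| ≤ 6 * |G y| * B := by gcongr
    have t2 : η y ^ 2 * |outerFactor c (η y)| ≤ η y ^ 2 * (3 + c ^ 2) := by gcongr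
    linarith
  nlinarith [abs_nonneg K]

theorem diffusion_ne_zero_iff (ha : Admissible c κ η₀) (h : ℝ) :
    diffusion κ h ≠ 0 ↔ h ≠ etaStar κ := by
  have := ha.pos
  rw [diffusion_eq ha.pos, mul_ne_zero_iff, sub_ne_zero]
  simp [this.ne']

theorem diffusion_neg_of_lt (ha : Admissible c κ η₀) {h : ℝ} (hh : h < etaStar κ) :
    diffusion κ h < 0 := by
  rw [diffusion_eq ha.pos]
  exact mul_neg_of_pos_of_neg (by linarith [ha.pos]) (by linarith)

/-- The hypotheses on the extrema of the profile. -/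
structure SingleExtremum (κ η₀ : ℝ) (η : ℝ → ℝ) : Prop where
  value : η 0 = η₀
  extr : IsLocalExtr η 0
  unique : ∀ x, η x ≠ etaStar κ → IsLocalExtr η x → x = 0

theorem SingleExtremum.reflect (hs : SingleExtremum κ η₀ η) :
    SingleExtremum κ η₀ (fun x => η (-x)) where
  value := by simpa using hs.value
  extr := by
    have hc : Tendsto (fun x : ℝ => -x) (𝓝 0) (𝓝 0) := by simpa using (continuous_neg (G := ℝ)).tendsto 0
    rcases hs.extr with h | h
    · left
      have := hc.eventually h
      simpa [IsLocalMin, IsMinFilter] using this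
    · right
      have := hc.eventually h
      simpa [IsLocalMax, IsMaxFilter] using this
  unique x hx h := by
    have hc : Tendsto (fun y : ℝ => -y) (𝓝 (-x)) (𝓝 x) := by simpa using (continuous_neg (G := ℝ)).tendsto (-x)
    have : -x = 0 := by
      refine hs.unique (-x) hx ?_
      rcases h with h | h
      · left
        have := hc.eventually h
        simpa [IsLocalMin, IsMinFilter] using this
      · right
        have := hc.eventually h
        simpa [IsLocalMax, IsMaxFilter] using this
    linarith

theorem flux_zero (ha : Admissible c κ η₀) (h : ScalarWave c κ η q G) (hs : SingleExtremum κ η₀ η) :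
    q 0 = 0 := by
  have hD : diffusion κ (η 0) ≠ 0 := by
    rw [hs.value]; exact (diffusion_neg_of_lt ha ha.lt_etaStar).ne
  have h1 := hs.extr.hasDerivAt_eq_zero (h.ode 0 hD)
  simpa [hD] using h1

/-- Otherwise `η` stays below `η*` on a half-line containing the origin, so the first integral
vanishes there. At the origin, where the flux is zero, it equals `-η₀²(2-c²-2η₀)/(1-η₀) < 0`. -/
theorem exists_hit (ha : Admissible c κ η₀) (h : ScalarWave c κ η q G) (hs : SingleExtremum κ η₀ η) :
    ∃ x, 0 < x ∧ η x = etaStar κ := by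
  by_contra hcon
  push Not at hcon
  have hlt0 : η 0 < etaStar κ := by rw [hs.value]; exact ha.lt_etaStar
  -- Room to the left of the origin is needed because the first integral is evaluated at `0` inside
  -- an open half-line.
  obtain ⟨ε, hε, hball⟩ := Metric.eventually_nhds_iff.1 (h.cont.continuousAt.eventually_lt_const hlt0)
  have hlt : ∀ x ∈ Ioi (-ε), η x < etaStar κ := by
    intro x hx
    by_cases hx0 : x ≤ 0
    · exact hball (by rw [Real.dist_eq, sub_zero, abs_of_nonpos hx0]; linarith [mem_Ioi.1 hx])
    · push Not at hx0
      by_contra hge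
      push Not at hge
      obtain ⟨z, hz, hz'⟩ := intermediate_value_Icc hx0.le h.cont.continuousOn ⟨hlt0.le, hge⟩
      have : z ≠ 0 := fun h0 => by rw [h0] at hz'; linarith
      exact hcon z (lt_of_le_of_ne hz.1 this.symm) hz'
  have h0 := h.energy_eq_zero (a := -ε) (fun x hx => (diffusion_neg_of_lt ha (hlt x hx)).ne)
    (fun x hx => (hlt x hx).trans (etaStar_lt_one ha.pos)) (x := 0) (by simpa using hε)
  have h1 := ha.lt_zero
  have hm : 1 - η₀ ≠ 0 := by nlinarith [sq_nonneg c]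
  rw [energy, h.flux_zero ha hs, hs.value, div_eq_zero_iff, or_iff_left hm] at h0
  have h2 : 0 < outerFactor c η₀ := by unfold outerFactor; nlinarith [sq_nonneg c]
  have h3 : 0 < η₀ ^ 2 := by nlinarith [sq_nonneg c]
  have := mul_pos h3 h2
  simp at h0
  rcases h0 with h0 | h0 <;> nlinarith

/-- The inner part of the profile: `η` follows the desingularized profile up to its first crossing
of the singular value. -/
theorem eq_profile_inner (ha : Admissible c κ η₀) (hP : ProfileClock c κ η₀ P)
    (h : ScalarWave c κ η q G) (hs : SingleExtremum κ η₀ η) :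
    ∀ x ∈ Icc 0 (crossingPoint c κ η₀), η x = profEta κ η₀ (P x) := by
  have hlt0 : η 0 < etaStar κ := by rw [hs.value]; exact ha.lt_etaStar
  have hclosed : IsClosed {x | 0 ≤ x ∧ η x = etaStar κ} :=
    (isClosed_le continuous_const continuous_id).inter (isClosed_eq h.cont continuous_const)
  obtain ⟨x₀, hx0, hx0'⟩ := h.exists_hit ha hs
  have hbdd : BddBelow {x | 0 ≤ x ∧ η x = etaStar κ} := ⟨0, fun x hx => hx.1⟩
  obtain ⟨hb0, hb1⟩ := hclosed.csInf_mem ⟨x₀, hx0.le, hx0'⟩ hbdd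
  set b := sInf {x | 0 ≤ x ∧ η x = etaStar κ}
  have hbpos : 0 < b := lt_of_le_of_ne hb0 fun h0 => by rw [← h0] at hb1; linarith
  have hlt : ∀ x ∈ Ico 0 b, η x < etaStar κ := by
    intro x hx
    by_contra hge
    push Not at hge
    obtain ⟨z, hz, hz'⟩ := intermediate_value_Icc hx.1 h.cont.continuousOn ⟨hlt0.le, hge⟩
    exact absurd (csInf_le hbdd ⟨hz.1, hz'⟩) (not_le.2 (hz.2.trans_lt hx.2))
  obtain ⟨ε, hε, hball⟩ := Metric.eventually_nhds_iff.1 (h.cont.continuousAt.eventually_lt_const hlt0)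
  have hlt' : ∀ x ∈ Ioo (-ε) b, η x < etaStar κ := by
    intro x hx
    by_cases hx0 : x ≤ 0
    · exact hball (by rw [Real.dist_eq, sub_zero, abs_of_nonpos hx0]; linarith [hx.1])
    · exact hlt x ⟨(not_le.1 hx0).le, hx.2⟩
  have hz0 := ha.lt_zero
  have hm0 : 0 < 1 - η₀ := by nlinarith [sq_nonneg c]
  -- Equating the first integral at `x` and at `0` and factoring out `η - η₀`.
  have hfirst : ∀ x ∈ Ico 0 b, (η x - η₀) * innerFactor c η₀ (η x) =
      -diffusion κ (η x) * (q x / diffusion κ (η x)) ^ 2 := by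
    intro x hx
    have hD := (diffusion_neg_of_lt ha (hlt x hx)).ne
    have hm : 0 < 1 - η x := by linarith [hlt x hx, etaStar_lt_one ha.pos]
    have hE := h.energy_const isOpen_Ioo isPreconnected_Ioo
      (fun y hy => (diffusion_neg_of_lt ha (hlt' y hy)).ne)
      (fun y hy => (hlt' y hy).trans (etaStar_lt_one ha.pos)) (x := x) (y := 0)
      ⟨by linarith [hx.1], hx.2⟩ ⟨by linarith, hbpos⟩
    rw [energy, energy, h.flux_zero ha hs, hs.value] at hE
    unfold innerFactor
    unfold outerFactor at hE
    generalize diffusion κ (η x) = D at *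
    have hq : q x ^ 2 / D = η x ^ 2 * (2 - c ^ 2 - 2 * η x)
        - η₀ ^ 2 * (2 - c ^ 2 - 2 * η₀) * (1 - η x) / (1 - η₀) := by
      have h2 : q x ^ 2 / D - η x ^ 2 * (2 - c ^ 2 - 2 * η x)
        = ((0 ^ 2 / diffusion κ η₀ - η₀ ^ 2 * (2 - c ^ 2 - 2 * η₀)) / (1 - η₀)) * (1 - η x) := by
        rw [← hE]; field_simp
      rw [sub_eq_iff_eq_add.1 h2]; field_simp; ring
    have hr : -D * (q x / D) ^ 2 = -(q x ^ 2 / D) := by field_simp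
    rw [hr, hq]
    field_simp
    ring
  have hIF : ∀ x ∈ Ico 0 b, 0 < innerFactor c η₀ (η x) := fun x hx =>
    ha.innerFactor_pos ((hlt x hx).trans (etaStar_lt_one ha.pos))
  have hge : ∀ x ∈ Ico 0 b, η₀ ≤ η x := by
    intro x hx
    have h1 := hfirst x hx
    have h2 : 0 ≤ (η x - η₀) * innerFactor c η₀ (η x) := by
      rw [h1]
      exact mul_nonneg (by linarith [diffusion_neg_of_lt ha (hlt x hx)]) (sq_nonneg _)
    linarith [nonneg_of_mul_nonneg_left h2 (hIF x hx)]
  -- By Rolle, two equal values would enclose a regular extremum other than `0`. Injectivity with `η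
  -- 0 < η b` then gives monotonicity.
  have hinj : InjOn η (Icc 0 b) := by
    have key : ∀ x ∈ Icc 0 b, ∀ y ∈ Icc 0 b, x < y → η x ≠ η y := by
      intro x hx y hy hxy he
      obtain ⟨z, hz, hz'⟩ := exists_isLocalExtr_Ioo hxy h.cont.continuousOn he
      have hz0 : 0 < z := hx.1.trans_lt hz.1
      exact hz0.ne' (hs.unique z (hlt z ⟨hz0.le, hz.2.trans_le hy.2⟩).ne hz')
    intro x hx y hy he
    rcases lt_trichotomy x y with hxy | hxy | hxy
    · exact absurd he (key x hx y hy hxy)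
    · exact hxy
    · exact absurd he.symm (key y hy x hx hxy)
  have hmono : StrictMonoOn η (Icc 0 b) := by
    rcases h.cont.continuousOn.strictMonoOn_of_injOn_Icc' hb0 hinj with hm | hm
    · exact hm
    · have := hm (left_mem_Icc.2 hb0) (right_mem_Icc.2 hb0) hbpos
      linarith
  have hgt : ∀ x ∈ Ioc 0 b, η₀ < η x := fun x hx => by
    rw [← hs.value]; exact hmono (left_mem_Icc.2 hb0) ⟨hx.1.le, hx.2⟩ hx.1
  have hle : ∀ x ∈ Icc 0 b, η₀ ≤ η x ∧ η x ≤ etaStar κ := fun x hx => by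
    refine ⟨?_, ?_⟩
    · rw [← hs.value]; exact hmono.monotoneOn (left_mem_Icc.2 hb0) hx hx.1
    · rw [← hb1]; exact hmono.monotoneOn hx (right_mem_Icc.2 hb0) hx.2
  have hparam : ∀ x ∈ Icc 0 b, √(η x - η₀) ≤ crossing κ η₀ := fun x hx =>
    Real.sqrt_le_sqrt (by linarith [(hle x hx).2])
  -- `√(η - η₀)` is the inner parameter, and the first integral with nonnegative slope says that its
  -- clock advances at unit speed. Only the open interval is differentiated, so the degenerate
  -- endpoints are harmless.
  have hclock : ∀ x ∈ Icc 0 b, clock (profRate c κ η₀) (√(η x - η₀)) = x := by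
    intro x hx
    have hcl : Continuous (clock (profRate c κ η₀)) :=
      continuous_iff_continuousAt.2 fun p => (hasDerivAt_clock ha.profRate_continuous p).continuousAt
    have hc : Continuous (fun y => clock (profRate c κ η₀) (√(η y - η₀)) - y) :=
      (hcl.comp (Real.continuous_sqrt.comp (h.cont.sub continuous_const))).sub continuous_id
    have := eq_on_Icc_of_hasDerivAt_zero hx.1 hc.continuousOn fun y hy => by
      have hyb : y < b := hy.2.trans_le hx.2
      have hy0 : y ∈ Ico 0 b := ⟨hy.1.le, hyb⟩
      have hD := diffusion_neg_of_lt ha (hlt y hy0)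
      have hpos : 0 < η y - η₀ := by linarith [hgt y ⟨hy.1, hyb.le⟩]
      have hd := h.ode y hD.ne
      have hnn : 0 ≤ q y / diffusion κ (η y) :=
        nonneg_of_hasDerivAt_of_monotoneOn hd ⟨hy.1, hyb⟩ (hmono.monotoneOn.mono Ioo_subset_Icc_self)
      have h1 := (hasDerivAt_clock ha.profRate_continuous (√(η y - η₀))).comp y
        ((hd.sub_const η₀).sqrt hpos.ne')
      refine (h1.sub (hasDerivAt_id y)).congr_deriv ?_
      have hsq := Real.sq_sqrt hpos.le
      have hsp := Real.sqrt_pos.2 hpos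
      have hpc : |√(η y - η₀)| ≤ crossing κ η₀ := by
        rw [abs_of_pos hsp]; exact hparam y ⟨hy.1.le, hyb.le⟩
      have h2 := hfirst y hy0
      have h3 := hIF y hy0
      have hηp : η₀ + √(η y - η₀) ^ 2 = η y := by rw [hsq]; ring
      rw [sub_eq_zero, profRate, if_pos hpc, hηp]
      have hND : 0 < -diffusion κ (η y) := by linarith
      have hfr : 0 < -diffusion κ (η y) / innerFactor c η₀ (η y) := div_pos hND h3
      have hr := Real.sq_sqrt hfr.le
      have hrp := Real.sqrt_pos.2 hfr
      set r := √(-diffusion κ (η y) / innerFactor c η₀ (η y))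
      set s := √(η y - η₀)
      set d := q y / diffusion κ (η y)
      have h4 : (r * d) ^ 2 = s ^ 2 := by
        rw [mul_pow, hr, hsq, div_mul_eq_mul_div, div_eq_iff h3.ne', ← h2]
      have h5 : r * d = s := by
        rwa [sq_eq_sq₀ (mul_nonneg hrp.le hnn) hsp.le] at h4
      rw [← h5]
      have : r * d ≠ 0 := by rw [h5]; exact hsp.ne'
      have := left_ne_zero_of_mul this
      have : d ≠ 0 := right_ne_zero_of_mul ‹r * d ≠ 0›
      field_simp
    simp only [hs.value, sub_self, Real.sqrt_zero, clock_zero] at this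
    linarith
  have hPx : ∀ x ∈ Icc 0 b, P x = √(η x - η₀) := fun x hx => by
    have := hP.apply_clock (√(η x - η₀))
    rwa [hclock x hx] at this
  have hbR : b = crossingPoint c κ η₀ := by
    rw [← hclock b (right_mem_Icc.2 hb0), hb1]; rfl
  rw [← hbR]
  intro x hx
  rw [hPx x hx, Admissible.profEta_inner, Real.sq_sqrt (by linarith [(hle x hx).1])]
  · ring
  · rw [abs_of_nonneg (Real.sqrt_nonneg _)]; exact hparam x hx

end ScalarWave

namespace ScalarWave

variable {c κ η₀ : ℝ} {η q G : ℝ → ℝ} {P : ℝ → ℝ}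

/-- For `η* ≠ 0` the relation reduces to `c²(4κ² + 2κ) = 4`. The left side is less than `4` if `κ <
1/2` and `c² ≤ 2`, and greater if `κ > 1/2` and `c² ≥ 2`. -/
theorem plateau_ne_zero (ha : Admissible c κ η₀) (hκ : κ ≠ 1 / 2) :
    c ^ 2 * etaStar κ ^ 2 + 2 * c ^ 2 * etaStar κ * (1 - etaStar κ)
      - 4 * (1 - etaStar κ) ^ 2 * etaStar κ ≠ 0 := by
  have he := ha.etaStar_ne_zero hκ
  have hk := ha.pos
  have h1 := etaStar_eq ha.pos
  intro h
  have h2 : etaStar κ * (c ^ 2 * (2 - etaStar κ) - 4 * (1 - etaStar κ) ^ 2) = 0 := by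
    linear_combination h
  have h3 := (mul_eq_zero.1 h2).resolve_left he
  have h5 : etaStar κ = 1 - 1 / (2 * κ) := rfl
  have h4 : c ^ 2 * (4 * κ ^ 2 + 2 * κ) = 4 := by
    rw [h5] at h3
    field_simp at h3
    nlinarith
  rcases lt_or_gt_of_ne hκ with h6 | h6
  · have := ha.sub h6
    nlinarith [sq_nonneg c]
  · have := ha.super h6
    nlinarith [sq_nonneg c]

theorem abs_sub_mono (hc : Continuous η) (hs : SingleExtremum κ η₀ η) {R x y : ℝ} (hR : 0 ≤ R)
    (hη : η R = etaStar κ) (hx : R ≤ x) (hxy : x ≤ y) :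
    |η x - etaStar κ| ≤ |η y - etaStar κ| :=
  abs_sub_le_of_no_extr hc hη
    (fun z hz hne hext => (hR.trans_lt hz.1).ne' (hs.unique z hne hext)) ⟨hx, hxy⟩

/-- In the critical case the profile vanishes after reaching the singular value. -/
theorem eq_zero_outer (h : ScalarWave c (1 / 2) η q G) (hs : SingleExtremum (1 / 2) η₀ η) {R : ℝ}
    (hR : 0 ≤ R) (hη : η R = etaStar (1 / 2)) {x : ℝ} (hx : R ≤ x) : η x = 0 := by
  have h0 : etaStar (1 / 2) = 0 := by norm_num [etaStar]
  by_contra hne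
  refine not_sq_ge_on_Ioi (a := x) (k := η x ^ 2) h.sq (by positivity) fun y hy => ?_
  have := abs_sub_mono h.cont hs hR hη hx (le_of_lt hy)
  rw [h0, sub_zero, sub_zero] at this
  exact sq_le_sq.2 this

/-- Since `|η - η*|` cannot decrease after `R`, a return to `η*` would create a plateau at `η*`,
which is algebraically impossible. -/
theorem outer_ne (ha : Admissible c κ η₀) (hκ : κ ≠ 1 / 2) (h : ScalarWave c κ η q G)
    (hs : SingleExtremum κ η₀ η) {R : ℝ} (hR : 0 ≤ R) (hη : η R = etaStar κ) {x : ℝ} (hx : R < x) :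
    η x ≠ etaStar κ := by
  intro hxe
  have hpl : ∀ z ∈ Ioo R x, η z = etaStar κ := fun z hz => by
    have := abs_sub_mono h.cont hs hR hη hz.1.le hz.2.le
    rw [hxe, sub_self, abs_zero] at this
    exact sub_eq_zero.1 (abs_eq_zero.1 (le_antisymm this (abs_nonneg _)))
  have hmid : (R + x) / 2 ∈ Ioo R x := ⟨by linarith, by linarith⟩
  have := h.plateau R x hx (fun z hz => by rw [hpl z hz, ha.diffusion_etaStar]) _ hmid
  rw [hpl _ hmid] at this
  exact plateau_ne_zero ha hκ this

/-- The sign of the slope of the profile on the outer region. -/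
noncomputable def outerSign (κ : ℝ) : ℝ := if κ < 1 / 2 then 1 else -1

theorem outerSign_sq : outerSign κ ^ 2 = 1 := by unfold outerSign; split_ifs <;> norm_num

theorem outerSign_mul_etaStar_neg (ha : Admissible c κ η₀) (hκ : κ ≠ 1 / 2) :
    outerSign κ * etaStar κ < 0 := by
  have h2 := etaStar_eq ha.pos
  have h3 := ha.pos
  unfold outerSign
  split_ifs with h
  · by_contra h5; push Not at h5; nlinarith [mul_nonneg h3.le h5]
  · have : 1 / 2 < κ := lt_of_le_of_ne (not_lt.1 h) (Ne.symm hκ)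
    by_contra h5; push Not at h5; nlinarith [mul_nonneg h3.le h5]

/-- On the outer region the profile moves monotonically from the singular value towards zero. -/
theorem outer_monotone (ha : Admissible c κ η₀) (hκ : κ ≠ 1 / 2) (h : ScalarWave c κ η q G)
    (hs : SingleExtremum κ η₀ η) {R : ℝ} (hR : 0 ≤ R) (hη : η R = etaStar κ) :
    MonotoneOn (fun x => outerSign κ * η x) (Ici R) ∧
      ∀ x ∈ Ioi R, outerSign κ * etaStar κ < outerSign κ * η x ∧ outerSign κ * η x < 0 := by
  have hσ := outerSign_sq (κ := κ)
  have hσe := outerSign_mul_etaStar_neg ha hκ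
  set σ := outerSign κ
  have hσ1 : |σ| = 1 := by rw [← sq_eq_sq₀ (abs_nonneg _) zero_le_one, sq_abs, hσ]; norm_num
  have hcont : Continuous (fun x => σ * η x) := continuous_const.mul h.cont
  have hne : ∀ x ∈ Ioi R, σ * η x ≠ σ * etaStar κ := fun x hx he =>
    h.outer_ne ha hκ hs hR hη hx (mul_left_cancel₀ (fun h0 => by rw [h0] at hσ; norm_num at hσ) he)
  have hsqσ : ∀ x, η x ^ 2 = (σ * η x) ^ 2 := fun x => by rw [mul_pow, hσ, one_mul]
  have habs : ∀ x, |η x - etaStar κ| = |σ * η x - σ * etaStar κ| := fun x => by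
    rw [← mul_sub, abs_mul, hσ1, one_mul]
  -- On the wrong side of `η*` the profile could never cross back, and would stay at least `|η*|`
  -- away from zero, contradicting square integrability.
  have hgt : ∀ x ∈ Ioi R, σ * etaStar κ < σ * η x := by
    intro x hx
    by_contra hle
    have hlt : σ * η x < σ * etaStar κ := lt_of_le_of_ne (not_lt.1 hle) (hne x hx)
    refine not_sq_ge_on_Ioi (a := x) (k := (σ * etaStar κ) ^ 2) h.sq
      (by have := hσe.ne; positivity) fun y hy => ?_
    have hlt' : σ * η y < σ * etaStar κ := by
      by_contra hge
      push Not at hge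
      obtain ⟨z, hz, hz'⟩ := intermediate_value_Icc (le_of_lt hy) hcont.continuousOn ⟨hlt.le, hge⟩
      exact hne z (lt_of_lt_of_le hx hz.1) hz'
    rw [hsqσ]
    nlinarith
  have hmono : MonotoneOn (fun x => σ * η x) (Ici R) := by
    intro x hx y hy hxy
    have h1 := abs_sub_mono h.cont hs hR hη hx hxy
    rw [habs, habs] at h1
    have hge : ∀ z ∈ Ici R, 0 ≤ σ * η z - σ * etaStar κ := fun z hz => by
      rcases (mem_Ici.1 hz).eq_or_lt with h2 | h2
      · rw [← h2, hη]; simp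
      · linarith [hgt z h2]
    rw [abs_of_nonneg (hge x hx), abs_of_nonneg (hge y hy)] at h1
    simp only
    linarith
  refine ⟨hmono, fun x hx => ⟨hgt x hx, ?_⟩⟩
  have hnonpos : ∀ z ∈ Ioi R, σ * η z ≤ 0 := by
    intro z hz
    by_contra hp
    push Not at hp
    refine not_sq_ge_on_Ioi (a := z) (k := (σ * η z) ^ 2) h.sq (by positivity) fun y hy => ?_
    rw [hsqσ]
    have := hmono (Ioi_subset_Ici_self hz) (Ioi_subset_Ici_self (lt_trans (mem_Ioi.1 hz) hy)) (le_of_lt hy)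
    simp only at this
    gcongr
  refine lt_of_le_of_ne (hnonpos x hx) fun h0 => ?_
  have hz : ∀ z ∈ Ioi x, η z = 0 := fun z hz => by
    have hzR : z ∈ Ioi R := lt_trans (mem_Ioi.1 hx) hz
    have h1 := hmono (Ioi_subset_Ici_self hx) (Ioi_subset_Ici_self hzR) (le_of_lt hz)
    simp only [h0] at h1
    have h2 := le_antisymm (hnonpos z hzR) h1
    have h3 := hsqσ z
    rw [h2] at h3
    simpa using h3
  have h1 : x + 1 ∈ Ioi x := by simp
  have h2 := hs.unique (x + 1) (by rw [hz _ h1]; exact (ha.etaStar_ne_zero hκ).symm) (Or.inl (by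
    filter_upwards [Ioi_mem_nhds h1] with y hy
    rw [hz _ h1, hz _ hy]))
  have := mem_Ioi.1 hx
  linarith

theorem eq_profile_outer (ha : Admissible c κ η₀) (hP : ProfileClock c κ η₀ P) (hκ : κ ≠ 1 / 2)
    (h : ScalarWave c κ η q G) (hs : SingleExtremum κ η₀ η)
    (hη : η (crossingPoint c κ η₀) = etaStar κ) :
    ∀ x, crossingPoint c κ η₀ ≤ x → η x = profEta κ η₀ (P x) := by
  have hR := hP.crossingPoint_pos ha
  set R := crossingPoint c κ η₀ with hRdef
  obtain ⟨hmono, hb⟩ := h.outer_monotone ha hκ hs hR.le hη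
  have hσ := outerSign_sq (κ := κ)
  have hσe := outerSign_mul_etaStar_neg ha hκ
  set σ := outerSign κ
  have hratio : ∀ x ∈ Ioi R, 0 < η x / etaStar κ ∧ η x / etaStar κ < 1 := by
    intro x hx
    obtain ⟨h1, h2⟩ := hb x hx
    have h3 : η x / etaStar κ = (σ * η x) / (σ * etaStar κ) := by
      rw [mul_div_mul_left _ _ (fun h0 => by rw [h0] at hσ; norm_num at hσ)]
    rw [h3]
    exact ⟨div_pos_of_neg_of_neg h2 hσe, (div_lt_one_of_neg hσe).2 h1⟩
  have he0 := ha.etaStar_ne_zero hκ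
  have hratio' : ∀ x ∈ Ici R, 0 < η x / etaStar κ := fun x hx => by
    rcases (mem_Ici.1 hx).eq_or_lt with h2 | h2
    · rw [← h2, hη, div_self he0]; exact one_pos
    · exact (hratio x h2).1
  have hlt1 : ∀ x ∈ Ioi R, η x < 1 := fun x hx => by
    obtain ⟨r1, r2⟩ := hratio x hx
    have h1 : η x = etaStar κ * (η x / etaStar κ) := by field_simp
    have h2 := etaStar_lt_one ha.pos
    rw [h1]
    rcases le_total (etaStar κ) 0 with h | h <;> nlinarith
  have hD : ∀ x ∈ Ioi R, diffusion κ (η x) ≠ 0 := fun x hx =>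
    (diffusion_ne_zero_iff ha _).2 (h.outer_ne ha hκ hs hR.le hη hx)
  have hpar : ∀ x ∈ Ioi R, crossing κ η₀ < crossing κ η₀ - Real.log (η x / etaStar κ) := fun x hx => by
    have := Real.log_neg (hratio x hx).1 (hratio x hx).2
    linarith
  have hprof : ∀ x ∈ Ioi R, profEta κ η₀ (crossing κ η₀ - Real.log (η x / etaStar κ)) = η x := by
    intro x hx
    have h1 := hpar x hx
    have h2 : |crossing κ η₀ - Real.log (η x / etaStar κ)| = crossing κ η₀ - Real.log (η x / etaStar κ) :=
      abs_of_pos (ha.crossing_pos.trans h1)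
    rw [profEta, h2, if_neg (not_le.2 h1), sub_sub_cancel, Real.exp_log (hratio x hx).1]
    field_simp
  have hcl : Continuous (clock (profRate c κ η₀)) :=
    continuous_iff_continuousAt.2 fun p => (hasDerivAt_clock ha.profRate_continuous p).continuousAt
  -- Solving `η = η* exp(crossing - p)` for `p` gives this logarithmic parameter; the vanishing
  -- first integral makes its clock advance at unit speed.
  have hclock : ∀ x ∈ Ici R, clock (profRate c κ η₀) (crossing κ η₀ - Real.log (η x / etaStar κ)) = x := by
    intro x hx
    have hc : ContinuousOn (fun y => clock (profRate c κ η₀)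
        (crossing κ η₀ - Real.log (η y / etaStar κ)) - y) (Icc R x) := by
      refine ContinuousOn.sub (hcl.comp_continuousOn ?_) continuousOn_id
      refine continuousOn_const.sub (ContinuousOn.log (h.cont.div_const _).continuousOn fun y hy => ?_)
      exact (hratio' y hy.1).ne'
    have := eq_on_Icc_of_hasDerivAt_zero hx hc fun y hy => by
      have hy0 : y ∈ Ioi R := hy.1
      have hd := h.ode y (hD y hy0)
      have h1 := (hasDerivAt_clock ha.profRate_continuous
        (crossing κ η₀ - Real.log (η y / etaStar κ))).comp y
        (((hd.div_const (etaStar κ)).log (hratio y hy0).1.ne').const_sub _)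
      refine (h1.sub (hasDerivAt_id y)).congr_deriv ?_
      have hp := hpar y hy0
      have habs : crossing κ η₀ < |crossing κ η₀ - Real.log (η y / etaStar κ)| :=
        hp.trans_le (le_abs_self _)
      rw [sub_eq_zero, profRate, if_neg (not_le.2 habs), if_neg hκ, hprof y hy0]
      have hE := h.energy_eq_zero hD hlt1 hy0
      have hm : 1 - η y ≠ 0 := by linarith [hlt1 y hy0]
      rw [energy, div_eq_zero_iff, or_iff_left hm, sub_eq_zero] at hE
      have hsg := (ha.outer_sign (c := c) (hratio y hy0).1 (hratio y hy0).2 hκ).1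
      have hη1 : etaStar κ * (η y / etaStar κ) = η y := by field_simp
      rw [hη1] at hsg
      have hnn : 0 ≤ σ * (q y / diffusion κ (η y)) :=
        nonneg_of_hasDerivAt_of_monotoneOn (hd.const_mul σ) (a := R) (b := y + 1) ⟨hy.1, by linarith⟩
          (hmono.mono fun z hz => hz.1.le)
      have hση := (hb y hy0).2
      have hDy := hD y hy0
      have hB : outerFactor c (η y) ≠ 0 := right_ne_zero_of_mul hsg.ne'
      have hfr : 0 < diffusion κ (η y) / outerFactor c (η y) := div_pos_iff.2 (mul_pos_iff.1 hsg)
      have hr := Real.sq_sqrt hfr.le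
      have hrp := Real.sqrt_pos.2 hfr
      set r := √(diffusion κ (η y) / outerFactor c (η y))
      have hdd : q y ^ 2 / diffusion κ (η y) = (q y / diffusion κ (η y)) ^ 2 * diffusion κ (η y) := by
        field_simp
      rw [hdd] at hE
      set d := q y / diffusion κ (η y)
      have hηne : η y ≠ 0 := fun h0 => by rw [h0] at hση; simp at hση
      have h4 : (r * (σ * d)) ^ 2 = (-(σ * η y)) ^ 2 := by
        rw [mul_pow, mul_pow, hr, neg_sq, mul_pow, hσ, one_mul, one_mul, div_mul_eq_mul_div,
          div_eq_iff hB, ← hE]; ring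
      -- The first integral determines the slope up to sign; monotonicity of `σ η` and `σ η < 0`
      -- select the root.
      have h5 : r * (σ * d) = -(σ * η y) := by
        rwa [sq_eq_sq₀ (mul_nonneg hrp.le hnn) (by linarith)] at h4
      have h6 : r * d = -η y := by linear_combination σ * h5 + (-r * d - η y) * hσ
      have h7 : r * -(d / etaStar κ / (η y / etaStar κ)) = -(r * d) / η y := by
        field_simp
      rw [h7, h6]
      field_simp
    rw [hη, div_self he0, Real.log_one, sub_zero] at this
    have h2 : clock (profRate c κ η₀) (crossing κ η₀) = R := rfl
    rw [h2] at this
    linarith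
  intro x hx
  rcases hx.eq_or_lt with h1 | h1
  · rw [← h1, hη, hP.apply_crossingPoint, ha.profEta_crossing (abs_of_pos ha.crossing_pos)]
  · have h2 := hP.apply_clock (crossing κ η₀ - Real.log (η x / etaStar κ))
    rw [hclock x hx] at h2
    rw [h2, hprof x h1]

theorem eq_profile_of_nonneg (ha : Admissible c κ η₀) (hP : ProfileClock c κ η₀ P)
    (h : ScalarWave c κ η q G) (hs : SingleExtremum κ η₀ η) {x : ℝ} (hx : 0 ≤ x) :
    η x = profEta κ η₀ (P x) := by
  have hR := hP.crossingPoint_pos ha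
  have hin := h.eq_profile_inner ha hP hs
  have hη : η (crossingPoint c κ η₀) = etaStar κ := by
    rw [hin _ ⟨hR.le, le_rfl⟩, hP.apply_crossingPoint,
      ha.profEta_crossing (abs_of_pos ha.crossing_pos)]
  rcases le_total x (crossingPoint c κ η₀) with h1 | h1
  · exact hin x ⟨hx, h1⟩
  by_cases hκ : κ = 1 / 2
  · subst hκ
    rw [h.eq_zero_outer hs hR.le hη h1, ha.profEta_half]
    by_contra hlt
    exact absurd ((hP.abs_lt_iff x).1 (not_le.1 hlt)) (not_lt.2 (h1.trans (le_abs_self _)))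
  · exact h.eq_profile_outer ha hP hκ hs hη x h1

/-- The intensity profile of a wave with a single regular extremum of depth `η₀` is unique. -/
theorem eq_profile (ha : Admissible c κ η₀) (hP : ProfileClock c κ η₀ P)
    (h : ScalarWave c κ η q G) (hs : SingleExtremum κ η₀ η) (x : ℝ) :
    η x = profEta κ η₀ (P x) := by
  rcases le_total 0 x with hx | hx
  · exact h.eq_profile_of_nonneg ha hP hs hx
  · have := h.reflect.eq_profile_of_nonneg ha hP hs.reflect (x := -x) (by linarith)
    rwa [neg_neg, hP.eta_even] at this

end ScalarWave

/-! ### From the weak equation to the scalar system -/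

/-- The real form of the travelling wave equation for `u = a + i b` with `u' = α + i β`; the
functions `W₁`, `W₂` are the components of `u' - 2κ ⟨u, u'⟩ u`. -/
structure RealWave (c κ : ℝ) (a b α β W₁ W₂ : ℝ → ℝ) : Prop where
  fst : HasAEDeriv a α
  snd : HasAEDeriv b β
  flux_fst : HasAEDeriv W₁ (fun x => -(-c * β x + a x * (1 - (a x ^ 2 + b x ^ 2))
    + 2 * κ * (a x * α x + b x * β x) * α x))
  flux_snd : HasAEDeriv W₂ (fun x => -(c * α x + b x * (1 - (a x ^ 2 + b x ^ 2))
    + 2 * κ * (a x * α x + b x * β x) * β x))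
  fst_eq : ∀ᵐ x, W₁ x = α x - 2 * κ * (a x * α x + b x * β x) * a x
  snd_eq : ∀ᵐ x, W₂ x = β x - 2 * κ * (a x * α x + b x * β x) * b x
  sq_grad : Integrable (fun x => α x ^ 2 + β x ^ 2)
  sq_eta : Integrable (fun x => (1 - (a x ^ 2 + b x ^ 2)) ^ 2)

namespace RealWave

variable {c κ η₀ : ℝ} {a b α β W₁ W₂ : ℝ → ℝ}

theorem hasAEDeriv_eta (h : RealWave c κ a b α β W₁ W₂) :
    HasAEDeriv (fun x => 1 - (a x ^ 2 + b x ^ 2)) (fun x => -2 * (a x * α x + b x * β x)) := by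
  have := (hasAEDeriv_const 1).sub ((h.fst.mul h.fst).add (h.snd.mul h.snd))
  convert this using 2 <;> ring

theorem continuous_eta (h : RealWave c κ a b α β W₁ W₂) :
    Continuous (fun x => 1 - (a x ^ 2 + b x ^ 2)) := h.hasAEDeriv_eta.continuous

/-- The momentum is `c η / 2`. -/
theorem momentum (h : RealWave c κ a b α β W₁ W₂) (x : ℝ) :
    a x * W₂ x - b x * W₁ x = c * (1 - (a x ^ 2 + b x ^ 2)) / 2 := by
  have hJ := ((h.fst.mul h.flux_snd).sub (h.snd.mul h.flux_fst)).sub (h.hasAEDeriv_eta.const_mul (c / 2))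
  have hz := hJ.eq_of_ae_zero (by
    filter_upwards [h.fst_eq, h.snd_eq] with y h1 h2
    rw [h1, h2]; ring)
  set C := a x * W₂ x - b x * W₁ x - c / 2 * (1 - (a x ^ 2 + b x ^ 2)) with hC
  -- Where `|η| ≤ 1` one has `|u|² ≤ 2`, so `C²` is at most `4|u'|² + c²η²/2`, an integrable
  -- function; hence `C = 0`.
  have hk := nonpos_of_le_integrable (a := 0) (k := C ^ 2) h.sq_eta
    ((h.sq_grad.const_mul 4).add (h.sq_eta.const_mul (c ^ 2 / 2))) (by
      filter_upwards [h.fst_eq, h.snd_eq] with y h1 h2 _ h3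
      have hy : C = a y * β y - b y * α y - c / 2 * (1 - (a y ^ 2 + b y ^ 2)) := by
        rw [hC, hz x y, h1, h2]; ring
      have h4 := (abs_le.1 h3).1
      have h5 : (a y * β y - b y * α y) ^ 2 ≤ 2 * (α y ^ 2 + β y ^ 2) := by
        have : (a y * β y - b y * α y) ^ 2 + (a y * α y + b y * β y) ^ 2
          = (a y ^ 2 + b y ^ 2) * (α y ^ 2 + β y ^ 2) := by ring
        have h6 : (a y ^ 2 + b y ^ 2) * (α y ^ 2 + β y ^ 2) ≤ 2 * (α y ^ 2 + β y ^ 2) :=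
          mul_le_mul_of_nonneg_right (by linarith) (by positivity)
        nlinarith [sq_nonneg (a y * α y + b y * β y)]
      simp only [Pi.add_apply]
      rw [hy]
      nlinarith [sq_nonneg (a y * β y - b y * α y + c / 2 * (1 - (a y ^ 2 + b y ^ 2)))])
  have h0 : C = 0 := by nlinarith [sq_nonneg C]
  rw [hC] at h0
  linarith

/-- Classical regularity on an open set where `⟨u, u'⟩` has a continuous representative `σ`. -/
theorem classical (h : RealWave c κ a b α β W₁ W₂) {U : Set ℝ} {σ : ℝ → ℝ} (hU : IsOpen U)
    (hσ : ContinuousOn σ U) (hs : ∀ᵐ x, x ∈ U → a x * α x + b x * β x = σ x) {x : ℝ} (hx : x ∈ U) :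
    HasDerivAt a (W₁ x + 2 * κ * σ x * a x) x ∧ HasDerivAt b (W₂ x + 2 * κ * σ x * b x) x ∧
    HasDerivAt W₁ (-(-c * (W₂ x + 2 * κ * σ x * b x) + a x * (1 - (a x ^ 2 + b x ^ 2))
      + 2 * κ * σ x * (W₁ x + 2 * κ * σ x * a x))) x ∧
    HasDerivAt W₂ (-(c * (W₁ x + 2 * κ * σ x * a x) + b x * (1 - (a x ^ 2 + b x ^ 2))
      + 2 * κ * σ x * (W₂ x + 2 * κ * σ x * b x))) x := by
  have ca := h.fst.continuous.continuousOn (s := U)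
  have cb := h.snd.continuous.continuousOn (s := U)
  have c1 := h.flux_fst.continuous.continuousOn (s := U)
  have c2 := h.flux_snd.continuous.continuousOn (s := U)
  have e1 : ∀ᵐ y, y ∈ U → α y = W₁ y + 2 * κ * σ y * a y := by
    filter_upwards [hs, h.fst_eq] with y h1 h2 hy
    rw [h2, h1 hy]; ring
  have e2 : ∀ᵐ y, y ∈ U → β y = W₂ y + 2 * κ * σ y * b y := by
    filter_upwards [hs, h.snd_eq] with y h1 h2 hy
    rw [h2, h1 hy]; ring
  refine ⟨h.fst.hasDerivAt_of_ae_eq hU (by fun_prop) e1 hx,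
    h.snd.hasDerivAt_of_ae_eq hU (by fun_prop) e2 hx,
    h.flux_fst.hasDerivAt_of_ae_eq hU (g := fun x => -(-c * (W₂ x + 2 * κ * σ x * b x) +
      a x * (1 - (a x ^ 2 + b x ^ 2)) + 2 * κ * σ x * (W₁ x + 2 * κ * σ x * a x)))
      (by fun_prop) ?_ hx,
    h.flux_snd.hasDerivAt_of_ae_eq hU (g := fun x => -(c * (W₁ x + 2 * κ * σ x * a x) +
      b x * (1 - (a x ^ 2 + b x ^ 2)) + 2 * κ * σ x * (W₂ x + 2 * κ * σ x * b x)))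
      (by fun_prop) ?_ hx⟩
  · filter_upwards [hs, e1, e2] with y h1 h2 h3 hy
    rw [h1 hy, ← h2 hy, ← h3 hy]
  · filter_upwards [hs, e1, e2] with y h1 h2 h3 hy
    rw [h1 hy, ← h2 hy, ← h3 hy]

/-- The scalar flux `-2 ⟨u, u' - 2κ ⟨u, u'⟩ u⟩`. -/
def scalarFlux (a b W₁ W₂ : ℝ → ℝ) (x : ℝ) : ℝ := -2 * (a x * W₁ x + b x * W₂ x)

theorem continuous_scalarFlux (h : RealWave c κ a b α β W₁ W₂) :
    Continuous (scalarFlux a b W₁ W₂) := by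
  have ca := h.fst.continuous
  have cb := h.snd.continuous
  have c1 := h.flux_fst.continuous
  have c2 := h.flux_snd.continuous
  unfold scalarFlux
  fun_prop

theorem scalarFlux_ae (h : RealWave c κ a b α β W₁ W₂) :
    ∀ᵐ x, scalarFlux a b W₁ W₂ x =
      -2 * (a x * α x + b x * β x) * diffusion κ (1 - (a x ^ 2 + b x ^ 2)) := by
  filter_upwards [h.fst_eq, h.snd_eq] with x h1 h2
  rw [scalarFlux, h1, h2, diffusion]; ring

/-- Pointwise consequences of classical regularity. -/
theorem pointwise (h : RealWave c κ a b α β W₁ W₂) {U : Set ℝ} {σ : ℝ → ℝ} (hU : IsOpen U)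
    (hσ : ContinuousOn σ U) (hs : ∀ᵐ x, x ∈ U → a x * α x + b x * β x = σ x)
    (hq : ∀ x ∈ U, scalarFlux a b W₁ W₂ x = -2 * σ x * diffusion κ (1 - (a x ^ 2 + b x ^ 2)))
    {x : ℝ} (hx : x ∈ U) :
    HasDerivAt (fun y => 1 - (a y ^ 2 + b y ^ 2)) (-2 * σ x) x ∧
    (∃ N, (a x ^ 2 + b x ^ 2) * N = σ x ^ 2 + (c * (1 - (a x ^ 2 + b x ^ 2)) / 2) ^ 2 ∧
      HasDerivAt (scalarFlux a b W₁ W₂) (-2 * (N - 4 * κ * σ x ^ 2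
        + c * (c * (1 - (a x ^ 2 + b x ^ 2)) / 2)
        - (a x ^ 2 + b x ^ 2) * (1 - (a x ^ 2 + b x ^ 2)))) x) ∧
    (a x ^ 2 + b x ^ 2 ≠ 0 → HasDerivAt (fun y => (a y : ℂ) + Complex.I * b y)
      ((a x + Complex.I * b x) * logSlope c (1 - (a x ^ 2 + b x ^ 2)) (-2 * σ x)) x) := by
  obtain ⟨d1, d2, d3, d4⟩ := h.classical hU hσ hs hx
  have hJ := h.momentum x
  have hqx := hq x hx
  unfold scalarFlux diffusion at hqx
  set A := W₁ x + 2 * κ * σ x * a x with hA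
  set B := W₂ x + 2 * κ * σ x * b x with hB
  have hW1 : W₁ x = A - 2 * κ * σ x * a x := by rw [hA]; ring
  have hW2 : W₂ x = B - 2 * κ * σ x * b x := by rw [hB]; ring
  rw [hW1, hW2] at hJ hqx
  have hS : a x * A + b x * B = σ x := by linear_combination (-1 / 2) * hqx
  have hJ' : a x * B - b x * A = c * (1 - (a x ^ 2 + b x ^ 2)) / 2 := by linear_combination hJ
  -- The witness is `|u'|²`; Lagrange's identity `|u|²|u'|² = ⟨u,u'⟩² + ⟨iu,u'⟩²` relates it to
  -- slope and momentum without dividing by `|u|²`.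
  refine ⟨?_, ⟨A ^ 2 + B ^ 2, ?_, ?_⟩, fun hm => ?_⟩
  · refine (((d1.fun_pow 2).add (d2.fun_pow 2)).const_sub 1).congr_deriv ?_
    push_cast
    linear_combination (-2) * hS
  · rw [← hS, ← hJ']; ring
  · have := ((d1.mul d3).add (d2.mul d4)).const_mul (-2)
    refine this.congr_deriv ?_
    rw [hW1, hW2, ← hJ']
    linear_combination (-2) * (-4 * κ * σ x) * hS
  · have := d1.ofReal_comp.add (d2.ofReal_comp.const_mul Complex.I)
    refine this.congr_deriv ?_
    have hm' : ((a x : ℂ) ^ 2 + (b x : ℂ) ^ 2) ≠ 0 := by exact_mod_cast hm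
    have hS' : (a x : ℂ) * A + b x * B = σ x := by exact_mod_cast hS
    have hJ'' : (c : ℂ) * (1 - ((a x : ℂ) ^ 2 + (b x : ℂ) ^ 2)) = 2 * (a x * B - b x * A) := by
      have : c * (1 - (a x ^ 2 + b x ^ 2)) = 2 * (a x * B - b x * A) := by linarith
      exact_mod_cast this
    unfold logSlope
    push_cast
    rw [mul_assoc Complex.I, hJ'', ← hS']
    have hm2 : (2 : ℂ) * (1 - (1 - ((a x : ℂ) ^ 2 + (b x : ℂ) ^ 2))) ≠ 0 := by
      rw [sub_sub_cancel]; exact mul_ne_zero two_ne_zero hm'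
    rw [← mul_div_assoc, eq_div_iff hm2]
    linear_combination (-2 * (b x : ℂ) * (a x * B - b x * A)) * Complex.I_sq

/-- The slope off the singular set. -/
theorem pointwise_regular (h : RealWave c κ a b α β W₁ W₂) {x : ℝ}
    (hx : diffusion κ (1 - (a x ^ 2 + b x ^ 2)) ≠ 0) :
    HasDerivAt (fun y => 1 - (a y ^ 2 + b y ^ 2))
      (scalarFlux a b W₁ W₂ x / diffusion κ (1 - (a x ^ 2 + b x ^ 2))) x ∧
    (1 - (a x ^ 2 + b x ^ 2) < 1 → HasDerivAt (scalarFlux a b W₁ W₂)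
      (fluxDeriv c κ (1 - (a x ^ 2 + b x ^ 2))
        (scalarFlux a b W₁ W₂ x / diffusion κ (1 - (a x ^ 2 + b x ^ 2)))) x) ∧
    (a x ^ 2 + b x ^ 2 ≠ 0 → HasDerivAt (fun y => (a y : ℂ) + Complex.I * b y)
      ((a x + Complex.I * b x) * logSlope c (1 - (a x ^ 2 + b x ^ 2))
        (scalarFlux a b W₁ W₂ x / diffusion κ (1 - (a x ^ 2 + b x ^ 2)))) x) := by
  have hDc : Continuous (fun y => diffusion κ (1 - (a y ^ 2 + b y ^ 2))) :=
    Admissible.continuous_diffusion.comp h.continuous_eta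
  have hU : IsOpen {y | diffusion κ (1 - (a y ^ 2 + b y ^ 2)) ≠ 0} :=
    isOpen_ne_fun hDc continuous_const
  let σ : ℝ → ℝ := fun y => -(scalarFlux a b W₁ W₂ y / diffusion κ (1 - (a y ^ 2 + b y ^ 2))) / 2
  have hσ : ContinuousOn σ {y | diffusion κ (1 - (a y ^ 2 + b y ^ 2)) ≠ 0} :=
    ((h.continuous_scalarFlux.continuousOn.div hDc.continuousOn fun y hy => hy).neg).div_const 2
  obtain ⟨p1, ⟨N, p2, p3⟩, p4⟩ := h.pointwise hU hσ (by
    filter_upwards [h.scalarFlux_ae] with y hy hyD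
    simp only [σ]
    rw [hy]
    have : diffusion κ (1 - (a y ^ 2 + b y ^ 2)) ≠ 0 := hyD
    field_simp) (fun y hy => by
    have : diffusion κ (1 - (a y ^ 2 + b y ^ 2)) ≠ 0 := hy
    simp only [σ]
    field_simp) (x := x) hx
  have e : scalarFlux a b W₁ W₂ x / diffusion κ (1 - (a x ^ 2 + b x ^ 2)) = -2 * σ x := by
    simp only [σ]; ring
  rw [e]
  refine ⟨p1, fun hm => p3.congr_deriv ?_, p4⟩
  have hm' : a x ^ 2 + b x ^ 2 ≠ 0 := by linarith
  have hN : N = (σ x ^ 2 + (c * (1 - (a x ^ 2 + b x ^ 2)) / 2) ^ 2) / (a x ^ 2 + b x ^ 2) := by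
    rw [eq_div_iff hm', ← p2]; ring
  rw [hN]
  unfold fluxDeriv
  rw [sub_sub_cancel]
  field_simp
  ring

/-- On a plateau the slope vanishes and continuity makes the flux vanish everywhere. The flux
equation, with zero on the left, becomes the algebraic relation, and the wave rotates with constant
modulus. -/
theorem pointwise_plateau (h : RealWave c κ a b α β W₁ W₂) {s t : ℝ}
    (hz : ∀ x ∈ Ioo s t, diffusion κ (1 - (a x ^ 2 + b x ^ 2)) = 0)
    (hconst : ∀ x ∈ Ioo s t, ∀ y ∈ Ioo s t, 1 - (a x ^ 2 + b x ^ 2) = 1 - (a y ^ 2 + b y ^ 2))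
    {x : ℝ} (hx : x ∈ Ioo s t) :
    (c ^ 2 * (1 - (a x ^ 2 + b x ^ 2)) ^ 2 + 2 * c ^ 2 * (1 - (a x ^ 2 + b x ^ 2)) *
      (1 - (1 - (a x ^ 2 + b x ^ 2))) - 4 * (1 - (1 - (a x ^ 2 + b x ^ 2))) ^ 2 *
      (1 - (a x ^ 2 + b x ^ 2)) = 0) ∧
    (a x ^ 2 + b x ^ 2 ≠ 0 → HasDerivAt (fun y => (a y : ℂ) + Complex.I * b y)
      ((a x + Complex.I * b x) * logSlope c (1 - (a x ^ 2 + b x ^ 2)) 0) x) := by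
  have hq : ∀ y ∈ Ioo s t, scalarFlux a b W₁ W₂ y = 0 := by
    have hae : ∀ᵐ y ∂(volume.restrict (Ioo s t)), scalarFlux a b W₁ W₂ y = 0 := by
      rw [ae_restrict_iff' measurableSet_Ioo]
      filter_upwards [h.scalarFlux_ae] with y hy hys
      rw [hy, hz y hys, mul_zero]
    exact Measure.eqOn_Ioo_of_ae_eq volume hae h.continuous_scalarFlux.continuousOn continuousOn_const
  obtain ⟨-, ⟨N, p2, p3⟩, p4⟩ := h.pointwise isOpen_Ioo (σ := fun _ => 0) continuousOn_const (by
    filter_upwards [h.hasAEDeriv_eta.2] with y hy hys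
    have h0 : HasDerivAt (fun y => 1 - (a y ^ 2 + b y ^ 2)) 0 y := by
      refine (hasDerivAt_const y (1 - (a y ^ 2 + b y ^ 2))).congr_of_eventuallyEq ?_
      filter_upwards [isOpen_Ioo.mem_nhds hys] with z hzs using hconst z hzs y hys
    have := hy.unique h0
    linarith) (fun y hy => by rw [hq y hy]; ring) hx
  have h0 : HasDerivAt (scalarFlux a b W₁ W₂) 0 x := by
    refine (hasDerivAt_const x (0 : ℝ)).congr_of_eventuallyEq ?_
    filter_upwards [isOpen_Ioo.mem_nhds hx] with z hzs using hq z hzs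
  have h1 := p3.unique h0
  refine ⟨?_, by simpa using p4⟩
  rw [sub_sub_cancel]
  linear_combination (-2 * (a x ^ 2 + b x ^ 2)) * h1 - 4 * p2

theorem scalarWave (ha : Admissible c κ η₀) (h : RealWave c κ a b α β W₁ W₂) :
    ScalarWave c κ (fun x => 1 - (a x ^ 2 + b x ^ 2)) (scalarFlux a b W₁ W₂)
      (fun x => α x ^ 2 + β x ^ 2) where
  cont := h.continuous_eta
  cont_flux := h.continuous_scalarFlux
  ode x hx := (h.pointwise_regular hx).1
  ode_flux x hx := (h.pointwise_regular hx).2.1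
  sq := h.sq_eta
  int := h.sq_grad
  bound := by
    filter_upwards [h.scalarFlux_ae] with x hx hD
    rw [hx, mul_div_assoc, div_self hD, mul_one]
    nlinarith [sq_nonneg (a x * β x - b x * α x)]
  plateau s t _ hz x hx := by
    refine (h.pointwise_plateau hz (fun y hy z hz' => ?_) hx).1
    have h1 := hz y hy
    have h2 := hz z hz'
    rw [diffusion_eq ha.pos, mul_eq_zero] at h1 h2
    have h3 : 2 * κ ≠ 0 := by linarith [ha.pos]
    linarith [h1.resolve_left h3, h2.resolve_left h3]

end RealWave

theorem locallyIntegrable_re {g : ℝ → ℂ} (hg : LocallyIntegrable g volume) :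
    LocallyIntegrable (fun x => (g x).re) volume := fun x => by
  obtain ⟨s, hs, hi⟩ := hg x
  exact ⟨s, hs, hi.re⟩

theorem locallyIntegrable_im {g : ℝ → ℂ} (hg : LocallyIntegrable g volume) :
    LocallyIntegrable (fun x => (g x).im) volume := fun x => by
  obtain ⟨s, hs, hi⟩ := hg x
  exact ⟨s, hs, hi.im⟩

theorem locallyIntegrable_continuous_mul {f g : ℝ → ℝ} (hf : Continuous f)
    (hg : LocallyIntegrable g volume) : LocallyIntegrable (fun x => f x * g x) volume := by
  rw [locallyIntegrable_iff]
  exact fun K hK => (hg.integrableOn_isCompact hK).continuousOn_mul hf.continuousOn hK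

theorem HasWeakDeriv.ae_unique {v g₁ g₂ : ℝ → ℂ} (h₁ : HasWeakDeriv v g₁) (h₂ : HasWeakDeriv v g₂) :
    ∀ᵐ x, g₁ x = g₂ x :=
  ae_eq_of_integral_contDiff_smul_eq h₁.2.1 h₂.2.1 fun φ hφ hc => by
    have e1 := h₁.2.2 φ hφ hc
    rw [h₂.2.2 φ hφ hc] at e1
    exact neg_inj.1 e1.symm

theorem HasWeakDeriv.hasAEDeriv {v g : ℝ → ℂ} (hv : Continuous v) (h : HasWeakDeriv v g) :
    HasAEDeriv (fun x => (v x).re) (fun x => (g x).re) ∧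
      HasAEDeriv (fun x => (v x).im) (fun x => (g x).im) := by
  have hi : ∀ φ : ℝ → ℝ, ContDiff ℝ ∞ φ → HasCompactSupport φ →
      Integrable (fun x => deriv φ x • v x) ∧ Integrable (fun x => φ x • g x) := fun φ hφ hc =>
    ⟨h.1.integrable_smul_left_of_hasCompactSupport (hφ.continuous_deriv (by simp)) hc.deriv,
      h.2.1.integrable_smul_left_of_hasCompactSupport hφ.continuous hc⟩
  constructor
  · obtain ⟨P, hP, hPe⟩ := exists_hasAEDeriv_of_weakDeriv (locallyIntegrable_re h.1)
      (locallyIntegrable_re h.2.1) fun φ hφ hc => by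
        have e := congrArg Complex.re (h.2.2 φ hφ hc)
        obtain ⟨i1, i2⟩ := hi φ hφ hc
        have r1 := Complex.reCLM.integral_comp_comm i1
        have r2 := Complex.reCLM.integral_comp_comm i2
        simp only [Complex.reCLM_apply, Complex.real_smul, Complex.re_ofReal_mul, Complex.neg_re] at r1 r2 e
        rw [r1, r2]; exact e
    have : (fun x => (v x).re) = P :=
      (Complex.continuous_re.comp hv).ae_eq_iff_eq volume hP.continuous |>.1 hPe
    rw [this]; exact hP
  · obtain ⟨P, hP, hPe⟩ := exists_hasAEDeriv_of_weakDeriv (locallyIntegrable_im h.1)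
      (locallyIntegrable_im h.2.1) fun φ hφ hc => by
        have e := congrArg Complex.im (h.2.2 φ hφ hc)
        obtain ⟨i1, i2⟩ := hi φ hφ hc
        have r1 := Complex.imCLM.integral_comp_comm i1
        have r2 := Complex.imCLM.integral_comp_comm i2
        simp only [Complex.imCLM_apply, Complex.real_smul, Complex.im_ofReal_mul, Complex.neg_im] at r1 r2 e
        rw [r1, r2]; exact e
    have : (fun x => (v x).im) = P :=
      (Complex.continuous_im.comp hv).ae_eq_iff_eq volume hP.continuous |>.1 hPe
    rw [this]; exact hP

/-- Testing with `χ` and `iχ`, `χ` real, splits the weak equation into two equations `∫ χ' W = -∫ χ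
F` with `F` locally integrable. The lemma of du Bois-Reymond then gives `u' - 2κ⟨u,u'⟩u` an
absolutely continuous representative. -/
theorem exists_realWave {c κ : ℝ} {v : ℝ → ℂ} (hX : InX v) (hS : IsWeakSolution c κ v) :
    ∃ α β W₁ W₂, RealWave c κ (fun x => (v x).re) (fun x => (v x).im) α β W₁ W₂ := by
  obtain ⟨hv, -, hη, g, hg, hg2⟩ := hX
  obtain ⟨g', hg', hw⟩ := hS
  -- The energy space and the weak equation may each supply a different representative of `u'`.
  have hgg := hg'.ae_unique hg
  obtain ⟨ha, hb⟩ := hg.hasAEDeriv hv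
  set a := fun x => (v x).re with hadef
  set b := fun x => (v x).im with hbdef
  set α := fun x => (g x).re with hαdef
  set β := fun x => (g x).im with hβdef
  have ca : Continuous a := ha.continuous
  have cb : Continuous b := hb.continuous
  have hαl : LocallyIntegrable α volume := locallyIntegrable_re hg.2.1
  have hβl : LocallyIntegrable β volume := locallyIntegrable_im hg.2.1
  have heta : ∀ x, eta v x = 1 - (a x ^ 2 + b x ^ 2) := fun x => by
    rw [eta, ← Complex.normSq_eq_norm_sq, Complex.normSq_apply]; ring
  have hgm := hg2.aestronglyMeasurable
  have hsq : Integrable (fun x => α x ^ 2 + β x ^ 2) := by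
    have := (memLp_two_iff_integrable_sq_norm hgm).1 hg2
    refine this.congr (Eventually.of_forall fun x => ?_)
    simp only [hαdef, hβdef]
    rw [← Complex.normSq_eq_norm_sq, Complex.normSq_apply]; ring
  have hαm : AEStronglyMeasurable α := hαl.aestronglyMeasurable
  have hβm : AEStronglyMeasurable β := hβl.aestronglyMeasurable
  have hαα : Integrable (fun x => α x * α x) := by
    refine hsq.mono' (hαm.mul hαm) (Eventually.of_forall fun x => ?_)
    rw [Real.norm_eq_abs, abs_mul_self]; nlinarith [sq_nonneg (β x)]
  have hββ : Integrable (fun x => β x * β x) := by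
    refine hsq.mono' (hβm.mul hβm) (Eventually.of_forall fun x => ?_)
    rw [Real.norm_eq_abs, abs_mul_self]; nlinarith [sq_nonneg (α x)]
  have hαβ : Integrable (fun x => α x * β x) := by
    refine hsq.mono' (hαm.mul hβm) (Eventually.of_forall fun x => ?_)
    rw [Real.norm_eq_abs, abs_le]
    constructor <;> nlinarith [sq_nonneg (α x + β x), sq_nonneg (α x - β x)]
  have hF1 : LocallyIntegrable (fun x => -(-c * β x + a x * (1 - (a x ^ 2 + b x ^ 2))
      + 2 * κ * (a x * α x + b x * β x) * α x)) volume := by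
    have l1 := hβl.smul (-c)
    have l2 : LocallyIntegrable (fun x => a x * (1 - (a x ^ 2 + b x ^ 2))) volume :=
      Continuous.locallyIntegrable (by fun_prop)
    have l3 := locallyIntegrable_continuous_mul (f := fun x => 2 * κ * a x) (by fun_prop) hαα.locallyIntegrable
    have l4 := locallyIntegrable_continuous_mul (f := fun x => 2 * κ * b x) (by fun_prop) hαβ.locallyIntegrable
    convert (((l1.add l2).add l3).add l4).neg using 1
    ext x
    simp only [Pi.neg_apply, Pi.add_apply, Pi.smul_apply, smul_eq_mul]
    ring
  have hF2 : LocallyIntegrable (fun x => -(c * α x + b x * (1 - (a x ^ 2 + b x ^ 2))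
      + 2 * κ * (a x * α x + b x * β x) * β x)) volume := by
    have l1 := hαl.smul c
    have l2 : LocallyIntegrable (fun x => b x * (1 - (a x ^ 2 + b x ^ 2))) volume :=
      Continuous.locallyIntegrable (by fun_prop)
    have l3 := locallyIntegrable_continuous_mul (f := fun x => 2 * κ * a x) (by fun_prop) hαβ.locallyIntegrable
    have l4 := locallyIntegrable_continuous_mul (f := fun x => 2 * κ * b x) (by fun_prop) hββ.locallyIntegrable
    convert (((l1.add l2).add l3).add l4).neg using 1
    ext x
    simp only [Pi.neg_apply, Pi.add_apply, Pi.smul_apply, smul_eq_mul]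
    ring
  have hW1 : LocallyIntegrable (fun x => α x - 2 * κ * (a x * α x + b x * β x) * a x) volume := by
    have l3 := locallyIntegrable_continuous_mul (f := fun x => 2 * κ * a x * a x) (by fun_prop) hαl
    have l4 := locallyIntegrable_continuous_mul (f := fun x => 2 * κ * b x * a x) (by fun_prop) hβl
    convert (hαl.sub l3).sub l4 using 1
    ext x
    simp only [Pi.sub_apply]
    ring
  have hW2 : LocallyIntegrable (fun x => β x - 2 * κ * (a x * α x + b x * β x) * b x) volume := by
    have l3 := locallyIntegrable_continuous_mul (f := fun x => 2 * κ * a x * b x) (by fun_prop) hαl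
    have l4 := locallyIntegrable_continuous_mul (f := fun x => 2 * κ * b x * b x) (by fun_prop) hβl
    convert (hβl.sub l3).sub l4 using 1
    ext x
    simp only [Pi.sub_apply]
    ring
  have hinner : ∀ z w : ℂ, inner ℝ z w = z.re * w.re + z.im * w.im := fun z w => by
    rw [Complex.inner, Complex.mul_re, Complex.conj_re, Complex.conj_im]; ring
  have split : ∀ {χ F W : ℝ → ℝ}, ContDiff ℝ ∞ χ → HasCompactSupport χ →
      LocallyIntegrable F volume → LocallyIntegrable W volume →
      ∫ x, (-(χ x * F x) - deriv χ x * W x) = 0 → ∫ x, deriv χ x * W x = -∫ x, χ x * F x := by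
    intro χ F W hχ hc hF hW h0
    have i1 : Integrable (fun x => χ x * F x) :=
      hF.integrable_smul_left_of_hasCompactSupport hχ.continuous hc
    have i2 : Integrable (fun x => deriv χ x * W x) :=
      hW.integrable_smul_left_of_hasCompactSupport (hχ.continuous_deriv (by simp)) hc.deriv
    have e : ∫ x, (-(χ x * F x) - deriv χ x * W x) = -(∫ x, χ x * F x) - ∫ x, deriv χ x * W x := by
      rw [← integral_neg]
      exact integral_sub i1.neg i2
    rw [e] at h0
    linarith
  obtain ⟨W₁, hW₁, hW₁e⟩ := exists_hasAEDeriv_of_weakDeriv hW1 hF1 fun χ hχ hc => by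
    refine split hχ hc hF1 hW1 ?_
    have hφ : ContDiff ℝ ∞ (fun x => (χ x : ℂ)) := Complex.ofRealCLM.contDiff.comp hχ
    have hd : ∀ x, deriv (fun x => (χ x : ℂ)) x = deriv χ x := fun x =>
      ((hχ.differentiable (by simp) x).hasDerivAt.ofReal_comp).deriv
    rw [← hw _ hφ (hc.comp_left (g := fun r : ℝ => (r : ℂ)) (by simp))]
    refine integral_congr_ae ?_
    filter_upwards [hgg] with x hx
    rw [hx, hd, heta]
    simp only [hinner, Complex.add_re, Complex.mul_re, Complex.mul_im, Complex.I_re, Complex.I_im,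
      Complex.ofReal_re, Complex.ofReal_im, Complex.add_im]
    simp only [hadef, hbdef, hαdef, hβdef]
    ring
  obtain ⟨W₂, hW₂, hW₂e⟩ := exists_hasAEDeriv_of_weakDeriv hW2 hF2 fun χ hχ hc => by
    refine split hχ hc hF2 hW2 ?_
    have hφ : ContDiff ℝ ∞ (fun x => Complex.I * (χ x : ℂ)) :=
      contDiff_const.mul (Complex.ofRealCLM.contDiff.comp hχ)
    have hd : ∀ x, deriv (fun x => Complex.I * (χ x : ℂ)) x = Complex.I * deriv χ x := fun x =>
      ((hχ.differentiable (by simp) x).hasDerivAt.ofReal_comp.const_mul Complex.I).deriv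
    rw [← hw _ hφ (hc.comp_left (g := fun r : ℝ => Complex.I * (r : ℂ)) (by simp))]
    refine integral_congr_ae ?_
    filter_upwards [hgg] with x hx
    rw [hx, hd, heta]
    simp only [hinner, Complex.add_re, Complex.mul_re, Complex.mul_im, Complex.I_re, Complex.I_im,
      Complex.ofReal_re, Complex.ofReal_im, Complex.add_im]
    simp only [hadef, hbdef, hαdef, hβdef]
    ring
  refine ⟨α, β, W₁, W₂, ha, hb, hW₁, hW₂, ?_, ?_, hsq, ?_⟩
  · filter_upwards [hW₁e] with x hx using hx.symm
  · filter_upwards [hW₂e] with x hx using hx.symm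
  · have := (memLp_two_iff_integrable_sq_norm hη.aestronglyMeasurable).1 hη
    simpa [heta] using this

/-! ### Uniqueness up to a phase -/

theorem IsCompositeWave.singleExtremum {c κ η₀ : ℝ} (ha : Admissible c κ η₀) {v : ℝ → ℂ}
    (hv : IsCompositeWave c κ η₀ v) : ScalarWave.SingleExtremum κ η₀ (eta v) where
  value := hv.value
  extr := by
    have : (0 : ℝ) ∈ regularExtrema κ v := by rw [hv.extrema]; rfl
    exact this.2
  unique x hx h := by
    have : x ∈ regularExtrema κ v := by
      refine ⟨fun hm => ?_, h⟩
      rw [ProfileClock.mem_singularSet_iff ha] at hm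
      exact (ScalarWave.diffusion_ne_zero_iff ha _).2 hx hm
    rw [hv.extrema] at this
    exact this

/-- Any composite wave has the intensity of the profile wave, and away from the two singular points
the same logarithmic derivative. -/
theorem IsCompositeWave.eta_eq_and_hasDerivAt {c κ η₀ : ℝ} (ha : Admissible c κ η₀) {P : ℝ → ℝ}
    (hP : ProfileClock c κ η₀ P) {v : ℝ → ℂ} (hv : IsCompositeWave c κ η₀ v) :
    (∀ x, eta v x = profEta κ η₀ (P x)) ∧
    ∀ x, |x| ≠ crossingPoint c κ η₀ → HasDerivAt v (v x * logSlope c (profEta κ η₀ (P x))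
      (profFlux c κ η₀ (P x) / diffusion κ (profEta κ η₀ (P x)))) x := by
  obtain ⟨α, β, W₁, W₂, hr⟩ := exists_realWave hv.inX hv.sol
  have heta : eta v = fun x => 1 - ((v x).re ^ 2 + (v x).im ^ 2) := funext fun x => by
    rw [eta, ← Complex.normSq_eq_norm_sq, Complex.normSq_apply]; ring
  have hs := hv.singleExtremum ha
  have hη : ∀ x, eta v x = profEta κ η₀ (P x) := by
    rw [heta] at hs ⊢
    exact (hr.scalarWave ha).eq_profile ha hP hs
  have hη' : ∀ x, 1 - ((v x).re ^ 2 + (v x).im ^ 2) = profEta κ η₀ (P x) := fun x => by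
    rw [← hη, heta]
  refine ⟨hη, fun x hx => ?_⟩
  have hfun : (fun y => ((v y).re : ℂ) + Complex.I * (v y).im) = v := funext fun y => by
    rw [mul_comm]; exact Complex.re_add_im (v y)
  have hvx : ((v x).re : ℂ) + Complex.I * (v x).im = v x := congrFun hfun x
  have hm : (v x).re ^ 2 + (v x).im ^ 2 ≠ 0 := by
    have := ha.profEta_lt_one (P x)
    have := hη' x
    linarith
  have hd := (hP.ode ha hx).1
  -- Off the crossings the diffusion vanishes only on the outer region for `κ = 1/2`. There `x` lies
  -- in a plateau at `η = 0`, which replaces the regular computation.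
  by_cases hD : diffusion κ (profEta κ η₀ (P x)) = 0
  · by_cases hκ : κ = 1 / 2
    · subst hκ
      have hx1 : |P x| ≠ crossing (1 / 2) η₀ := fun h => hx ((hP.abs_eq_iff x).1 h)
      have hout : crossingPoint c (1 / 2) η₀ < |x| := by
        rcases lt_or_gt_of_ne hx1 with h1 | h1
        · exact absurd hD (ha.diffusion_inner_neg h1).ne
        · exact (hP.lt_abs_iff x).1 h1
      have hz : ∀ y, crossingPoint c (1 / 2) η₀ < |y| → profEta (1 / 2) η₀ (P y) = 0 := fun y hy =>
        ha.profEta_half ((hP.lt_abs_iff y).2 hy).le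
      obtain ⟨s, t, hxs, hst⟩ : ∃ s t, x ∈ Ioo s t ∧ ∀ y ∈ Ioo s t, crossingPoint c (1 / 2) η₀ < |y| := by
        rcases lt_abs.1 hout with h1 | h1
        · exact ⟨crossingPoint c (1 / 2) η₀, x + 1, ⟨h1, by linarith⟩,
            fun y hy => hy.1.trans_le (le_abs_self y)⟩
        · refine ⟨x - 1, -crossingPoint c (1 / 2) η₀, ⟨by linarith, by linarith⟩, fun y hy => ?_⟩
          have := neg_le_abs y
          linarith [hy.2]
      have hpl := (hr.pointwise_plateau (s := s) (t := t)
        (fun y hy => by simp only [hη', hz y (hst y hy)]; norm_num [diffusion])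
        (fun y hy z hz' => by simp only [hη', hz y (hst y hy), hz z (hst z hz')]) hxs).2 hm
      simp only [hη', hfun, hvx] at hpl
      have h0 : profFlux c (1 / 2) η₀ (P x) = 0 := ha.profFlux_half ((hP.lt_abs_iff x).2 hout)
      rw [h0, zero_div]
      exact hpl
    · exact absurd ((hP.abs_eq_iff x).1 ((ha.diffusion_eq_zero_iff hκ _).1 hD)) hx
  · obtain ⟨d1, -, d3⟩ := hr.pointwise_regular (x := x) (by simp only [hη']; exact hD)
    have h3 := d3 hm
    simp only [hη', hfun, hvx] at h3 d1
    rw [d1.unique hd] at h3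
    exact h3

/-- Composite waves are unique up to a phase shift. -/
theorem IsCompositeWave.eq_phase_mul {c κ η₀ : ℝ} (ha : Admissible c κ η₀) {P : ℝ → ℝ}
    (hP : ProfileClock c κ η₀ P) {u v : ℝ → ℂ} (hu : IsCompositeWave c κ η₀ u)
    (hv : IsCompositeWave c κ η₀ v) :
    ∃ ϕ : ℝ, ∀ x : ℝ, v x = Complex.exp (Complex.I * (ϕ : ℂ)) * u x := by
  obtain ⟨eu, du⟩ := hu.eta_eq_and_hasDerivAt ha hP
  obtain ⟨ev, dv⟩ := hv.eta_eq_and_hasDerivAt ha hP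
  have hne : ∀ x, u x ≠ 0 := fun x h0 => by
    have h1 := eu x
    rw [eta, h0] at h1
    have := ha.profEta_lt_one (P x)
    simp at h1
    linarith
  -- The quotient is continuous because `u` has no zeros, so equality of logarithmic derivatives off
  -- two points makes it constant across them.
  have hconst := eq_of_hasDerivAt_zero_off_countable (f := fun x => v x / u x)
    (s := {crossingPoint c κ η₀, -crossingPoint c κ η₀}) (toFinite _).countable
    (hv.inX.1.div hu.inX.1 hne) fun x hx => by
      have hx' : |x| ≠ crossingPoint c κ η₀ := fun h => hx ((hP.mem_pair_iff ha).2 h)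
      refine ((dv x hx').fun_div (du x hx') (hne x)).congr_deriv ?_
      rw [div_eq_zero_iff]; left; ring
  have hnorm : ‖v 0 / u 0‖ = 1 := by
    have h1 : ‖v 0‖ ^ 2 = ‖u 0‖ ^ 2 := by
      have h2 := eu 0
      rw [← ev 0, eta, eta] at h2
      linarith
    have h2 : ‖v 0‖ = ‖u 0‖ := (sq_eq_sq₀ (norm_nonneg _) (norm_nonneg _)).1 h1
    rw [norm_div, h2, div_self (norm_ne_zero_iff.2 (hne 0))]
  refine ⟨(v 0 / u 0).arg, fun x => ?_⟩
  have h1 := Complex.norm_mul_exp_arg_mul_I (v 0 / u 0)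
  rw [hnorm, Complex.ofReal_one, one_mul] at h1
  rw [mul_comm Complex.I, h1, ← hconst x 0, div_mul_cancel₀ _ (hne x)]

end QuasilinearGP

/-! ### The proposition -/

theorem proposition1p8 (c κ : ℝ)
    (h : (c, κ) ∈ QuasilinearGP.Dtilde ∪ QuasilinearGP.Ccrit) :
    ∃ A : ℝ, A < 0 ∧ A < 1 - 1 / (2 * κ) ∧ ∀ η₀ : ℝ, η₀ < A →
      ∃ u : ℝ → ℂ, QuasilinearGP.IsCompositeWave c κ η₀ u ∧
        (∀ v : ℝ → ℂ, QuasilinearGP.IsCompositeWave c κ η₀ v →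
          ∃ ϕ : ℝ, ∀ x : ℝ, v x = Complex.exp (Complex.I * (ϕ : ℂ)) * u x) ∧
        QuasilinearGP.InNX u ∧
        (∀ x : ℝ, η₀ ≤ QuasilinearGP.eta u x) ∧
        (QuasilinearGP.nondiffSet u).ncard = 2 ∧
        ((c, κ) ∈ QuasilinearGP.Dtilde →
          QuasilinearGP.singularSet κ u = QuasilinearGP.nondiffSet u) ∧
        ((c, κ) ∈ QuasilinearGP.Ccrit → HasCompactSupport (QuasilinearGP.eta u)) := by
  have hmin1 := min_le_left (QuasilinearGP.etaStar κ) 0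
  have hmin2 := min_le_right (QuasilinearGP.etaStar κ) 0
  have hstar : QuasilinearGP.etaStar κ = 1 - 1 / (2 * κ) := rfl
  -- A convenient, not optimal, threshold: it puts `η₀` below `η*` and keeps the inner factor
  -- positive for all values below `1`.
  refine ⟨min (QuasilinearGP.etaStar κ) 0 - c ^ 2 - 2, by linarith [sq_nonneg c],
    by linarith [sq_nonneg c], fun η₀ hη => ?_⟩
  have ha := QuasilinearGP.admissible_of_mem h hη
  obtain ⟨P, hP⟩ := ha.exists_profileClock
  have hu := hP.isCompositeWave ha
  refine ⟨QuasilinearGP.profileWave c κ η₀ P, hu, fun v hv => hu.eq_phase_mul ha hP hv,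
    (hP.scalarProfile ha).inNX_wave, fun x => ?_, hP.ncard_nondiffSet_profileWave ha,
    fun hD => hP.singularSet_profileWave ha (QuasilinearGP.ne_half_of_mem_Dtilde hD),
    fun hC => hP.hasCompactSupport_eta ha (QuasilinearGP.half_of_mem_Ccrit hC)⟩
  rw [hP.eta_profileWave ha]
  exact ha.le_profEta (P x)
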